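/- Let $N_t\ge 1$, $N_x\ge 3$, $N_\gamma\in\mathbb Z$, $\gamma=2\pi N_\gamma/N_x$, and let $\lambda,\tau\in\mathbb C\setminus\{0\}$ with $\lambda^2+\tau^2\ne 1$. *Lattice.* The nodes $(t,x)$ form the $N_t\times N_x$ square lattice on the twisted torus, $(t,N_x)\equiv(t,0)$ and $(N_t,x)\equiv(0,x+N_\gamma)$. Let $|{\uparrow}\rangle=(1,0)^{T}$ and $|+\rangle=\frac1{\sqrt2}(1,1)^{T}$. For group elements $h^{(h)}_{t,x},h^{(v)}_{t,x}\in SU(2)$ on the horizontal links $(t,x)\to(t,x+1)$ and the vertical links $(t,x)\to(t+1,x)$, and for spins $T_{t,x},L_{t,x}\in\frac12\mathbb N$ on these links, set $$\psi_{LS}=\int_{SU(2)^{N_tN_x}}\prod_{t,x}dg_{t,x}\ \langle\uparrow|g_{t,x+1}^{-1}h^{(h)}_{t,x}g_{t,x}|\uparrow\rangle^{2T_{t,x}}\ \langle+|g_{t+1,x}^{-1}h^{(v)}_{t,x}g_{t,x}|+\rangle^{2L_{t,x}}$$ with normalized Haar measure. *Boundary state.* The coherent spin network is $$\psi_{\lambda,\tau}=\sum_{\{T,L\}}\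 \prod_{t,x}\frac{\lambda^{2L_{t,x}}\tau^{2T_{t,x}}}{(2L_{t,x})!\,(2T_{t,x})!}(J_{t,x}+1)!\ \ \psi_{LS},\qquad J_{t,x}=T_{t,x}+L_{t,x}+T_{t,x-1}+L_{t-1,x},$$ where $(J+1)!=\Gamma(J+2)$, for $|\lambda|+|\tau|<1$; for other couplings it is the analytic continuation of this series in $(\lambda,\tau)$. *Partition function.* The Ponzano–Regge partition function of the solid torus is $$Z(\lambda,\tau)=\int_{SU(2)}dH\ \psi_{\lambda,\tau}\big(h^{(h)}=\mathbb I,\ h^{(v)}_{t,x}=\mathbb I\ (t<N_t-1),\ h^{(v)}_{N_t-1,x}=H\big).$$ *Poles.* For $a\in\mathbb C$ let $X_a$ be the principal value of $\mathrm{arcosh}(a)$, so that $\mathrm{ch}X_a=a$ and $\mathrm{Re}X_a\ge0$, and let $$C_k=\lambda^{-1}\Big[1+\frac{\tau^2+\lambda^2-1}{2-2\tau\cos(2\pi k/N_x)}\Big],\qquad 0\le k\le N_x-1 .$$ Assume that the denominators $2-2\tau\cos(2\pi k/N_x)$ do not vanish and that $\mathrm{Re}\,X_{C_k}>0$ for all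 $k$ (the poles $e^{i\gamma k\pm N_tX_{C_k}}$ are off the unit circle). For $\theta\in\mathbb R$ put $$R(\theta)=\frac{2^{N_t(N_x-2)}}{(\lambda\tau)^{N_tN_x}}\,\frac1{\mathrm{sh}^{2N_t}(\frac12N_xX_{\tau^{-1}})}\sum_{n=0}^{N_x-1}\frac{\sin^2(\theta n+iN_tX_{C_n})}{\mathrm{sh}(N_tX_{C_n})}\prod_{\substack{k=0\\k\ne n}}^{N_x-1}\frac1{2\big[\mathrm{ch}(N_tX_{C_k})-\cos(\theta(n-k)+iN_tX_{C_n})\big]} .$$ **Claim.** 1. For all group elements, the series of the boundary state converges absolutely whenever its couplings satisfy $|\lambda|+|\tau|<1$. 2. At the given couplings, the continued wave-function exists and is unique for every $H\in SU(2)$, and it is integrable in $H$. 3. If the poles $e^{i\gamma k-N_tX_{C_k}}$, $0\le k\le N_x-1$, are pairwise distinct, then $$Z(\lambda,\tau)=R(\gamma).$$ 4. In all cases, also when some of these poles coincide and $R(\gamma)$ has vanishing denominators, $Z(\lambda,\tau)=\lim_{\theta\to\gamma,\ \theta\ne\gamma}R(\theta)$, with $\theta$ real. -/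

import Mathlib

/-!
Objects of the statement: the coherent spin network on the square lattice of a twisted torus,
the Ponzano-Regge amplitude of the solid torus with this boundary state, and the residue sum.
-/

open Filter Topology MeasureTheory

noncomputable section

namespace PonzanoRegge

/-! ### The group `SU(2)` and its normalized Haar measure -/

/-- `SU(2)`. -/
abbrev SU2 : Type := Matrix.specialUnitaryGroup (Fin 2) ℂ

instance : MeasurableSpace SU2 := borel SU2

instance : BorelSpace SU2 := ⟨rfl⟩

instance : IsTopologicalGroup SU2 where
  continuous_inv := by
    refine Continuous.subtype_mk (f := fun g : SU2 => star (g : Matrix (Fin 2) (Fin 2) ℂ)) ?_ _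
    exact continuous_subtype_val.star

instance : CompactSpace SU2 := by
  have hbox : IsCompact (Set.pi Set.univ (fun _ : Fin 2 =>
      Set.pi Set.univ (fun _ : Fin 2 => Metric.closedBall (0 : ℂ) 1))) :=
    isCompact_univ_pi fun _ => isCompact_univ_pi fun _ => isCompact_closedBall 0 1
  have hclosed : IsClosed ((Matrix.specialUnitaryGroup (Fin 2) ℂ :
      Submonoid (Matrix (Fin 2) (Fin 2) ℂ)) : Set (Matrix (Fin 2) (Fin 2) ℂ)) := by
    have h : ((Matrix.specialUnitaryGroup (Fin 2) ℂ :
        Submonoid (Matrix (Fin 2) (Fin 2) ℂ)) : Set (Matrix (Fin 2) (Fin 2) ℂ)) =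
        {A | A * star A = 1} ∩ {A | A.det = 1} := by
      ext A
      simp [Matrix.mem_specialUnitaryGroup_iff, Matrix.mem_unitaryGroup_iff]
    rw [h]
    exact (isClosed_eq (by fun_prop) continuous_const).inter
      (isClosed_eq (by fun_prop) continuous_const)
  refine isCompact_iff_compactSpace.mp (hbox.of_isClosed_subset hclosed ?_)
  intro A hA i _ j _
  have hU : A ∈ Matrix.unitaryGroup (Fin 2) ℂ := (Matrix.mem_specialUnitaryGroup_iff.mp hA).1
  simpa using entry_norm_bound_of_unitary hU i j

/-- The Haar measure of `SU(2)` with total mass one. -/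
def haarSU2 : Measure SU2 := Measure.haarMeasure ⊤

instance : IsProbabilityMeasure haarSU2 :=
  ⟨by simpa [haarSU2] using Measure.haarMeasure_self (G := SU2) (K₀ := ⊤)⟩

/-- The matrix element `⟨v| A |v⟩`. -/
def expect (v : Fin 2 → ℂ) (A : Matrix (Fin 2) (Fin 2) ℂ) : ℂ :=
  star v ⬝ᵥ (A.mulVec v)

/-- The spinor `|↑⟩`. -/
def spinUp : Fin 2 → ℂ := ![1, 0]

/-- The spinor `|+⟩ = (|↑⟩ + |↓⟩) / √2`. -/
def spinPlus : Fin 2 → ℂ := ![((1 / √2 : ℝ) : ℂ), ((1 / √2 : ℝ) : ℂ)]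

/-! ### The square lattice on the twisted torus -/

section Lattice

variable (Nt Nx : ℕ) [NeZero Nt] [NeZero Nx] (Ng : ℤ)

/-- Nodes `(t, x)` with `0 ≤ t < Nt` and `x` modulo `Nx`. -/
abbrev Site : Type := Fin Nt × ZMod Nx

variable {Nt Nx}

/-- The node `(t, x + 1)`. -/
def right (s : Site Nt Nx) : Site Nt Nx := (s.1, s.2 + 1)

/-- The node `(t, x - 1)`. -/
def left (s : Site Nt Nx) : Site Nt Nx := (s.1, s.2 - 1)

/-- The node `(t + 1, x)`, where `(Nt, x)` is identified with `(0, x + Ng)`. -/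
def up (s : Site Nt Nx) : Site Nt Nx :=
  if h : (s.1 : ℕ) + 1 < Nt then (⟨(s.1 : ℕ) + 1, h⟩, s.2) else (0, s.2 + (Ng : ZMod Nx))

/-- The node `(t - 1, x)`, where `(-1, x)` is identified with `(Nt - 1, x - Ng)`. -/
def down (s : Site Nt Nx) : Site Nt Nx :=
  if 0 < (s.1 : ℕ) then (⟨(s.1 : ℕ) - 1, by omega⟩, s.2)
  else (⟨Nt - 1, Nat.sub_lt (Nat.pos_of_ne_zero (NeZero.ne Nt)) one_pos⟩, s.2 - (Ng : ZMod Nx))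

/-! ### The coherent spin network

A spin `j ∈ ℕ/2` is recorded by the natural number `2 * j`: `a s` is twice the spin `T` of the
horizontal link from `s` to `right s`, and `b s` is twice the spin `L` of the vertical link from
`s` to `up s`. -/

/-- The Livine-Speziale spin network wave-function with group elements `hh` on the horizontal and
`hv` on the vertical links, at fixed spins. -/
def psiLS (hh hv : Site Nt Nx → SU2) (a b : Site Nt Nx → ℕ) : ℂ :=
  ∫ g : Site Nt Nx → SU2,
    ∏ s, (expect spinUp ((g (right s))⁻¹ * hh s * g s : SU2) ^ a s
        * expect spinPlus ((g (up Ng s))⁻¹ * hv s * g s : SU2) ^ b s)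
    ∂(Measure.pi fun _ => haarSU2)

/-- Twice the sum `J` of the four spins around a node. -/
def twiceJ (a b : Site Nt Nx → ℕ) (s : Site Nt Nx) : ℕ :=
  a s + b s + a (left s) + b (down Ng s)

/-- The weight `∏ λ^(2L) τ^(2T) (J+1)! / ((2L)! (2T)!)` of a spin configuration, where
`(J+1)! = Γ(J+2)`. (Configurations with some half-integer `J` do not contribute, because their
Livine-Speziale wave-function vanishes.) -/
def weight (lam tau : ℂ) (a b : Site Nt Nx → ℕ) : ℂ :=
  ∏ s, (lam ^ b s * tau ^ a s / (((b s).factorial : ℂ) * ((a s).factorial : ℂ))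
        * ((Real.Gamma ((twiceJ Ng a b s : ℝ) / 2 + 2) : ℝ) : ℂ))

/-- The term of the coherent spin network series for the spin configuration `c`. -/
def coherentTerm (hh hv : Site Nt Nx → SU2) (p : ℂ × ℂ)
    (c : (Site Nt Nx → ℕ) × (Site Nt Nx → ℕ)) : ℂ :=
  weight Ng p.1 p.2 c.1 c.2 * psiLS Ng hh hv c.1 c.2

/-- The sum over all spins defining the coherent spin network with couplings `p = (λ, τ)`. -/
def coherentSeries (hh hv : Site Nt Nx → SU2) (p : ℂ × ℂ) : ℂ :=
  ∑' c, coherentTerm Ng hh hv p c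

end Lattice

/-- The couplings `(λ, τ)` with `|λ| + |τ| < 1`, the domain of convergence of the series. -/
def convergenceDomain : Set (ℂ × ℂ) := {p | ‖p.1‖ + ‖p.2‖ < 1}

/-- `z` is the value at `p` of an analytic continuation of `S` from the convergence domain to some
connected open set of couplings that contains `p`. -/
def IsContinuedValue (S : ℂ × ℂ → ℂ) (p : ℂ × ℂ) (z : ℂ) : Prop :=
  ∃ (U : Set (ℂ × ℂ)) (F : ℂ × ℂ → ℂ), IsOpen U ∧ IsConnected U ∧ convergenceDomain ⊆ U ∧ p ∈ U ∧
    AnalyticOnNhd ℂ F U ∧ Set.EqOn F S convergenceDomain ∧ F p = z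

section Amplitude

variable {Nt Nx : ℕ} [NeZero Nt] [NeZero Nx] (Ng : ℤ)

open Classical in
/-- The wave-function of the coherent spin network with couplings `p = (λ, τ)`: the sum of the
series, continued analytically in the couplings (and `0` where there is no continuation). -/
def coherentState (p : ℂ × ℂ) (hh hv : Site Nt Nx → SU2) : ℂ :=
  if h : ∃ z, IsContinuedValue (coherentSeries Ng hh hv) p z then h.choose else 0

/-- Vertical group elements carrying the holonomy `H` on the last time slice only. -/
def lastSlice (H : SU2) (s : Site Nt Nx) : SU2 := if (s.1 : ℕ) + 1 = Nt then H else 1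

end Amplitude

/-- The Ponzano-Regge partition function of the solid torus, for the coherent spin network on the
`Nt × Nx` square lattice with shift `Ng` and couplings `p = (λ, τ)`. -/
def partitionFunction (Nt Nx : ℕ) [NeZero Nt] [NeZero Nx] (Ng : ℤ) (p : ℂ × ℂ) : ℂ :=
  ∫ H : SU2, coherentState (Nt := Nt) (Nx := Nx) Ng p (fun _ => 1) (lastSlice H) ∂haarSU2

/-! ### The residue sum -/

/-- `X_a = arcosh a`, the principal branch. -/
def arcosh (a : ℂ) : ℂ :=
  Complex.log (a + (a + 1) ^ (1 / 2 : ℂ) * (a - 1) ^ (1 / 2 : ℂ))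

theorem cosh_arcosh (a : ℂ) : Complex.cosh (arcosh a) = a := by
  have h2 : ∀ z : ℂ, (z ^ (1 / 2 : ℂ)) ^ 2 = z := fun z => by simp
  set p := (a + 1) ^ (1 / 2 : ℂ) with hp
  set q := (a - 1) ^ (1 / 2 : ℂ) with hq
  have hp2 : p ^ 2 = a + 1 := h2 _
  have hq2 : q ^ 2 = a - 1 := h2 _
  have hprod : (a + p * q) * (a - p * q) = 1 := by
    linear_combination (-q ^ 2) * hp2 - (a + 1) * hq2
  have hne : a + p * q ≠ 0 := left_ne_zero_of_mul_eq_one hprod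
  have hinv : (a + p * q)⁻¹ = a - p * q := inv_eq_of_mul_eq_one_right hprod
  rw [arcosh, ← hp, ← hq, Complex.cosh, Complex.exp_neg, Complex.exp_log hne, hinv]
  ring

theorem arcosh_re_nonneg (a : ℂ) : 0 ≤ (arcosh a).re := by
  unfold arcosh
  have h2 : ∀ z : ℂ, (z ^ (1 / 2 : ℂ)) ^ 2 = z := fun z => by simp
  have hpol : ∀ z : ℂ, 0 ≤ (z ^ (1 / 2 : ℂ)).re ∧
      ((z ^ (1 / 2 : ℂ)).re = 0 → 0 ≤ (z ^ (1 / 2 : ℂ)).im) := fun z => by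
    by_cases hz : z = 0
    · simp [hz]
    have h1 : z ^ (1/2:ℂ) = Complex.exp (Complex.log z * (1/2:ℂ)) := Complex.cpow_def_of_ne_zero hz _
    have him : (Complex.log z * (1/2:ℂ)).im = Complex.arg z / 2 := by
      have : Complex.log z * (1/2:ℂ) = Complex.log z * ((1/2:ℝ):ℂ) := by push_cast; ring
      rw [this, Complex.im_mul_ofReal, Complex.log_im]; ring
    have ha := Complex.neg_pi_lt_arg z
    have hb := Complex.arg_le_pi z
    rw [h1, Complex.exp_re, Complex.exp_im, him]
    refine ⟨mul_nonneg (Real.exp_pos _).le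
      (Real.cos_nonneg_of_neg_pi_div_two_le_of_le (by linarith) (by linarith)), fun h => ?_⟩
    have hc : Real.cos (Complex.arg z / 2) = 0 :=
      (mul_eq_zero.mp h).resolve_left (Real.exp_pos _).ne'
    have hle : Real.pi ≤ Complex.arg z := by
      by_contra hlt
      exact (Real.cos_pos_of_mem_Ioo ⟨by linarith, by linarith⟩).ne' hc
    exact mul_nonneg (Real.exp_pos _).le
      (Real.sin_nonneg_of_nonneg_of_le_pi (by linarith [Real.pi_pos]) (by linarith [Real.pi_pos]))
  obtain ⟨hp0, hp1⟩ := hpol (a + 1)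
  obtain ⟨hq0, hq1⟩ := hpol (a - 1)
  have hp2 := h2 (a + 1)
  have hq2 := h2 (a - 1)
  generalize (a + 1) ^ (1 / 2 : ℂ) = p at *
  generalize (a - 1) ^ (1 / 2 : ℂ) = q at *
  have hip : 2 * (p.re * p.im) = a.im := by
    have := congrArg Complex.im hp2; simp [pow_two] at this; linarith
  have hiq : 2 * (q.re * q.im) = a.im := by
    have := congrArg Complex.im hq2; simp [pow_two] at this; linarith
  have key : 0 ≤ p.re * q.re + p.im * q.im := by
    rcases hp0.eq_or_lt with h | h
    · rcases hq0.eq_or_lt with h' | h'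
      · rw [← h, ← h']
        have := mul_nonneg (hp1 h.symm) (hq1 h'.symm)
        linarith
      · have : q.im = 0 := by
          rw [← h] at hip
          have : q.re * q.im = 0 := by linarith
          exact (mul_eq_zero.mp this).resolve_left h'.ne'
        simp [← h, this]
    · rcases hq0.eq_or_lt with h' | h'
      · have : p.im = 0 := by
          rw [← h'] at hiq
          have : p.re * p.im = 0 := by linarith
          exact (mul_eq_zero.mp this).resolve_left h.ne'
        simp [← h', this]
      · have h3 : 0 ≤ (p.re * q.re) * (p.im * q.im) := by
          have : (p.re * q.re) * (p.im * q.im) = (a.im / 2) ^ 2 := by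
            linear_combination (q.re * q.im / 2) * hip + (a.im / 4) * hiq
          rw [this]; positivity
        have := nonneg_of_mul_nonneg_right h3 (mul_pos h h')
        positivity
  have hprod : (a + p * q) * (a - p * q) = 1 := by
    linear_combination (-q ^ 2) * hp2 - (a + 1) * hq2
  have hn : ‖a + p * q‖ * ‖a - p * q‖ = 1 := by rw [← norm_mul, hprod, norm_one]
  have e1 : ‖p + q‖ ^ 2 = 2 * ‖a + p * q‖ := by
    rw [← norm_pow, show (p + q) ^ 2 = 2 * (a + p * q) by linear_combination hp2 + hq2]
    simp
  have e2 : ‖p - q‖ ^ 2 = 2 * ‖a - p * q‖ := by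
    rw [← norm_pow, show (p - q) ^ 2 = 2 * (a - p * q) by linear_combination hp2 + hq2]
    simp
  have e3 : ‖p - q‖ ^ 2 ≤ ‖p + q‖ ^ 2 := by
    rw [← Complex.normSq_eq_norm_sq, ← Complex.normSq_eq_norm_sq, Complex.normSq_apply,
      Complex.normSq_apply]
    simp only [Complex.add_re, Complex.add_im, Complex.sub_re, Complex.sub_im]
    nlinarith
  rw [Complex.log_re]
  apply Real.log_nonneg
  nlinarith [norm_nonneg (a + p * q), norm_nonneg (a - p * q)]

/-- `C_k = λ⁻¹ [1 + (τ² + λ² - 1) / (2 - 2 τ cos (2πk/Nx))]`. -/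
def coefC (Nx : ℕ) (lam tau : ℂ) (k : ℕ) : ℂ :=
  lam⁻¹ * (1 + (tau ^ 2 + lam ^ 2 - 1)
    / (2 - 2 * tau * Complex.cos (2 * Real.pi * k / Nx)))

/-- `N_t X_{C_k}`. -/
def tX (Nt Nx : ℕ) (lam tau : ℂ) (k : ℕ) : ℂ := Nt * arcosh (coefC Nx lam tau k)

/-- The twist angle `2π Ng / Nx`. -/
def twistAngle (Nx : ℕ) (Ng : ℤ) : ℝ := 2 * Real.pi * Ng / Nx

/-- The pole `e^{iγk} e^{-N_t X_{C_k}}` of the class-angle integrand in the variable `e^{iφ}`. -/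
def pole (Nt Nx : ℕ) (lam tau : ℂ) (γ : ℝ) (k : ℕ) : ℂ :=
  Complex.exp (Complex.I * γ * k) * Complex.exp (-tX Nt Nx lam tau k)

/-- The prefactor times the sum of the residues, as a function of the angle `γ`. -/
def residueSum (Nt Nx : ℕ) (lam tau : ℂ) (γ : ℝ) : ℂ :=
  2 ^ (Nt * (Nx - 2)) / (lam * tau) ^ (Nt * Nx)
    * (1 / Complex.sinh (1 / 2 * Nx * arcosh tau⁻¹) ^ (2 * Nt))
    * ∑ n ∈ Finset.range Nx,
        Complex.sin (γ * n + Complex.I * tX Nt Nx lam tau n) ^ 2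
          / Complex.sinh (tX Nt Nx lam tau n)
        * ∏ k ∈ (Finset.range Nx).erase n,
            1 / (2 * (Complex.cosh (tX Nt Nx lam tau k)
              - Complex.cos (γ * ((n : ℂ) - k) + Complex.I * tX Nt Nx lam tau n)))

end PonzanoRegge

end

noncomputable section

namespace PonzanoRegge

open ComplexConjugate

set_option linter.unusedSectionVars false

/-! ### Complex Gaussian integrals -/

/-! The factor `(J+1)! = Γ(J+2)` at a node is, up to `π²`, the moment of order `2J` of the norm
under the Gaussian `exp(-|ζ|²)` on `ℂ² ≅ ℝ⁴`. A spinor `ζ` is a norm times an element of `SU(2)`, so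
these factors turn the Haar integrals at the nodes into Gaussian integrals over spinors
(`integral_quat_mul_exp`, `coherentTerm_eq_integral`). The factorials of the weight then make the
sum over spins an exponential series. Every link matrix element is bounded by the product of the
norms at its two ends, so the exponent is at most `(|λ|+|τ|) Σ|ζ|²`; for `|λ|+|τ| < 1` the Gaussian
wins and sum and integral may be exchanged (`hasSum_coherentTerm`).

Conjugating the holonomy does not change the series, so it may be taken diagonal with eigenvalues
`exp(±iφ)`. The exponent is then sesquilinear, and the series is the inverse of a determinant
(`coherentSeries_diag`). Plane waves on the twisted torus reduce the determinant to one factor per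
mode. The product over the vertical momenta collapses by `prod_cosh_sub_cos`, leaving a constant
times `∏ 2(ch(N_t X_{C_k}) - cos(φ - γk))` (`det_gaussMatrix_eq`). This determinant is polynomial in
the couplings, so its inverse continues the series uniquely to the complement of its zeros
(`isContinuedValue_inv_iff`), a set which contains the given couplings because no `exp(±N_t
X_{C_k})` has modulus one.

The integral over `H` becomes an integral over the class angle with weight `sin²φ`
(`integral_SU2_class`). In the variable `z = exp(iφ)` it is a contour integral over the unit circle,
whose poles inside are the numbers `exp(iγk - N_t X_{C_k})`; if they are distinct, the residues give
`R(γ)` (`integral_sin_sq_mul_modeProduct`). The angular integral is continuous in `γ` even where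
poles collide, and collisions are isolated in `γ`; this gives the limit formula. -/

/-- In real coordinates this is a product of two real Gaussians with complex linear terms. The
coefficients `b` and `c` are independent, not conjugate, since the matrices treated below are not
Hermitian. -/
theorem integral_complex_gaussian {a : ℂ} (ha : 0 < a.re) (b c : ℂ) :
    ∫ z : ℂ, Complex.exp (-(a * (conj z * z) + b * conj z + c * z))
      = Real.pi / a * Complex.exp (b * c / a) := by
  have ha0 : a ≠ 0 := by rintro rfl; simp at ha
  rw [← Complex.volume_preserving_equiv_real_prod.symm.integral_comp
    (MeasurableEquiv.measurableEmbedding _)]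
  have h : ∀ p : ℝ × ℝ, Complex.exp (-(a * (conj (Complex.measurableEquivRealProd.symm p)
        * Complex.measurableEquivRealProd.symm p)
        + b * conj (Complex.measurableEquivRealProd.symm p)
        + c * Complex.measurableEquivRealProd.symm p))
      = Complex.exp (-a * (p.1 : ℂ) ^ 2 + (-(b + c)) * p.1 + 0)
        * Complex.exp (-a * (p.2 : ℂ) ^ 2 + (Complex.I * (b - c)) * p.2 + 0) := by
    rintro ⟨x, y⟩
    have e : Complex.measurableEquivRealProd.symm (x, y) = x + y * Complex.I := by
      apply Complex.ext <;> simp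
    rw [e, ← Complex.exp_add]
    simp only [map_add, map_mul, Complex.conj_ofReal, Complex.conj_I]
    congr 1
    linear_combination (a * (y : ℂ) ^ 2) * Complex.I_sq
  simp_rw [h]
  rw [Measure.volume_eq_prod, integral_prod_mul
    (f := fun x : ℝ => Complex.exp (-a * (x : ℂ) ^ 2 + (-(b + c)) * x + 0))
    (g := fun x : ℝ => Complex.exp (-a * (x : ℂ) ^ 2 + (Complex.I * (b - c)) * x + 0)),
    integral_cexp_quadratic (by simpa using ha), integral_cexp_quadratic (by simpa using ha)]
  rw [mul_mul_mul_comm, ← Complex.exp_add, ← pow_two, neg_neg]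
  congr 1
  · rw [one_div]; exact Complex.cpow_nat_inv_pow _ two_ne_zero
  · congr 1
    field_simp
    linear_combination ((b - c) ^ 2) * Complex.I_sq

/-- The sesquilinear form of a matrix on the diagonal. -/
def sesq {ι : Type*} [Fintype ι] (A : Matrix ι ι ℂ) (z : ι → ℂ) : ℂ :=
  ∑ i, ∑ j, conj (z i) * A i j * z j

theorem continuous_sesq {ι : Type*} [Fintype ι] (A : Matrix ι ι ℂ) : Continuous (sesq A) := by
  unfold sesq
  fun_prop

theorem integrable_exp_neg_sum_normSq {ι : Type*} [Fintype ι] {ε : ℝ} (hε : 0 < ε) :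
    Integrable (fun z : ι → ℂ => Real.exp (-(ε * ∑ i, ‖z i‖ ^ 2))) := by
  have h1 : Integrable (fun z : ℂ => Real.exp (-(ε * ‖z‖ ^ 2))) := by
    have := (GaussianFourier.integrable_cexp_neg_mul_sq_norm_add (V := ℂ) (b := (ε : ℂ))
      (by simpa using hε) 0 0).norm
    refine this.congr (Eventually.of_forall fun z => ?_)
    simp only [Complex.norm_exp]
    congr 1
    simp [← Complex.ofReal_pow]
  have h2 := Integrable.fintype_prod (ι := ι) (μ := fun _ => (volume : Measure ℂ))
    (f := fun _ z => Real.exp (-(ε * ‖z‖ ^ 2))) fun _ => h1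
  refine h2.congr (Eventually.of_forall fun z => ?_)
  simp only [← Real.exp_sum, Finset.sum_neg_distrib, Finset.mul_sum]

theorem integrable_exp_neg_sesq {ι : Type*} [Fintype ι] {A : Matrix ι ι ℂ} {ε : ℝ} (hε : 0 < ε)
    (hA : ∀ z, ε * ∑ i, ‖z i‖ ^ 2 ≤ (sesq A z).re) :
    Integrable (fun z : ι → ℂ => Complex.exp (-sesq A z)) := by
  refine (integrable_exp_neg_sum_normSq hε).mono'
    (Complex.continuous_exp.comp (continuous_sesq A).neg).aestronglyMeasurable
    (Eventually.of_forall fun z => ?_)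
  rw [Complex.norm_exp, Complex.neg_re]
  exact Real.exp_le_exp.2 (neg_le_neg (hA z))

/-- Integrating out the first variable leaves the Gaussian of the Schur complement `S` of the entry
`a = A 0 0`, with a factor `π / a`, while `det A = a * det S`. Only the real part of the form is
assumed coercive, and this property passes to `S`. -/
theorem gaussian_integral_fin (n : ℕ) (A : Matrix (Fin n) (Fin n) ℂ) {ε : ℝ} (hε : 0 < ε)
    (hA : ∀ z, ε * ∑ i, ‖z i‖ ^ 2 ≤ (sesq A z).re) :
    A.det ≠ 0 ∧ ∫ z : Fin n → ℂ, Complex.exp (-sesq A z) = Real.pi ^ n / A.det := by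
  induction n with
  | zero => simp [sesq, Measure.volume_pi_eq_dirac (fun _ : Fin 0 => (0 : ℂ))]
  | succ n ih =>
    set a := A 0 0 with ha
    have ha_re : 0 < a.re := by
      have h := hA (Pi.single 0 1)
      have e : sesq A (Pi.single 0 1) = a := by
        simp [sesq, Pi.single_apply, ha]
      have e2 : ∑ i : Fin (n + 1), ‖(Pi.single 0 1 : Fin (n + 1) → ℂ) i‖ ^ 2 = 1 := by
        simp [Fin.sum_univ_succ]
      rw [e, e2, mul_one] at h
      linarith
    have ha0 : a ≠ 0 := fun h => by simp [h] at ha_re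
    set S : Matrix (Fin n) (Fin n) ℂ :=
      fun i j => A i.succ j.succ - A i.succ 0 / a * A 0 j.succ with hS
    have hdet : A.det = a * S.det := by
      have h1 : A.det = (Matrix.of fun i j => A i j
          - (Fin.cons 0 (fun i => A (Fin.succ i) 0 / a) : Fin (n + 1) → ℂ) i * A 0 j).det := by
        refine Matrix.det_eq_of_forall_row_eq_smul_add_const
          (Fin.cons 0 (fun i => A (Fin.succ i) 0 / a) : Fin (n + 1) → ℂ) 0 (by simp) ?_
        intro i j
        simp
      rw [h1, Matrix.det_succ_column_zero, Fin.sum_univ_succ]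
      have h2 : ∀ i : Fin n, A i.succ 0 - A i.succ 0 / a * A 0 0 = 0 := fun i => by
        rw [← ha]; field_simp; ring
      simp only [Matrix.of_apply, Fin.cons_succ, h2]
      simp only [Fin.coe_ofNat_eq_mod, Nat.zero_mod, pow_zero, Fin.cons_zero, zero_mul, sub_zero,
        one_mul, mul_zero, Finset.sum_const_zero, add_zero, ← ha]
      congr 1
    have hsplit : ∀ (z0 : ℂ) (w : Fin n → ℂ), sesq A (Fin.cons z0 w) =
        a * (conj z0 * z0) + (∑ j, A 0 j.succ * w j) * conj z0
          + (∑ i, conj (w i) * A i.succ 0) * z0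
          + (sesq S w + (∑ j, A 0 j.succ * w j) * (∑ i, conj (w i) * A i.succ 0) / a) := by
      intro z0 w
      have e3 : (∑ j, A 0 j.succ * w j) * (∑ i, conj (w i) * A i.succ 0) / a
          = ∑ i, ∑ j, conj (w i) * (A i.succ 0 / a * A 0 j.succ) * w j := by
        rw [Finset.sum_mul_sum, Finset.sum_comm, Finset.sum_div]
        refine Finset.sum_congr rfl fun i _ => ?_
        rw [Finset.sum_div]
        exact Finset.sum_congr rfl fun j _ => by ring
      have e2 : ∀ x : Fin n, conj z0 * A 0 x.succ * w x = A 0 x.succ * w x * conj z0 :=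
        fun x => by ring
      rw [e3]
      simp only [sesq, Fin.sum_univ_succ, Fin.cons_zero, Fin.cons_succ, hS, Finset.sum_add_distrib,
        Finset.sum_mul, mul_sub, sub_mul, Finset.sum_sub_distrib, e2]
      ring
    have hSpos : ∀ w, ε * ∑ i, ‖w i‖ ^ 2 ≤ (sesq S w).re := by
      intro w
      -- This first coordinate makes the coefficient of its own conjugate vanish and cancels the
      -- remaining cross term, so the form of `A` takes exactly the value of the form of `S`.
      have h := hA (Fin.cons (-(∑ j, A 0 j.succ * w j) / a) w)
      rw [hsplit] at h
      have e : a * (conj (-(∑ j, A 0 j.succ * w j) / a) * (-(∑ j, A 0 j.succ * w j) / a))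
          + (∑ j, A 0 j.succ * w j) * conj (-(∑ j, A 0 j.succ * w j) / a)
          + (∑ i, conj (w i) * A i.succ 0) * (-(∑ j, A 0 j.succ * w j) / a)
          + (sesq S w + (∑ j, A 0 j.succ * w j) * (∑ i, conj (w i) * A i.succ 0) / a)
          = sesq S w := by
        generalize conj (-(∑ j, A 0 j.succ * w j) / a) = u
        field_simp
        ring
      rw [e] at h
      refine le_trans (mul_le_mul_of_nonneg_left ?_ hε.le) h
      rw [Fin.sum_univ_succ]
      simp only [Fin.cons_succ]
      exact le_add_of_nonneg_left (by positivity)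
    obtain ⟨hS0, hSint⟩ := ih S hSpos
    refine ⟨by rw [hdet]; exact mul_ne_zero ha0 hS0, ?_⟩
    have hI := integrable_exp_neg_sesq hε hA
    have mp := (volume_preserving_piFinSuccAbove (fun _ : Fin (n + 1) => ℂ) 0).symm
    rw [← mp.integral_comp (MeasurableEquiv.measurableEmbedding _)]
    rw [← mp.integrable_comp_emb (MeasurableEquiv.measurableEmbedding _)] at hI
    rw [Measure.volume_eq_prod] at hI ⊢
    rw [integral_prod_symm (fun p : ℂ × (Fin n → ℂ) => Complex.exp (-sesq A
      ((MeasurableEquiv.piFinSuccAbove (fun _ : Fin (n + 1) => ℂ) 0).symm p))) hI]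
    have hin : ∀ w : Fin n → ℂ, ∫ z0 : ℂ, Complex.exp (-sesq A
        ((MeasurableEquiv.piFinSuccAbove (fun _ : Fin (n + 1) => ℂ) 0).symm (z0, w)))
        = Real.pi / a * Complex.exp (-sesq S w) := by
      intro w
      have e : ∀ z0 : ℂ, (MeasurableEquiv.piFinSuccAbove (fun _ : Fin (n + 1) => ℂ) 0).symm (z0, w)
          = Fin.cons z0 w := fun z0 => by
        simp [MeasurableEquiv.piFinSuccAbove, Fin.insertNthEquiv]
      simp_rw [e, hsplit, neg_add _ (sesq S w + _), Complex.exp_add]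
      rw [integral_mul_const, integral_complex_gaussian ha_re, mul_assoc, ← Complex.exp_add]
      congr 2
      ring
    simp_rw [hin]
    rw [integral_const_mul, hSint, hdet, pow_succ]
    field_simp

theorem gaussian_integral {ι : Type*} [Fintype ι] [DecidableEq ι] (A : Matrix ι ι ℂ) {ε : ℝ}
    (hε : 0 < ε) (hA : ∀ z, ε * ∑ i, ‖z i‖ ^ 2 ≤ (sesq A z).re) :
    A.det ≠ 0 ∧ ∫ z : ι → ℂ, Complex.exp (-sesq A z) = Real.pi ^ Fintype.card ι / A.det := by
  set e := Fintype.equivFin ι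
  have hs : ∀ z : Fin (Fintype.card ι) → ℂ, sesq (A.submatrix e.symm e.symm) z
      = sesq A (fun i => z (e i)) := by
    intro z
    simp only [sesq, Matrix.submatrix_apply]
    rw [← e.symm.sum_comp]
    refine Finset.sum_congr rfl fun i _ => ?_
    rw [← e.symm.sum_comp]
    simp
  have h := gaussian_integral_fin _ (A.submatrix e.symm e.symm) hε (fun z => by
    rw [hs]
    refine le_trans (le_of_eq ?_) (hA _)
    rw [← e.sum_comp])
  rw [Matrix.det_submatrix_equiv_self] at h
  refine ⟨h.1, ?_⟩
  rw [← h.2]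
  have mp := volume_measurePreserving_piCongrLeft (fun _ : Fin (Fintype.card ι) => ℂ) e
  rw [← mp.integral_comp (MeasurableEquiv.measurableEmbedding _)]
  congr 1
  ext z
  rw [hs]
  congr 3
  ext i
  exact (Equiv.piCongrLeft_apply_apply (P := fun _ => ℂ) e z i).symm

/-! ### Spinors, quaternions and averages over `SU(2)` -/

/-- The spinors `ℂ²` with the Euclidean norm. -/
abbrev Spinor : Type := EuclideanSpace ℂ (Fin 2)

/-- The real multiple of an `SU(2)` matrix with first row `ζ`. -/
def quat (ζ : Spinor) : Matrix (Fin 2) (Fin 2) ℂ := !![ζ 0, ζ 1; -conj (ζ 1), conj (ζ 0)]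

theorem Spinor.norm_sq (ζ : Spinor) : ‖ζ‖ ^ 2 = ‖ζ 0‖ ^ 2 + ‖ζ 1‖ ^ 2 := by
  simp [EuclideanSpace.norm_sq_eq]

theorem Spinor.norm_sq_cast (ζ : Spinor) :
    ((‖ζ‖ : ℂ)) ^ 2 = conj (ζ 0) * ζ 0 + conj (ζ 1) * ζ 1 := by
  rw [← Complex.ofReal_pow, Spinor.norm_sq]
  simp [Complex.conj_mul']

theorem det_quat (ζ : Spinor) : (quat ζ).det = (‖ζ‖ : ℂ) ^ 2 := by
  rw [Spinor.norm_sq_cast, quat, Matrix.det_fin_two_of]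
  ring

theorem continuous_quat : Continuous quat := by
  unfold quat
  refine continuous_matrix fun i j => ?_
  fin_cases i <;> fin_cases j <;> simp <;> fun_prop

theorem quat_smul (r : ℝ) (ζ : Spinor) : quat (r • ζ) = (r : ℂ) • quat ζ := by
  ext i j
  fin_cases i <;> fin_cases j <;> simp [quat]

theorem quat_mem_SU2 {ζ : Spinor} (h : ‖ζ‖ = 1) :
    quat ζ ∈ Matrix.specialUnitaryGroup (Fin 2) ℂ := by
  have hn := Spinor.norm_sq_cast ζ
  rw [h, Complex.ofReal_one] at hn
  rw [Matrix.mem_specialUnitaryGroup_iff, det_quat, h, Matrix.mem_unitaryGroup_iff]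
  refine ⟨?_, by simp⟩
  ext i j
  fin_cases i <;> fin_cases j <;> simp [quat, Matrix.mul_apply, Fin.sum_univ_two, Matrix.star_apply]
  · linear_combination -hn
  · ring
  · ring
  · linear_combination -hn

/-- Polar decomposition of a quaternion; at `ζ = 0` any group element serves. -/
theorem exists_quat_eq (ζ : Spinor) : ∃ g : SU2, quat ζ = (‖ζ‖ : ℂ) • (g : Matrix (Fin 2) (Fin 2) ℂ) := by
  rcases eq_or_ne ζ 0 with rfl | h
  · refine ⟨1, ?_⟩
    have := quat_smul 0 0
    simpa using this
  · have hn : ‖ζ‖ ≠ 0 := norm_ne_zero_iff.2 h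
    refine ⟨⟨quat (‖ζ‖⁻¹ • ζ), quat_mem_SU2 (by simp [norm_smul, hn])⟩, ?_⟩
    rw [← quat_smul, smul_smul, mul_inv_cancel₀ hn, one_smul]

instance : SecondCountableTopology SU2 := by
  have : SecondCountableTopology (Matrix (Fin 2) (Fin 2) ℂ) :=
    inferInstanceAs (SecondCountableTopology (Fin 2 → Fin 2 → ℂ))
  exact TopologicalSpace.Subtype.secondCountableTopology _

theorem SU2.coe_inv (g : SU2) : ((g⁻¹ : SU2) : Matrix (Fin 2) (Fin 2) ℂ)
    = star (g : Matrix (Fin 2) (Fin 2) ℂ) := rfl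

theorem SU2.apply_one (g : SU2) : (g : Matrix (Fin 2) (Fin 2) ℂ) 1 0
      = -conj ((g : Matrix (Fin 2) (Fin 2) ℂ) 0 1) ∧
    (g : Matrix (Fin 2) (Fin 2) ℂ) 1 1 = conj ((g : Matrix (Fin 2) (Fin 2) ℂ) 0 0) := by
  have hdet : (g : Matrix (Fin 2) (Fin 2) ℂ).det = 1 := (Matrix.mem_specialUnitaryGroup_iff.1 g.2).2
  have h1 : star (g : Matrix (Fin 2) (Fin 2) ℂ) = (g : Matrix (Fin 2) (Fin 2) ℂ).adjugate := by
    have h2 : (g : Matrix (Fin 2) (Fin 2) ℂ) * star (g : Matrix (Fin 2) (Fin 2) ℂ) = 1 :=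
      Matrix.mem_unitaryGroup_iff.1 (Matrix.mem_specialUnitaryGroup_iff.1 g.2).1
    have h3 := Matrix.adjugate_mul (g : Matrix (Fin 2) (Fin 2) ℂ)
    rw [hdet, one_smul] at h3
    calc _ = (Matrix.adjugate (g : Matrix (Fin 2) (Fin 2) ℂ) * (g : Matrix (Fin 2) (Fin 2) ℂ))
          * star (g : Matrix (Fin 2) (Fin 2) ℂ) := by rw [h3, one_mul]
      _ = _ := by rw [mul_assoc, h2, mul_one]
  rw [Matrix.adjugate_fin_two] at h1
  have h01 := congrFun (congrFun h1 1) 0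
  have h11 := congrFun (congrFun h1 0) 0
  simp [Matrix.star_apply] at h01 h11
  exact ⟨by rw [h01]; ring, h11.symm⟩

/-- Right multiplication of spinors (row vectors) by a matrix of `SU(2)`. -/
def rightMul (g : SU2) (ζ : Spinor) : Spinor :=
  WithLp.toLp 2 (Matrix.vecMul (WithLp.ofLp ζ) (g : Matrix (Fin 2) (Fin 2) ℂ))

theorem quat_rightMul (g : SU2) (ζ : Spinor) :
    quat (rightMul g ζ) = quat ζ * (g : Matrix (Fin 2) (Fin 2) ℂ) := by
  obtain ⟨h0, h1⟩ := SU2.apply_one g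
  ext i j
  fin_cases i <;> fin_cases j <;>
    simp [quat, rightMul, Matrix.mul_apply, Matrix.vecMul, dotProduct, Fin.sum_univ_two, h0, h1]
  all_goals ring

/-- The squared norm is the determinant of `quat`, which right multiplication by a matrix of
determinant one preserves. -/
theorem norm_rightMul (g : SU2) (ζ : Spinor) : ‖rightMul g ζ‖ = ‖ζ‖ := by
  have hdet : (g : Matrix (Fin 2) (Fin 2) ℂ).det = 1 := (Matrix.mem_specialUnitaryGroup_iff.1 g.2).2
  have h := congrArg Matrix.det (quat_rightMul g ζ)
  rw [Matrix.det_mul, hdet, mul_one, det_quat, det_quat] at h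
  exact (sq_eq_sq₀ (norm_nonneg _) (norm_nonneg _)).1 (by exact_mod_cast h)

theorem measurePreserving_rightMul (g : SU2) : MeasurePreserving (rightMul g) := by
  let L : Spinor →ₗᵢ[ℝ] Spinor :=
    { toFun := rightMul g
      map_add' := fun x y => by simp [rightMul, Matrix.add_vecMul]
      map_smul' := fun c x => by simp [rightMul, Matrix.smul_vecMul]
      norm_map' := norm_rightMul g }
  exact (L.toLinearIsometryEquiv rfl).measurePreserving

theorem measurePreserving_rightMul_pi {σ : Type*} [Fintype σ] (g : σ → SU2) :
    MeasurePreserving (fun (ζ : σ → Spinor) s => rightMul (g s) (ζ s)) :=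
  volume_preserving_pi fun s => measurePreserving_rightMul (g s)

theorem finrank_spinor : Module.finrank ℝ Spinor = 4 := by
  rw [← Module.finrank_mul_finrank ℝ ℂ Spinor]
  simp

theorem integral_exp_neg_norm_sq_spinor :
    ∫ ζ : Spinor, Real.exp (-‖ζ‖ ^ 2) = Real.pi ^ 2 := by
  have h := GaussianFourier.integral_cexp_neg_mul_sq_norm_add (V := Spinor) (b := 1)
    (by simp) 0 0
  rw [finrank_spinor] at h
  have h2 : ((∫ ζ : Spinor, Real.exp (-‖ζ‖ ^ 2) : ℝ) : ℂ) = (Real.pi : ℂ) ^ 2 := by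
    rw [← integral_complex_ofReal]
    convert h using 1
    · congr 1; ext v; simp
    · norm_num
  exact_mod_cast h2

/-- Radial integration in real dimension four gives the Gamma value up to a constant independent of
`n`. The constant involves the volume of the unit ball; the known Gaussian integral at `n = 0` fixes
it. -/
theorem integral_norm_pow_mul_exp_spinor (n : ℕ) :
    ∫ ζ : Spinor, ‖ζ‖ ^ n * Real.exp (-‖ζ‖ ^ 2) = Real.pi ^ 2 * Real.Gamma ((n : ℝ) / 2 + 2) := by
  have key : ∀ m : ℕ, ∫ ζ : Spinor, ‖ζ‖ ^ m * Real.exp (-‖ζ‖ ^ 2)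
      = 2 * (volume : Measure Spinor).real (Metric.ball 0 1) * Real.Gamma ((m : ℝ) / 2 + 2) := by
    intro m
    rw [integral_fun_norm_addHaar volume (fun r => r ^ m * Real.exp (-r ^ 2)), finrank_spinor]
    have h := integral_rpow_mul_exp_neg_rpow (p := 2) (q := (m : ℝ) + 3) two_pos (by
      have : (0 : ℝ) ≤ m := m.cast_nonneg
      linarith)
    have e : ∫ y in Set.Ioi (0 : ℝ), y ^ (4 - 1) • (y ^ m * Real.exp (-y ^ 2))
        = 1 / 2 * Real.Gamma ((m : ℝ) / 2 + 2) := by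
      rw [show (m : ℝ) / 2 + 2 = ((m : ℝ) + 3 + 1) / 2 by ring, ← h]
      refine setIntegral_congr_fun measurableSet_Ioi fun y _ => ?_
      have : ((m : ℝ) + 3) = ((m + 3 : ℕ) : ℝ) := by push_cast; ring
      simp only [this, Real.rpow_natCast, Real.rpow_ofNat, smul_eq_mul]
      ring
    rw [e]
    simp only [nsmul_eq_mul, smul_eq_mul]
    push_cast
    ring
  have h0 := key 0
  simp only [pow_zero, one_mul, integral_exp_neg_norm_sq_spinor, Nat.cast_zero, zero_div, zero_add,
    Real.Gamma_two, mul_one] at h0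
  rw [key, ← h0]

theorem integrable_norm_pow_mul_exp_spinor (n : ℕ) :
    Integrable (fun ζ : Spinor => ‖ζ‖ ^ n * Real.exp (-‖ζ‖ ^ 2)) := by
  refine Integrable.of_integral_ne_zero ?_
  rw [integral_norm_pow_mul_exp_spinor]
  have : 0 < Real.Gamma ((n : ℝ) / 2 + 2) := Real.Gamma_pos_of_pos (by positivity)
  exact ne_of_gt (by positivity)

/-- The Gaussian measure is invariant under right multiplication of each spinor by `SU(2)`, so the
integrand may be averaged over such multiplications. After exchanging the integrals, for fixed `ζ`
the homogeneity of `P` extracts the norms, and left invariance of Haar measure absorbs the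
directions. What remains is a product of radial moments times the Haar average of `P`. -/
theorem integral_quat_mul_exp {σ : Type*} [Fintype σ]
    (P : (σ → Matrix (Fin 2) (Fin 2) ℂ) → ℂ) (hP : Continuous P) (n : σ → ℕ)
    (hhom : ∀ (r : σ → ℝ) M, P (fun s => (r s : ℂ) • M s) = (∏ s, (r s : ℂ) ^ n s) * P M) :
    ∫ ζ : σ → Spinor, P (fun s => quat (ζ s)) * (Real.exp (-∑ s, ‖ζ s‖ ^ 2) : ℝ)
      = (∏ s, ((Real.pi ^ 2 * Real.Gamma ((n s : ℝ) / 2 + 2) : ℝ) : ℂ))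
        * ∫ g : σ → SU2, P (fun s => (g s : Matrix (Fin 2) (Fin 2) ℂ))
            ∂(Measure.pi fun _ => haarSU2) := by
  have : haarSU2.IsMulLeftInvariant := by unfold haarSU2; infer_instance
  set μ : Measure (σ → SU2) := Measure.pi fun _ => haarSU2 with hμ
  set w : (σ → Spinor) → ℝ := fun ζ => Real.exp (-∑ s, ‖ζ s‖ ^ 2) with hw
  have hwprod : ∀ ζ, (∏ s, ‖ζ s‖ ^ n s) * w ζ = ∏ s, (‖ζ s‖ ^ n s * Real.exp (-‖ζ s‖ ^ 2)) := by
    intro ζ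
    rw [hw, Finset.prod_mul_distrib, ← Real.exp_sum, Finset.sum_neg_distrib]
  have hwint : Integrable (fun ζ : σ → Spinor => (∏ s, ‖ζ s‖ ^ n s) * w ζ) := by
    simp_rw [hwprod]
    exact Integrable.fintype_prod (μ := fun _ => (volume : Measure Spinor))
      (f := fun s (ζ : Spinor) => ‖ζ‖ ^ n s * Real.exp (-‖ζ‖ ^ 2))
      fun s => integrable_norm_pow_mul_exp_spinor (n s)
  have hcoe : Continuous fun g : σ → SU2 => P (fun s => (g s : Matrix (Fin 2) (Fin 2) ℂ)) :=
    hP.comp (continuous_pi fun s => continuous_subtype_val.comp (continuous_apply s))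
  -- No measurability of the direction is needed: it is used pointwise, in bounds and in inner
  -- integrals at fixed `ζ`.
  choose dir hdir using exists_quat_eq
  have hpolar : ∀ (ζ : σ → Spinor) (g : σ → SU2),
      P (fun s => quat (ζ s) * (g s : Matrix (Fin 2) (Fin 2) ℂ))
        = (∏ s, (‖ζ s‖ : ℂ) ^ n s) * P (fun s => ((dir (ζ s) * g s : SU2) :
            Matrix (Fin 2) (Fin 2) ℂ)) := by
    intro ζ g
    rw [← hhom]
    congr 1
    ext s : 1
    rw [hdir, Matrix.smul_mul]
    rfl
  obtain ⟨C, hC⟩ : ∃ C : ℝ, ∀ g : σ → SU2, ‖P (fun s => (g s : Matrix (Fin 2) (Fin 2) ℂ))‖ ≤ C := by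
    obtain ⟨C, hC⟩ := isCompact_univ.exists_bound_of_continuousOn hcoe.continuousOn
    exact ⟨C, fun g => hC g trivial⟩
  have hint : Integrable (Function.uncurry fun (g : σ → SU2) (ζ : σ → Spinor) =>
      P (fun s => quat (ζ s) * (g s : Matrix (Fin 2) (Fin 2) ℂ)) * (w ζ : ℂ))
      (μ.prod volume) := by
    have hb : Integrable (fun p : (σ → SU2) × (σ → Spinor) => C * ((∏ s, ‖p.2 s‖ ^ n s) * w p.2))
        (μ.prod volume) := (hwint.comp_snd μ).const_mul C
    refine hb.mono' (Continuous.aestronglyMeasurable ?_)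
      (Eventually.of_forall ?_)
    · refine Continuous.mul (hP.comp (continuous_pi fun s => Continuous.mul ?_ ?_)) ?_
      · exact continuous_quat.comp ((continuous_apply s).comp continuous_snd)
      · exact continuous_subtype_val.comp ((continuous_apply s).comp continuous_fst)
      · simp only [hw]; fun_prop
    · rintro ⟨g, ζ⟩
      simp only [Function.uncurry]
      rw [hpolar, norm_mul, norm_mul, norm_prod]
      have e1 : ∏ s, ‖(‖ζ s‖ : ℂ) ^ n s‖ = ∏ s, ‖ζ s‖ ^ n s := by simp
      have e2 : ‖(w ζ : ℂ)‖ = w ζ := by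
        rw [Complex.norm_real, Real.norm_of_nonneg (Real.exp_pos _).le]
      rw [e1, e2]
      have h3 := hC fun s => dir (ζ s) * g s
      have h4 : 0 ≤ ∏ s, ‖ζ s‖ ^ n s := Finset.prod_nonneg fun _ _ => by positivity
      have h5 : 0 ≤ w ζ := (Real.exp_pos _).le
      calc _ ≤ (∏ s, ‖ζ s‖ ^ n s) * C * w ζ := by gcongr
        _ = _ := by ring
  have hinv : ∀ g : σ → SU2, ∫ ζ : σ → Spinor,
      P (fun s => quat (ζ s) * (g s : Matrix (Fin 2) (Fin 2) ℂ)) * (w ζ : ℂ)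
        = ∫ ζ : σ → Spinor, P (fun s => quat (ζ s)) * (w ζ : ℂ) := by
    intro g
    have mp := measurePreserving_rightMul_pi g
    have hF : Continuous fun ζ : σ → Spinor => P (fun s => quat (ζ s)) * (w ζ : ℂ) := by
      refine (hP.comp (continuous_pi fun s => continuous_quat.comp (continuous_apply s))).mul ?_
      simp only [hw]; fun_prop
    have h := integral_map (μ := volume) mp.measurable.aemeasurable
      (f := fun ζ : σ → Spinor => P (fun s => quat (ζ s)) * (w ζ : ℂ))
      hF.aestronglyMeasurable
    rw [mp.map_eq] at h
    rw [h]
    congr 1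
    ext ζ
    simp only [quat_rightMul, hw, norm_rightMul]
  have hswap := integral_integral_swap hint
  simp_rw [hinv] at hswap
  rw [integral_const] at hswap
  simp only [hμ, probReal_univ, one_smul] at hswap
  rw [hswap]
  have hin : ∀ ζ : σ → Spinor, ∫ g : σ → SU2,
      P (fun s => quat (ζ s) * (g s : Matrix (Fin 2) (Fin 2) ℂ)) * (w ζ : ℂ)
        ∂(Measure.pi fun _ => haarSU2)
      = (((∏ s, ‖ζ s‖ ^ n s) * w ζ : ℝ) : ℂ) * ∫ g : σ → SU2,
          P (fun s => (g s : Matrix (Fin 2) (Fin 2) ℂ)) ∂(Measure.pi fun _ => haarSU2) := by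
    intro ζ
    simp_rw [hpolar]
    rw [integral_mul_const, integral_const_mul]
    have h := integral_mul_left_eq_self (μ := Measure.pi fun _ : σ => haarSU2)
      (fun g : σ → SU2 => P (fun s => (g s : Matrix (Fin 2) (Fin 2) ℂ))) (fun s => dir (ζ s))
    simp only [Pi.mul_apply] at h
    rw [h]
    push_cast
    ring
  simp_rw [hin]
  rw [integral_mul_const, integral_complex_ofReal]
  congr 1
  simp_rw [hwprod]
  rw [volume_pi, integral_fintype_prod_eq_prod
    (f := fun s (ζ : Spinor) => ‖ζ‖ ^ n s * Real.exp (-‖ζ‖ ^ 2))]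
  simp_rw [integral_norm_pow_mul_exp_spinor]
  push_cast
  rfl

/-! ### The coherent series as a Gaussian integral -/

theorem hasSum_mul_of_summable_norm {α β : Type*} {f : α → ℂ} {g : β → ℂ} {a b : ℂ}
    (hf : Summable fun x => ‖f x‖) (hg : Summable fun x => ‖g x‖) (ha : HasSum f a)
    (hb : HasSum g b) : HasSum (fun x : α × β => f x.1 * g x.2) (a * b) :=
  ha.mul hb (summable_mul_of_summable_norm hf hg)

theorem hasSum_prod_exp_fin (n : ℕ) (x : Fin n → ℂ) :
    Summable (fun c : Fin n → ℕ => ‖∏ i, x i ^ c i / ((c i).factorial : ℂ)‖) ∧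
    HasSum (fun c : Fin n → ℕ => ∏ i, x i ^ c i / ((c i).factorial : ℂ)) (Complex.exp (∑ i, x i)) := by
  induction n with
  | zero =>
    refine ⟨(hasSum_fintype _).summable, ?_⟩
    convert hasSum_fintype (fun c : Fin 0 → ℕ => ∏ i, x i ^ c i / ((c i).factorial : ℂ)) using 1
    simp
  | succ n ih =>
    obtain ⟨ih1, ih2⟩ := ih (fun i => x i.succ)
    have h1 : Summable fun k : ℕ => ‖x 0 ^ k / (k.factorial : ℂ)‖ :=
      NormedSpace.norm_expSeries_div_summable (x 0)
    have h2 : HasSum (fun k : ℕ => x 0 ^ k / (k.factorial : ℂ)) (Complex.exp (x 0)) := by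
      rw [Complex.exp_eq_exp_ℂ]
      exact NormedSpace.expSeries_div_hasSum_exp (x 0)
    have h3 := h1.mul_norm ih1
    have h4 := hasSum_mul_of_summable_norm h1 ih1 h2 ih2
    have e : ∀ q : ℕ × (Fin n → ℕ), ∏ i, x i ^ (Fin.consEquiv (fun _ => ℕ) q) i
        / (((Fin.consEquiv (fun _ => ℕ) q) i).factorial : ℂ)
        = x 0 ^ q.1 / (q.1.factorial : ℂ) * ∏ i, x (Fin.succ i) ^ q.2 i / ((q.2 i).factorial : ℂ) := by
      rintro ⟨k, c⟩
      rw [Fin.prod_univ_succ]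
      simp [Fin.consEquiv]
    constructor
    · rw [← (Fin.consEquiv (fun _ : Fin (n + 1) => ℕ)).summable_iff]
      refine h3.congr fun q => ?_
      rw [Function.comp_apply, e]
    · rw [← (Fin.consEquiv (fun _ : Fin (n + 1) => ℕ)).hasSum_iff, Fin.sum_univ_succ, Complex.exp_add]
      refine h4.congr_fun ?_
      intro q
      rw [Function.comp_apply, e]

theorem hasSum_prod_exp {ι : Type*} [Fintype ι] (x : ι → ℂ) :
    Summable (fun c : ι → ℕ => ‖∏ i, x i ^ c i / ((c i).factorial : ℂ)‖) ∧
    HasSum (fun c : ι → ℕ => ∏ i, x i ^ c i / ((c i).factorial : ℂ)) (Complex.exp (∑ i, x i)) := by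
  set e := Fintype.equivFin ι
  obtain ⟨h1, h2⟩ := hasSum_prod_exp_fin _ (fun i => x (e.symm i))
  have key : ∀ c : ι → ℕ, ∏ i, x (e.symm i) ^ (e.arrowCongr (Equiv.refl ℕ) c) i
        / (((e.arrowCongr (Equiv.refl ℕ) c) i).factorial : ℂ)
      = ∏ i, x i ^ c i / ((c i).factorial : ℂ) := fun c => by
    rw [← e.prod_comp]
    simp
  rw [← (e.arrowCongr (Equiv.refl ℕ)).summable_iff] at h1
  rw [← (e.arrowCongr (Equiv.refl ℕ)).hasSum_iff, e.symm.sum_comp] at h2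
  refine ⟨h1.congr fun c => ?_, h2.congr_fun fun c => ?_⟩
  · rw [Function.comp_apply, key]
  · rw [Function.comp_apply, key]

theorem expect_smul (v : Fin 2 → ℂ) (c : ℂ) (A : Matrix (Fin 2) (Fin 2) ℂ) :
    expect v (c • A) = c * expect v A := by
  rw [expect, expect, Matrix.smul_mulVec, dotProduct_smul, smul_eq_mul]

theorem continuous_expect (v : Fin 2 → ℂ) : Continuous (expect v) := by
  unfold expect
  fun_prop

theorem expect_spinUp (A : Matrix (Fin 2) (Fin 2) ℂ) : expect spinUp A = A 0 0 := by
  simp [expect, spinUp, dotProduct, Fin.sum_univ_two, Matrix.mulVec]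

theorem expect_spinPlus (A : Matrix (Fin 2) (Fin 2) ℂ) :
    expect spinPlus A = (A 0 0 + A 0 1 + A 1 0 + A 1 1) / 2 := by
  have h : ((√2 : ℝ) : ℂ) ^ 2 = 2 := by
    rw [← Complex.ofReal_pow, Real.sq_sqrt (by norm_num)]; norm_num
  have h0 : ((√2 : ℝ) : ℂ) ≠ 0 := by
    intro h'; rw [h'] at h; norm_num at h
  simp only [expect, spinPlus, dotProduct, Fin.sum_univ_two, Matrix.mulVec, Pi.star_apply,
    Matrix.cons_val_zero, Matrix.cons_val_one, Complex.star_def, Complex.conj_ofReal]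
  push_cast
  field_simp
  rw [h]
  ring

theorem norm_expect_spinUp_le (u : SU2) : ‖expect spinUp (u : Matrix (Fin 2) (Fin 2) ℂ)‖ ≤ 1 := by
  rw [expect_spinUp]
  exact entry_norm_bound_of_unitary (Matrix.mem_specialUnitaryGroup_iff.1 u.2).1 0 0

theorem norm_expect_spinPlus_le (u : SU2) :
    ‖expect spinPlus (u : Matrix (Fin 2) (Fin 2) ℂ)‖ ≤ 1 := by
  obtain ⟨h0, h1⟩ := SU2.apply_one u
  have hdet : (u : Matrix (Fin 2) (Fin 2) ℂ).det = 1 := (Matrix.mem_specialUnitaryGroup_iff.1 u.2).2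
  rw [Matrix.det_fin_two, h0, h1] at hdet
  rw [expect_spinPlus, h0, h1]
  generalize (u : Matrix (Fin 2) (Fin 2) ℂ) 0 0 = a at *
  generalize (u : Matrix (Fin 2) (Fin 2) ℂ) 0 1 = b at *
  have hre := congrArg Complex.re hdet
  simp at hre
  -- The matrix element keeps two of the four real coordinates of the unit vector `(a, b)`.
  have e : (a + b + -conj b + conj a) / 2 = ⟨a.re, b.im⟩ := by
    apply Complex.ext
    · simp
    · simp
      ring
  rw [e, ← sq_le_one_iff₀ (norm_nonneg _), ← Complex.normSq_eq_norm_sq, Complex.normSq_apply]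
  nlinarith [mul_self_nonneg a.im, mul_self_nonneg b.re]

section Links

variable {Nt Nx : ℕ} [NeZero Nt] [NeZero Nx] (Ng : ℤ)

/-- `right` as a permutation of the nodes. -/
def rightEquiv : Equiv.Perm (Site Nt Nx) where
  toFun := right
  invFun := left
  left_inv s := by simp [right, left]
  right_inv s := by simp [right, left]

/-- `up` as a permutation of the nodes. -/
def upEquiv : Equiv.Perm (Site Nt Nx) where
  toFun := up Ng
  invFun := down Ng
  left_inv := by
    rintro ⟨t, x⟩
    have ht := t.2
    by_cases h : (t : ℕ) + 1 < Nt
    · simp [up, down, h]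
    · have : (t : ℕ) = Nt - 1 := by omega
      simp only [up, down, h, dite_false, Fin.val_zero, lt_irrefl, add_sub_cancel_right]
      exact Prod.ext (Fin.ext this.symm) rfl
  right_inv := by
    rintro ⟨t, x⟩
    have ht := t.2
    by_cases h : 0 < (t : ℕ)
    · have h2 : (t : ℕ) - 1 + 1 < Nt := by omega
      simp only [up, down, h, h2, dite_true, if_true]
      congr 1
      apply Fin.ext
      show (t : ℕ) - 1 + 1 = t
      omega
    · have h2 : ¬ (Nt - 1 + 1 < Nt) := by omega
      simp only [up, down, h, h2, dite_false, if_false, sub_add_cancel]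
      congr 1
      apply Fin.ext
      simp
      omega

/-- The matrix element of a horizontal link for arbitrary matrices at the nodes. -/
def linkH (hh : Site Nt Nx → SU2) (M : Site Nt Nx → Matrix (Fin 2) (Fin 2) ℂ) (s : Site Nt Nx) : ℂ :=
  expect spinUp (star (M (right s)) * (hh s : Matrix (Fin 2) (Fin 2) ℂ) * M s)

/-- The matrix element of a vertical link for arbitrary matrices at the nodes. -/
def linkV (hv : Site Nt Nx → SU2) (M : Site Nt Nx → Matrix (Fin 2) (Fin 2) ℂ) (s : Site Nt Nx) : ℂ :=
  expect spinPlus (star (M (up Ng s)) * (hv s : Matrix (Fin 2) (Fin 2) ℂ) * M s)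

theorem continuous_linkH (hh : Site Nt Nx → SU2) (s : Site Nt Nx) :
    Continuous fun M => linkH hh M s := by
  refine (continuous_expect _).comp ?_
  fun_prop

theorem continuous_linkV (hv : Site Nt Nx → SU2) (s : Site Nt Nx) :
    Continuous fun M => linkV Ng hv M s := by
  refine (continuous_expect _).comp ?_
  fun_prop

theorem linkH_smul (hh : Site Nt Nx → SU2) (r : Site Nt Nx → ℝ)
    (M : Site Nt Nx → Matrix (Fin 2) (Fin 2) ℂ) (s : Site Nt Nx) :
    linkH hh (fun s => (r s : ℂ) • M s) s = (r (right s) : ℂ) * r s * linkH hh M s := by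
  rw [linkH, linkH, ← expect_smul]
  congr 1
  simp only [star_smul, Matrix.smul_mul, Matrix.mul_smul, smul_smul, Complex.star_def,
    Complex.conj_ofReal, mul_comm]

theorem linkV_smul (hv : Site Nt Nx → SU2) (r : Site Nt Nx → ℝ)
    (M : Site Nt Nx → Matrix (Fin 2) (Fin 2) ℂ) (s : Site Nt Nx) :
    linkV Ng hv (fun s => (r s : ℂ) • M s) s = (r (up Ng s) : ℂ) * r s * linkV Ng hv M s := by
  rw [linkV, linkV, ← expect_smul]
  congr 1
  simp only [star_smul, Matrix.smul_mul, Matrix.mul_smul, smul_smul, Complex.star_def,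
    Complex.conj_ofReal, mul_comm]

theorem norm_linkH_quat_le (hh : Site Nt Nx → SU2) (ζ : Site Nt Nx → Spinor) (s : Site Nt Nx) :
    ‖linkH hh (fun s => quat (ζ s)) s‖ ≤ ‖ζ (right s)‖ * ‖ζ s‖ := by
  choose dir hdir using exists_quat_eq
  simp_rw [hdir]
  rw [linkH_smul hh (fun s => ‖ζ s‖)]
  have h := norm_expect_spinUp_le ((dir (ζ (right s)))⁻¹ * hh s * dir (ζ s))
  rw [norm_mul, norm_mul, Complex.norm_real, Complex.norm_real, norm_norm, norm_norm]
  exact mul_le_of_le_one_right (by positivity) h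

theorem norm_linkV_quat_le (hv : Site Nt Nx → SU2) (ζ : Site Nt Nx → Spinor) (s : Site Nt Nx) :
    ‖linkV Ng hv (fun s => quat (ζ s)) s‖ ≤ ‖ζ (up Ng s)‖ * ‖ζ s‖ := by
  choose dir hdir using exists_quat_eq
  simp_rw [hdir]
  rw [linkV_smul Ng hv (fun s => ‖ζ s‖)]
  have h := norm_expect_spinPlus_le ((dir (ζ (up Ng s)))⁻¹ * hv s * dir (ζ s))
  rw [norm_mul, norm_mul, Complex.norm_real, Complex.norm_real, norm_norm, norm_norm]
  exact mul_le_of_le_one_right (by positivity) h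

/-- Arithmetic-geometric mean on each link: every node is the source of one link and the target of
one link of the given direction. -/
theorem sum_norm_mul_norm_perm_le {σ : Type*} [Fintype σ] (e : Equiv.Perm σ) (ζ : σ → Spinor) :
    ∑ s, ‖ζ (e s)‖ * ‖ζ s‖ ≤ ∑ s, ‖ζ s‖ ^ 2 := by
  have h : ∑ s, ‖ζ s‖ ^ 2 = ∑ s, (‖ζ (e s)‖ ^ 2 + ‖ζ s‖ ^ 2) / 2 := by
    rw [← Finset.sum_div, Finset.sum_add_distrib, Equiv.sum_comp e (fun s => ‖ζ s‖ ^ 2)]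
    ring
  rw [h]
  exact Finset.sum_le_sum fun s _ => by nlinarith [sq_nonneg (‖ζ (e s)‖ - ‖ζ s‖)]

/-- The exponent of the couplings in the Gaussian integral. -/
def linkSum (hh hv : Site Nt Nx → SU2) (p : ℂ × ℂ) (ζ : Site Nt Nx → Spinor) : ℂ :=
  ∑ s, p.2 * linkH hh (fun s => quat (ζ s)) s + ∑ s, p.1 * linkV Ng hv (fun s => quat (ζ s)) s

theorem sum_norm_links_le (hh hv : Site Nt Nx → SU2) (p : ℂ × ℂ) (ζ : Site Nt Nx → Spinor) :
    ∑ s, ‖p.2 * linkH hh (fun s => quat (ζ s)) s‖ + ∑ s, ‖p.1 * linkV Ng hv (fun s => quat (ζ s)) s‖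
      ≤ (‖p.1‖ + ‖p.2‖) * ∑ s, ‖ζ s‖ ^ 2 := by
  simp_rw [norm_mul, ← Finset.mul_sum]
  have h1 : ∑ s, ‖linkH hh (fun s => quat (ζ s)) s‖ ≤ ∑ s, ‖ζ s‖ ^ 2 :=
    (Finset.sum_le_sum fun s _ => norm_linkH_quat_le hh ζ s).trans
      (sum_norm_mul_norm_perm_le rightEquiv ζ)
  have h2 : ∑ s, ‖linkV Ng hv (fun s => quat (ζ s)) s‖ ≤ ∑ s, ‖ζ s‖ ^ 2 :=
    (Finset.sum_le_sum fun s _ => norm_linkV_quat_le Ng hv ζ s).trans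
      (sum_norm_mul_norm_perm_le (upEquiv Ng) ζ)
  nlinarith [mul_le_mul_of_nonneg_left h1 (norm_nonneg p.2),
    mul_le_mul_of_nonneg_left h2 (norm_nonneg p.1)]

theorem integrable_exp_neg_mul_sum_norm_sq {σ : Type*} [Fintype σ] {ε : ℝ} (hε : 0 < ε) :
    Integrable (fun ζ : σ → Spinor => Real.exp (-(ε * ∑ s, ‖ζ s‖ ^ 2))) := by
  have h1 : Integrable (fun z : Spinor => Real.exp (-(ε * ‖z‖ ^ 2))) := by
    have := (GaussianFourier.integrable_cexp_neg_mul_sq_norm_add (V := Spinor) (b := (ε : ℂ))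
      (by simpa using hε) 0 0).norm
    refine this.congr (Eventually.of_forall fun z => ?_)
    simp only [Complex.norm_exp]
    congr 1
    simp [← Complex.ofReal_pow]
  have h2 := Integrable.fintype_prod (ι := σ) (μ := fun _ => (volume : Measure Spinor))
    (f := fun _ z => Real.exp (-(ε * ‖z‖ ^ 2))) fun _ => h1
  refine h2.congr (Eventually.of_forall fun z => ?_)
  simp only [← Real.exp_sum, Finset.sum_neg_distrib, Finset.mul_sum]

/-- The term of the expansion of the Gaussian integrand for a spin configuration. -/
def gaussianTerm (hh hv : Site Nt Nx → SU2) (p : ℂ × ℂ) (c : (Site Nt Nx → ℕ) × (Site Nt Nx → ℕ))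
    (ζ : Site Nt Nx → Spinor) : ℂ :=
  (∏ s, (p.2 * linkH hh (fun s => quat (ζ s)) s) ^ c.1 s / ((c.1 s).factorial : ℂ))
    * (∏ s, (p.1 * linkV Ng hv (fun s => quat (ζ s)) s) ^ c.2 s / ((c.2 s).factorial : ℂ))
    * (Real.exp (-∑ s, ‖ζ s‖ ^ 2) : ℝ)

theorem psiLS_eq (hh hv : Site Nt Nx → SU2) (a b : Site Nt Nx → ℕ) :
    psiLS Ng hh hv a b = ∫ g : Site Nt Nx → SU2,
      ∏ s, (linkH hh (fun s => (g s : Matrix (Fin 2) (Fin 2) ℂ)) s ^ a s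
        * linkV Ng hv (fun s => (g s : Matrix (Fin 2) (Fin 2) ℂ)) s ^ b s)
      ∂(Measure.pi fun _ => haarSU2) := rfl

/-- A node belongs to four links, so the product of link matrix elements is homogeneous in the
matrix at `s` of degree `twiceJ`. Its radial moment is `π² Γ(J + 2)`, precisely the factor in the
weight. -/
theorem coherentTerm_eq_integral (hh hv : Site Nt Nx → SU2) (p : ℂ × ℂ)
    (c : (Site Nt Nx → ℕ) × (Site Nt Nx → ℕ)) :
    coherentTerm Ng hh hv p c
      = ((Real.pi : ℂ) ^ (2 * Fintype.card (Site Nt Nx)))⁻¹ * ∫ ζ, gaussianTerm Ng hh hv p c ζ := by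
  obtain ⟨a, b⟩ := c
  have key := integral_quat_mul_exp
    (fun M => ∏ s, (linkH hh M s ^ a s * linkV Ng hv M s ^ b s))
    (continuous_finsetProd _ fun s _ =>
      ((continuous_linkH hh s).pow _).mul ((continuous_linkV Ng hv s).pow _))
    (twiceJ Ng a b) (by
      intro r M
      -- The scale at the endpoint of a link is reassigned to that node, which produces the incoming
      -- spins in `twiceJ`.
      have e1 : ∏ s, (r (right s) : ℂ) ^ a s = ∏ s, (r s : ℂ) ^ a (left s) := by
        rw [← (rightEquiv (Nt := Nt) (Nx := Nx)).symm.prod_comp]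
        refine Finset.prod_congr rfl fun s _ => ?_
        congr 2
        exact congrArg r (rightEquiv.apply_symm_apply s)
      have e2 : ∏ s, (r (up Ng s) : ℂ) ^ b s = ∏ s, (r s : ℂ) ^ b (down Ng s) := by
        rw [← (upEquiv (Nt := Nt) (Nx := Nx) Ng).symm.prod_comp]
        refine Finset.prod_congr rfl fun s _ => ?_
        congr 2
        exact congrArg r ((upEquiv Ng).apply_symm_apply s)
      simp only [linkH_smul, linkV_smul, mul_pow, Finset.prod_mul_distrib, twiceJ, pow_add, e1, e2]
      ring)
  rw [← psiLS_eq] at key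
  have e3 : ∀ ζ, gaussianTerm Ng hh hv p (a, b) ζ
      = (∏ s, (p.1 ^ b s * p.2 ^ a s / (((b s).factorial : ℂ) * ((a s).factorial : ℂ))))
        * ((∏ s, (linkH hh (fun s => quat (ζ s)) s ^ a s
            * linkV Ng hv (fun s => quat (ζ s)) s ^ b s)) * (Real.exp (-∑ s, ‖ζ s‖ ^ 2) : ℝ)) := by
    intro ζ
    rw [gaussianTerm, ← Finset.prod_mul_distrib, ← mul_assoc, ← Finset.prod_mul_distrib]
    congr 1
    refine Finset.prod_congr rfl fun s _ => ?_
    rw [mul_pow, mul_pow]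
    ring
  simp_rw [e3]
  rw [integral_const_mul, key, coherentTerm, weight, Finset.prod_mul_distrib]
  have e4 : ∏ s, ((Real.pi ^ 2 * Real.Gamma ((twiceJ Ng a b s : ℝ) / 2 + 2) : ℝ) : ℂ)
      = (Real.pi : ℂ) ^ (2 * Fintype.card (Site Nt Nx))
        * ∏ s, ((Real.Gamma ((twiceJ Ng a b s : ℝ) / 2 + 2) : ℝ) : ℂ) := by
    simp only [Complex.ofReal_mul, Finset.prod_mul_distrib, Finset.prod_const, Finset.card_univ,
      pow_mul, Complex.ofReal_pow]
  rw [e4]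
  have : (Real.pi : ℂ) ^ (2 * Fintype.card (Site Nt Nx)) ≠ 0 :=
    pow_ne_zero _ (Complex.ofReal_ne_zero.2 Real.pi_ne_zero)
  field_simp

theorem hasSum_gaussianTerm (hh hv : Site Nt Nx → SU2) (p : ℂ × ℂ) (ζ : Site Nt Nx → Spinor) :
    HasSum (fun c => gaussianTerm Ng hh hv p c ζ)
      (Complex.exp (linkSum Ng hh hv p ζ - (∑ s, ‖ζ s‖ ^ 2 : ℝ))) := by
  obtain ⟨h1, h2⟩ := hasSum_prod_exp fun s => p.2 * linkH hh (fun s => quat (ζ s)) s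
  obtain ⟨h3, h4⟩ := hasSum_prod_exp fun s => p.1 * linkV Ng hv (fun s => quat (ζ s)) s
  have h5 := (hasSum_mul_of_summable_norm h1 h3 h2 h4).mul_right
    (Complex.exp ((-∑ s, ‖ζ s‖ ^ 2 : ℝ) : ℂ))
  rw [← Complex.exp_add, ← Complex.exp_add, Complex.ofReal_neg, ← sub_eq_add_neg] at h5
  simp only [gaussianTerm, Complex.ofReal_exp, Complex.ofReal_neg]
  exact h5

/-- The absolute values form the same exponential series with the link terms replaced by their
norms. The bound does not depend on `T`, which is what the exchange of sum and integral requires. -/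
theorem sum_norm_gaussianTerm_le (hh hv : Site Nt Nx → SU2) (p : ℂ × ℂ)
    (T : Finset ((Site Nt Nx → ℕ) × (Site Nt Nx → ℕ))) (ζ : Site Nt Nx → Spinor) :
    ∑ c ∈ T, ‖gaussianTerm Ng hh hv p c ζ‖
      ≤ Real.exp (-((1 - (‖p.1‖ + ‖p.2‖)) * ∑ s, ‖ζ s‖ ^ 2)) := by
  obtain ⟨h1, h2⟩ := hasSum_prod_exp fun s =>
    ((‖p.2 * linkH hh (fun s => quat (ζ s)) s‖ : ℝ) : ℂ)
  obtain ⟨h3, h4⟩ := hasSum_prod_exp fun s =>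
    ((‖p.1 * linkV Ng hv (fun s => quat (ζ s)) s‖ : ℝ) : ℂ)
  have h5 := (hasSum_mul_of_summable_norm h1 h3 h2 h4).mul_right
    (Complex.exp ((-∑ s, ‖ζ s‖ ^ 2 : ℝ) : ℂ))
  rw [← Complex.exp_add, ← Complex.exp_add] at h5
  have h6 : HasSum (fun c => ‖gaussianTerm Ng hh hv p c ζ‖)
      (Real.exp (∑ s, ‖p.2 * linkH hh (fun s => quat (ζ s)) s‖
        + ∑ s, ‖p.1 * linkV Ng hv (fun s => quat (ζ s)) s‖ + -∑ s, ‖ζ s‖ ^ 2)) := by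
    rw [← Complex.hasSum_ofReal, Complex.ofReal_exp]
    simp only [Complex.ofReal_add, Complex.ofReal_sum]
    refine h5.congr_fun fun c => ?_
    simp only [gaussianTerm, norm_mul, norm_prod, norm_div, norm_pow, Complex.norm_natCast,
      Complex.norm_exp, Complex.ofReal_re, Complex.ofReal_mul,
      Complex.ofReal_prod, Complex.ofReal_div, Complex.ofReal_pow, Complex.ofReal_natCast,
      Complex.ofReal_exp]
  refine (sum_le_hasSum T (fun c _ => norm_nonneg _) h6).trans (Real.exp_le_exp.2 ?_)
  have := sum_norm_links_le Ng hh hv p ζ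
  linarith

theorem continuous_quat_pi {σ : Type*} :
    Continuous fun (ζ : σ → Spinor) (s : σ) => quat (ζ s) :=
  continuous_pi fun s => continuous_quat.comp (continuous_apply s)

theorem continuous_linkH_quat (hh : Site Nt Nx → SU2) (s : Site Nt Nx) :
    Continuous fun ζ : Site Nt Nx → Spinor => linkH hh (fun s => quat (ζ s)) s :=
  Continuous.comp (g := fun M => linkH hh M s) (f := fun (ζ : Site Nt Nx → Spinor) s => quat (ζ s))
    (continuous_linkH hh s) continuous_quat_pi

theorem continuous_linkV_quat (hv : Site Nt Nx → SU2) (s : Site Nt Nx) :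
    Continuous fun ζ : Site Nt Nx → Spinor => linkV Ng hv (fun s => quat (ζ s)) s :=
  Continuous.comp (g := fun M => linkV Ng hv M s)
    (f := fun (ζ : Site Nt Nx → Spinor) s => quat (ζ s))
    (continuous_linkV Ng hv s) continuous_quat_pi

theorem continuous_gaussianTerm (hh hv : Site Nt Nx → SU2) (p : ℂ × ℂ)
    (c : (Site Nt Nx → ℕ) × (Site Nt Nx → ℕ)) : Continuous (gaussianTerm Ng hh hv p c) := by
  have h1 := continuous_linkH_quat hh
  have h2 := continuous_linkV_quat Ng hv
  have h3 : Continuous fun ζ : Site Nt Nx → Spinor =>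
      ∏ s, (p.2 * linkH hh (fun s => quat (ζ s)) s) ^ c.1 s / ((c.1 s).factorial : ℂ) :=
    continuous_finsetProd _ fun s _ => ((continuous_const.mul (h1 s)).pow _).div_const _
  have h4 : Continuous fun ζ : Site Nt Nx → Spinor =>
      ∏ s, (p.1 * linkV Ng hv (fun s => quat (ζ s)) s) ^ c.2 s / ((c.2 s).factorial : ℂ) :=
    continuous_finsetProd _ fun s _ => ((continuous_const.mul (h2 s)).pow _).div_const _
  have h5 : Continuous fun ζ : Site Nt Nx → Spinor => ((Real.exp (-∑ s, ‖ζ s‖ ^ 2) : ℝ) : ℂ) := by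
    fun_prop
  exact (h3.mul h4).mul h5

/-- The decay rate `1 - (|λ| + |τ|)` of the dominating Gaussian is positive exactly on the
convergence domain; its integral bounds all partial sums of the `L¹` norms. -/
theorem hasSum_coherentTerm (hh hv : Site Nt Nx → SU2) {p : ℂ × ℂ} (hp : p ∈ convergenceDomain) :
    Summable (fun c => ‖coherentTerm Ng hh hv p c‖) ∧
    HasSum (coherentTerm Ng hh hv p)
      (((Real.pi : ℂ) ^ (2 * Fintype.card (Site Nt Nx)))⁻¹
        * ∫ ζ, Complex.exp (linkSum Ng hh hv p ζ - (∑ s, ‖ζ s‖ ^ 2 : ℝ))) := by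
  have hε : 0 < 1 - (‖p.1‖ + ‖p.2‖) := sub_pos.2 hp
  have hb := integrable_exp_neg_mul_sum_norm_sq (σ := Site Nt Nx) hε
  have hI : ∀ c, Integrable (gaussianTerm Ng hh hv p c) := fun c =>
    hb.mono' (continuous_gaussianTerm Ng hh hv p c).aestronglyMeasurable
      (Eventually.of_forall fun ζ => by
        simpa using sum_norm_gaussianTerm_le Ng hh hv p {c} ζ)
  have hS : Summable fun c => ∫ ζ, ‖gaussianTerm Ng hh hv p c ζ‖ := by
    refine summable_of_sum_le (c := ∫ ζ : Site Nt Nx → Spinor,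
      Real.exp (-((1 - (‖p.1‖ + ‖p.2‖)) * ∑ s, ‖ζ s‖ ^ 2)))
      (fun c => integral_nonneg fun _ => norm_nonneg _) fun T => ?_
    rw [← integral_finsetSum _ fun c _ => (hI c).norm]
    exact integral_mono (integrable_finsetSum _ fun c _ => (hI c).norm) hb
      (sum_norm_gaussianTerm_le Ng hh hv p T)
  have h := hasSum_integral_of_summable_integral_norm hI hS
  simp_rw [(hasSum_gaussianTerm Ng hh hv p _).tsum_eq] at h
  constructor
  · refine Summable.of_nonneg_of_le (fun _ => norm_nonneg _) (fun c => ?_)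
      (hS.mul_left ‖((Real.pi : ℂ) ^ (2 * Fintype.card (Site Nt Nx)))⁻¹‖)
    rw [coherentTerm_eq_integral, norm_mul]
    exact mul_le_mul_of_nonneg_left (norm_integral_le_integral_norm _) (norm_nonneg _)
  · have e : coherentTerm Ng hh hv p = fun c => _ :=
      funext fun c => coherentTerm_eq_integral Ng hh hv p c
    rw [e]
    exact h.mul_left _

end Links

/-! ### The coherent series for diagonal holonomy as an inverse determinant -/

theorem integral_exp_neg_sum_norm_sq_spinor (σ : Type*) [Fintype σ] :
    ∫ ζ : σ → Spinor, Real.exp (-∑ s, ‖ζ s‖ ^ 2) = Real.pi ^ (2 * Fintype.card σ) := by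
  simp_rw [← Finset.sum_neg_distrib, Real.exp_sum]
  rw [volume_pi, integral_fintype_prod_eq_prod (f := fun _ (ζ : Spinor) => Real.exp (-‖ζ‖ ^ 2))]
  simp only [integral_exp_neg_norm_sq_spinor, Finset.prod_const, Finset.card_univ, pow_mul]

/-- The components of a family of spinors. -/
def components (σ : Type*) [Fintype σ] : (σ → Spinor) ≃L[ℝ] (σ ⊕ σ → ℂ) :=
  LinearEquiv.toContinuousLinearEquiv
    { toFun := fun ζ => Sum.elim (fun s => ζ s 0) (fun s => ζ s 1)
      invFun := fun z s => !₂[z (Sum.inl s), z (Sum.inr s)]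
      map_add' := fun x y => by ext (s | s) <;> simp
      map_smul' := fun c x => by ext (s | s) <;> simp
      left_inv := fun ζ => by ext s i; fin_cases i <;> simp
      right_inv := fun z => by ext (s | s) <;> simp }

theorem components_inl {σ : Type*} [Fintype σ] (ζ : σ → Spinor) (s : σ) :
    components σ ζ (Sum.inl s) = ζ s 0 := rfl

theorem components_inr {σ : Type*} [Fintype σ] (ζ : σ → Spinor) (s : σ) :
    components σ ζ (Sum.inr s) = ζ s 1 := rfl

theorem sum_norm_sq_components {σ : Type*} [Fintype σ] (ζ : σ → Spinor) :
    ∑ i, ‖components σ ζ i‖ ^ 2 = ∑ s, ‖ζ s‖ ^ 2 := by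
  rw [Fintype.sum_sum_type, ← Finset.sum_add_distrib]
  exact Finset.sum_congr rfl fun s _ => (Spinor.norm_sq (ζ s)).symm

theorem sesq_one {ι : Type*} [Fintype ι] [DecidableEq ι] (z : ι → ℂ) :
    sesq 1 z = ((∑ i, ‖z i‖ ^ 2 : ℝ) : ℂ) := by
  simp [sesq, Matrix.one_apply, Complex.conj_mul']

/-- By uniqueness of Haar measure the two volumes are proportional, and the standard Gaussian, whose
integral is known on both sides, shows that the constant is one. -/
theorem integral_comp_components {σ : Type*} [Fintype σ] (f : (σ ⊕ σ → ℂ) → ℂ) :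
    ∫ ζ, f (components σ ζ) = ∫ z, f z := by
  classical
  have hemb := (components σ).toHomeomorph.measurableEmbedding
  have hvol : (volume : Measure (σ → Spinor)).IsAddHaarMeasure := by
    exact Measure.pi.isAddHaarMeasure (fun _ => (volume : Measure Spinor))
  have hhaar : (Measure.map (components σ) volume).IsAddHaarMeasure :=
    (components σ).isAddHaarMeasure_map _
  have hmap : Measure.map (components σ) volume
      = (Measure.map (components σ) volume).addHaarScalarFactor volume • volume :=
    Measure.isAddLeftInvariant_eq_smul _ _
  set c := (Measure.map (components σ) volume).addHaarScalarFactor (volume : Measure (σ ⊕ σ → ℂ))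
  have key : ∀ f : (σ ⊕ σ → ℂ) → ℂ, ∫ ζ, f (components σ ζ) = (c : ℝ) • ∫ z, f z := by
    intro f
    have h1 := hemb.integral_map (μ := volume) f
    have h2 : Measure.map (⇑(components σ).toHomeomorph) volume = c • volume := hmap
    rw [h2, integral_smul_nnreal_measure] at h1
    exact h1.symm
  have hc : (c : ℝ) = 1 := by
    have h := key fun z => Complex.exp (-sesq 1 z)
    have hg := (gaussian_integral (1 : Matrix (σ ⊕ σ) (σ ⊕ σ) ℂ) one_pos fun z => by
      rw [sesq_one, Complex.ofReal_re, one_mul]).2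
    rw [hg] at h
    simp_rw [sesq_one, sum_norm_sq_components] at h
    have h2 := congrArg (fun r : ℝ => (r : ℂ)) (integral_exp_neg_sum_norm_sq_spinor σ)
    simp only [← integral_complex_ofReal, Complex.ofReal_exp, Complex.ofReal_neg,
      Complex.ofReal_pow] at h2
    rw [h2, Matrix.det_one, div_one, Fintype.card_sum, ← two_mul, Complex.real_smul] at h
    have hpi : (Real.pi : ℂ) ^ (2 * Fintype.card σ) ≠ 0 :=
      pow_ne_zero _ (Complex.ofReal_ne_zero.2 Real.pi_ne_zero)
    have h3 := mul_right_cancel₀ hpi ((one_mul _).trans h)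
    exact_mod_cast h3.symm
  rw [key f, hc, one_smul]

/-- The diagonal matrix of `SU(2)` with eigenvalues `exp (± i φ)`. -/
def diagSU2 (φ : ℝ) : SU2 :=
  ⟨!![Complex.exp (φ * Complex.I), 0; 0, Complex.exp (-(φ * Complex.I))], by
    have h : conj (Complex.exp (φ * Complex.I)) = Complex.exp (-(φ * Complex.I)) := by
      rw [← Complex.exp_conj]; simp
    have := quat_mem_SU2 (ζ := !₂[Complex.exp (φ * Complex.I), 0])
      (by simp [EuclideanSpace.norm_eq, Fin.sum_univ_two, Complex.norm_exp_ofReal_mul_I])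
    simpa [quat, h] using this⟩

section Links

variable {Nt Nx : ℕ} [NeZero Nt] [NeZero Nx] (Ng : ℤ)

/-- The phase of a diagonal holonomy on the vertical link at a node. -/
def slicePhase (φ : ℝ) (s : Site Nt Nx) : ℂ :=
  if (s.1 : ℕ) + 1 = Nt then Complex.exp (φ * Complex.I) else 1

/-- The shift operator along horizontal links. -/
def shiftH (Nt Nx : ℕ) : Matrix (Site Nt Nx) (Site Nt Nx) ℂ :=
  Matrix.of fun s s' => if s = right s' then 1 else 0

/-- The covariant shift operator along vertical links. -/
def shiftV (φ : ℝ) : Matrix (Site Nt Nx) (Site Nt Nx) ℂ :=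
  Matrix.of fun s s' => if s = up Ng s' then slicePhase φ s' else 0

/-- The matrix of the Gaussian integral. -/
def gaussMatrix (φ : ℝ) (p : ℂ × ℂ) : Matrix (Site Nt Nx ⊕ Site Nt Nx) (Site Nt Nx ⊕ Site Nt Nx) ℂ :=
  let R := shiftH Nt Nx
  let V := shiftV (Nt := Nt) (Nx := Nx) Ng φ
  Matrix.fromBlocks (1 - p.2 • R - (p.1 / 2) • (V + V.conjTranspose))
    (-(p.1 / 2) • (V - V.conjTranspose)) (-(p.1 / 2) • (V - V.conjTranspose))
    (1 - p.2 • R.conjTranspose - (p.1 / 2) • (V + V.conjTranspose))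

theorem lastSlice_diagSU2 (φ : ℝ) (s : Site Nt Nx) :
    (lastSlice (diagSU2 φ) s : Matrix (Fin 2) (Fin 2) ℂ)
      = !![slicePhase φ s, 0; 0, conj (slicePhase φ s)] := by
  have h : conj (Complex.exp (φ * Complex.I)) = Complex.exp (-(φ * Complex.I)) := by
    rw [← Complex.exp_conj]; simp
  unfold lastSlice slicePhase
  split_ifs
  · rw [h]; rfl
  · ext i j
    fin_cases i <;> fin_cases j <;> simp

theorem linkH_one_quat (ζ : Site Nt Nx → Spinor) (s : Site Nt Nx) :
    linkH (fun _ => 1) (fun s => quat (ζ s)) s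
      = conj (ζ (right s) 0) * ζ s 0 + conj (ζ s 1) * ζ (right s) 1 := by
  rw [linkH, expect_spinUp]
  simp [Matrix.mul_apply, Fin.sum_univ_two, quat, Matrix.star_apply]
  ring

theorem linkV_lastSlice_quat (φ : ℝ) (ζ : Site Nt Nx → Spinor) (s : Site Nt Nx) :
    linkV Ng (lastSlice (diagSU2 φ)) (fun s => quat (ζ s)) s
      = (conj (ζ (up Ng s) 0 + ζ (up Ng s) 1) * slicePhase φ s * (ζ s 0 + ζ s 1)
        + conj (ζ s 0 - ζ s 1) * conj (slicePhase φ s) * (ζ (up Ng s) 0 - ζ (up Ng s) 1)) / 2 := by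
  rw [linkV, expect_spinPlus, lastSlice_diagSU2]
  simp [Matrix.mul_apply, Fin.sum_univ_two, quat, Matrix.star_apply]
  ring

theorem sesq_fromBlocks {n : Type*} [Fintype n] (A B C D : Matrix n n ℂ) (z : n ⊕ n → ℂ) :
    sesq (Matrix.fromBlocks A B C D) z
      = ∑ s, ∑ s', (conj (z (Sum.inl s)) * A s s' * z (Sum.inl s')
          + conj (z (Sum.inl s)) * B s s' * z (Sum.inr s')
          + conj (z (Sum.inr s)) * C s s' * z (Sum.inl s')
          + conj (z (Sum.inr s)) * D s s' * z (Sum.inr s')) := by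
  simp only [sesq, Fintype.sum_sum_type, Matrix.fromBlocks_apply₁₁, Matrix.fromBlocks_apply₁₂,
    Matrix.fromBlocks_apply₂₁, Matrix.fromBlocks_apply₂₂, Finset.sum_add_distrib]
  ring

/-- Diagonality of the holonomy matters: off-diagonal entries would produce products of two spinor
components with no conjugate, or with two. On horizontal links `ζ 0` moves by the shift and `ζ 1` by
its adjoint; on vertical links the same holds for `ζ 0 + ζ 1` and `ζ 0 - ζ 1`, whence the sums and
differences of `V` and its adjoint in the blocks. -/
theorem sesq_gaussMatrix (φ : ℝ) (p : ℂ × ℂ) (ζ : Site Nt Nx → Spinor) :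
    sesq (gaussMatrix Ng φ p) (components _ ζ)
      = (∑ s, ‖ζ s‖ ^ 2 : ℝ) - linkSum Ng (fun _ => 1) (lastSlice (diagSU2 φ)) p ζ := by
  have hbil : ∀ (f g : Site Nt Nx → ℂ) (e : Site Nt Nx → Site Nt Nx) (c : Site Nt Nx → ℂ),
      ∑ s, ∑ s', f s * (if s = e s' then c s' else 0) * g s' = ∑ s, f (e s) * c s * g s := by
    intro f g e c
    rw [Finset.sum_comm]
    simp
  have hbil' : ∀ (f g : Site Nt Nx → ℂ) (e : Site Nt Nx → Site Nt Nx) (c : Site Nt Nx → ℂ),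
      ∑ s, ∑ s', f s * (if s' = e s then c s else 0) * g s' = ∑ s, f s * c s * g (e s) := by
    intro f g e c
    simp
  have hone : ∀ f g : Site Nt Nx → ℂ, ∑ s, ∑ s', f s * ((1 : Matrix (Site Nt Nx) (Site Nt Nx) ℂ) s s')
      * g s' = ∑ s, f s * g s := by
    intro f g
    simp [Matrix.one_apply]
  have hR : ∀ f g : Site Nt Nx → ℂ, ∑ s, ∑ s', f s * shiftH Nt Nx s s' * g s'
      = ∑ s, f (right s) * 1 * g s := fun f g => hbil f g _ _
  have hR' : ∀ f g : Site Nt Nx → ℂ, ∑ s, ∑ s', f s * (shiftH Nt Nx).conjTranspose s s' * g s'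
      = ∑ s, f s * 1 * g (right s) := fun f g => by
    rw [← hbil' f g right fun _ => 1]
    simp [shiftH, Matrix.conjTranspose_apply]
  have hV : ∀ f g : Site Nt Nx → ℂ, ∑ s, ∑ s', f s * shiftV Ng φ s s' * g s'
      = ∑ s, f (up Ng s) * slicePhase φ s * g s := fun f g => hbil f g _ _
  have hV' : ∀ f g : Site Nt Nx → ℂ, ∑ s, ∑ s', f s * (shiftV Ng φ).conjTranspose s s' * g s'
      = ∑ s, f s * conj (slicePhase φ s) * g (up Ng s) := fun f g => by
    rw [← hbil' f g (up Ng) fun s => conj (slicePhase φ s)]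
    simp [shiftV, Matrix.conjTranspose_apply, apply_ite]
  set R := shiftH Nt Nx
  set V := shiftV (Nt := Nt) (Nx := Nx) Ng φ
  have hsplit : sesq (gaussMatrix Ng φ p) (components _ ζ)
      = (∑ s, ∑ s', conj (ζ s 0) * ((1 : Matrix (Site Nt Nx) (Site Nt Nx) ℂ) s s') * ζ s' 0)
      + (∑ s, ∑ s', conj (ζ s 1) * ((1 : Matrix (Site Nt Nx) (Site Nt Nx) ℂ) s s') * ζ s' 1)
      - p.2 * (∑ s, ∑ s', conj (ζ s 0) * R s s' * ζ s' 0)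
      - p.2 * (∑ s, ∑ s', conj (ζ s 1) * R.conjTranspose s s' * ζ s' 1)
      - p.1 / 2 * (∑ s, ∑ s', conj (ζ s 0 + ζ s 1) * V s s' * (ζ s' 0 + ζ s' 1))
      - p.1 / 2 * (∑ s, ∑ s', conj (ζ s 0 - ζ s 1) * V.conjTranspose s s' * (ζ s' 0 - ζ s' 1)) := by
    rw [gaussMatrix, sesq_fromBlocks]
    simp only [Finset.mul_sum, ← Finset.sum_add_distrib, ← Finset.sum_sub_distrib, components_inl,
      components_inr, Matrix.sub_apply, Matrix.add_apply, Matrix.smul_apply,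
      smul_eq_mul, map_add, map_sub]
    refine Finset.sum_congr rfl fun s _ => Finset.sum_congr rfl fun s' _ => ?_
    ring
  rw [hsplit, hone (fun s => conj (ζ s 0)) (fun s => ζ s 0),
    hone (fun s => conj (ζ s 1)) (fun s => ζ s 1),
    hR (fun s => conj (ζ s 0)) (fun s => ζ s 0), hR' (fun s => conj (ζ s 1)) (fun s => ζ s 1),
    hV (fun s => conj (ζ s 0 + ζ s 1)) (fun s => ζ s 0 + ζ s 1),
    hV' (fun s => conj (ζ s 0 - ζ s 1)) (fun s => ζ s 0 - ζ s 1), linkSum]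
  simp only [linkH_one_quat, linkV_lastSlice_quat, Complex.ofReal_sum, Complex.ofReal_pow,
    Spinor.norm_sq_cast, Finset.mul_sum, ← Finset.sum_add_distrib, ← Finset.sum_sub_distrib]
  refine Finset.sum_congr rfl fun s _ => ?_
  ring

theorem coherentSeries_diag (φ : ℝ) {p : ℂ × ℂ} (hp : p ∈ convergenceDomain) :
    (gaussMatrix (Nt := Nt) (Nx := Nx) Ng φ p).det ≠ 0 ∧
    coherentSeries (Nt := Nt) (Nx := Nx) Ng (fun _ => 1) (lastSlice (diagSU2 φ)) p
      = (gaussMatrix (Nt := Nt) (Nx := Nx) Ng φ p).det⁻¹ := by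
  have hε : 0 < 1 - (‖p.1‖ + ‖p.2‖) := sub_pos.2 hp
  obtain ⟨h1, h2⟩ := gaussian_integral (gaussMatrix (Nt := Nt) (Nx := Nx) Ng φ p) hε (by
    intro z
    obtain ⟨ζ, rfl⟩ := (components (Site Nt Nx)).surjective z
    rw [sum_norm_sq_components, sesq_gaussMatrix, Complex.sub_re, Complex.ofReal_re]
    have h3 := sum_norm_links_le Ng (fun _ => 1) (lastSlice (diagSU2 φ)) p ζ
    have h4 : (linkSum Ng (fun _ => 1) (lastSlice (diagSU2 φ)) p ζ).re
        ≤ ∑ s, ‖p.2 * linkH (fun _ => 1) (fun s => quat (ζ s)) s‖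
          + ∑ s, ‖p.1 * linkV Ng (lastSlice (diagSU2 φ)) (fun s => quat (ζ s)) s‖ := by
      refine (Complex.re_le_norm _).trans ((norm_add_le _ _).trans ?_)
      exact add_le_add (norm_sum_le _ _) (norm_sum_le _ _)
    linarith)
  refine ⟨h1, ?_⟩
  rw [coherentSeries, (hasSum_coherentTerm Ng _ _ hp).2.tsum_eq]
  rw [← integral_comp_components] at h2
  simp_rw [sesq_gaussMatrix, neg_sub] at h2
  rw [h2, Fintype.card_sum, ← two_mul]
  have hpi : (Real.pi : ℂ) ^ (2 * Fintype.card (Site Nt Nx)) ≠ 0 :=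
    pow_ne_zero _ (Complex.ofReal_ne_zero.2 Real.pi_ne_zero)
  field_simp

end Links

/-! ### Evaluation of the determinant -/

theorem prod_range_sub_pow_mul {ω : ℂ} {n : ℕ} (hn : 0 < n) (h : IsPrimitiveRoot ω n) (x y : ℂ) :
    ∏ j ∈ Finset.range n, (x - ω ^ j * y) = x ^ n - y ^ n := by
  rw [h.pow_sub_pow_eq_prod_sub_mul x y hn]
  refine Finset.prod_nbij (fun j => ω ^ j) ?_ ?_ ?_ fun _ _ => rfl
  · intro j _
    rw [Polynomial.mem_nthRootsFinset hn, ← pow_mul, mul_comm, pow_mul, h.pow_eq_one, one_pow]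
  · intro i hi j hj hij
    exact h.pow_inj (by simpa using hi) (by simpa using hj) hij
  · intro z hz
    have hz' : z ^ n = 1 := (Polynomial.mem_nthRootsFinset hn _).1 (by simpa using hz)
    have : NeZero n := ⟨hn.ne'⟩
    obtain ⟨i, hi, rfl⟩ := h.eq_pow_of_pow_eq_one hz'
    exact ⟨i, by simpa using hi, rfl⟩

/-- With `y = exp X` and `u = ω^j v`, where `v = exp(iα/n)` and `ω` is a primitive `n`-th root of
unity, each factor is `(y - u)(y - u⁻¹) / y`. The two products over `j` are `y^n - v^n` and `y^n -
v^(-n)`. -/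
theorem prod_cosh_sub_cos {n : ℕ} (hn : 0 < n) (X α : ℂ) :
    ∏ j ∈ Finset.range n, (2 * (Complex.cosh X - Complex.cos ((α + 2 * Real.pi * j) / n)))
      = 2 * (Complex.cosh (n * X) - Complex.cos α) := by
  have hn0 : (n : ℂ) ≠ 0 := Nat.cast_ne_zero.2 hn.ne'
  set ω := Complex.exp (2 * Real.pi * Complex.I / n) with hω
  have hp : IsPrimitiveRoot ω n := Complex.isPrimitiveRoot_exp n hn.ne'
  set v := Complex.exp (α * Complex.I / n) with hv
  set y := Complex.exp X with hy
  have hy0 : y ≠ 0 := Complex.exp_ne_zero _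
  have hv0 : v ≠ 0 := Complex.exp_ne_zero _
  have hω0 : ω ≠ 0 := Complex.exp_ne_zero _
  have hterm : ∀ j : ℕ, 2 * (Complex.cosh X - Complex.cos ((α + 2 * Real.pi * j) / n))
      = (y - ω ^ j * v) * (y - ω⁻¹ ^ j * v⁻¹) / y := by
    intro j
    have e1 : ω ^ j * v = Complex.exp ((α + 2 * Real.pi * j) / n * Complex.I) := by
      rw [hω, hv, ← Complex.exp_nat_mul, ← Complex.exp_add]
      congr 1
      field_simp
      ring
    have e2 : ω⁻¹ ^ j * v⁻¹ = Complex.exp (-((α + 2 * Real.pi * j) / n) * Complex.I) := by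
      rw [neg_mul, Complex.exp_neg, ← e1, mul_inv, inv_pow]
    have e3 : (ω ^ j * v) * (ω⁻¹ ^ j * v⁻¹) = 1 := by
      rw [inv_pow]
      have := pow_ne_zero j hω0
      field_simp
    have e4 : 2 * Complex.cosh X = y + y⁻¹ := by
      rw [Complex.cosh, hy, Complex.exp_neg]; ring
    rw [mul_sub (2 : ℂ), e4, Complex.two_cos, ← e1, ← e2]
    generalize ω ^ j * v = u at e3 ⊢
    generalize ω⁻¹ ^ j * v⁻¹ = u' at e3 ⊢
    field_simp
    linear_combination -e3
  simp_rw [hterm]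
  rw [Finset.prod_div_distrib, Finset.prod_mul_distrib, prod_range_sub_pow_mul hn hp,
    prod_range_sub_pow_mul hn hp.inv, Finset.prod_const, Finset.card_range]
  have hvn : v ^ n = Complex.exp (α * Complex.I) := by
    rw [hv, ← Complex.exp_nat_mul]
    congr 1
    field_simp
  have hyn : y ^ n = Complex.exp (n * X) := by rw [hy, ← Complex.exp_nat_mul]
  have e4 : 2 * Complex.cosh (n * X) = y ^ n + (y ^ n)⁻¹ := by
    rw [Complex.cosh, hyn, Complex.exp_neg]; ring
  have e5 : 2 * Complex.cos α = v ^ n + (v ^ n)⁻¹ := by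
    rw [Complex.two_cos, hvn, neg_mul, Complex.exp_neg]
  rw [mul_sub (2 : ℂ), e4, e5, inv_pow]
  have h1 := pow_ne_zero n hy0
  have h2 := pow_ne_zero n hv0
  field_simp
  ring

theorem det_fromBlocks_diagonal {n : Type*} [Fintype n] [DecidableEq n] (a b c d : n → ℂ) :
    (Matrix.fromBlocks (Matrix.diagonal a) (Matrix.diagonal b) (Matrix.diagonal c)
      (Matrix.diagonal d)).det = ∏ m, (a m * d m - b m * c m) := by
  have h := Matrix.det_blockDiagonal fun m => !![a m, b m; c m, d m]
  simp only [Matrix.det_fin_two_of] at h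
  rw [← h]
  let e : n ⊕ n ≃ Fin 2 × n :=
    ((finTwoEquiv.prodCongr (Equiv.refl n)).trans (Equiv.boolProdEquivSum n)).symm
  rw [← Matrix.det_submatrix_equiv_self e]
  congr 1
  ext (i | i) (j | j) <;>
    simp [e, Matrix.blockDiagonal_apply, Matrix.diagonal_apply, finTwoEquiv]

/-- The four blocks share the eigenbasis `F`, so conjugation by `F ⊕ F` makes all of them diagonal
at once, and the determinant splits into `2 × 2` determinants. -/
theorem det_fromBlocks_of_eigenbasis {n : Type*} [Fintype n] [DecidableEq n]
    {A B C D F : Matrix n n ℂ} {a b c d : n → ℂ} (hF : F.det ≠ 0)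
    (hA : A * F = F * Matrix.diagonal a) (hB : B * F = F * Matrix.diagonal b)
    (hC : C * F = F * Matrix.diagonal c) (hD : D * F = F * Matrix.diagonal d) :
    (Matrix.fromBlocks A B C D).det = ∏ m, (a m * d m - b m * c m) := by
  rw [← det_fromBlocks_diagonal]
  have h : Matrix.fromBlocks A B C D * Matrix.fromBlocks F 0 0 F
      = Matrix.fromBlocks F 0 0 F * Matrix.fromBlocks (Matrix.diagonal a) (Matrix.diagonal b)
        (Matrix.diagonal c) (Matrix.diagonal d) := by
    simp [Matrix.fromBlocks_multiply, hA, hB, hC, hD]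
  have h2 := congrArg Matrix.det h
  rw [Matrix.det_mul, Matrix.det_mul, Matrix.det_fromBlocks_zero₂₁, mul_comm] at h2
  exact mul_left_cancel₀ (mul_ne_zero hF hF) h2

theorem prod_zmod_val {M : Type*} [CommMonoid M] {n : ℕ} [NeZero n] (f : ℕ → M) :
    ∏ k : ZMod n, f k.val = ∏ k ∈ Finset.range n, f k := by
  obtain ⟨m, rfl⟩ := Nat.exists_eq_succ_of_ne_zero (NeZero.ne n)
  exact Fin.prod_univ_eq_prod_range f (m + 1)

theorem stdAddChar_eq_exp {n : ℕ} [NeZero n] (k : ZMod n) :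
    ZMod.stdAddChar k = Complex.exp (2 * Real.pi * k.val / n * Complex.I) := by
  have h := ZMod.stdAddChar_coe (N := n) (k.val : ℤ)
  rw [Int.cast_natCast, ZMod.natCast_zmod_val] at h
  rw [h]
  congr 1
  push_cast
  ring

/-! ### Plane waves on the twisted torus -/

section Lattice

variable {Nt Nx : ℕ} [NeZero Nt] [NeZero Nx] (Ng : ℤ)

/-- The angle of the inverse eigenvalue of the vertical shift. -/
def waveAngle (φ : ℝ) (m : Site Nt Nx) : ℂ :=
  ((twistAngle Nx Ng : ℂ) * m.2.val - φ + 2 * Real.pi * (m.1 : ℕ)) / Nt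

/-- The inverse eigenvalue of the vertical shift. -/
def wavePhase (φ : ℝ) (m : Site Nt Nx) : ℂ := Complex.exp (waveAngle Ng φ m * Complex.I)

theorem wavePhase_ne_zero (φ : ℝ) (m : Site Nt Nx) : wavePhase Ng φ m ≠ 0 := Complex.exp_ne_zero _

theorem exp_twistAngle (k : ZMod Nx) :
    Complex.exp ((twistAngle Nx Ng : ℂ) * k.val * Complex.I) = ZMod.stdAddChar (k * (Ng : ZMod Nx)) := by
  have h := ZMod.stdAddChar_coe (N := Nx) ((k.val : ℤ) * Ng)
  rw [Int.cast_mul, Int.cast_natCast, ZMod.natCast_zmod_val] at h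
  rw [h, twistAngle]
  congr 1
  push_cast
  ring

/-- This is the quantization condition: once around the time direction, a plane wave must match the
spatial shift by `Ng` and the phase of the holonomy. -/
theorem wavePhase_pow (φ : ℝ) (m : Site Nt Nx) :
    wavePhase Ng φ m ^ Nt = Complex.exp (-(φ * Complex.I)) * ZMod.stdAddChar (m.2 * (Ng : ZMod Nx)) := by
  have hn0 : (Nt : ℂ) ≠ 0 := Nat.cast_ne_zero.2 (NeZero.ne Nt)
  rw [wavePhase, ← Complex.exp_nat_mul, ← exp_twistAngle, ← Complex.exp_add]
  rw [show (Nt : ℂ) * (waveAngle Ng φ m * Complex.I) = -(φ * Complex.I)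
    + (twistAngle Nx Ng : ℂ) * m.2.val * Complex.I + (m.1 : ℕ) * (2 * Real.pi * Complex.I) by
      rw [waveAngle]; field_simp; ring]
  exact (Complex.exp_periodic.nat_mul _) _

/-- The matrix of the joint eigenvectors of the shifts. -/
def fourierMatrix (φ : ℝ) : Matrix (Site Nt Nx) (Site Nt Nx) ℂ :=
  Matrix.of fun s m => wavePhase Ng φ m ^ (s.1 : ℕ) * ZMod.stdAddChar (m.2 * s.2)

/-- The inverse is explicit up to the scalar `Nt * Nx`. Different horizontal momenta are orthogonal
by the sum over `x`. For equal ones the sum over `t` is geometric, with ratio an `Nt`-th root of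
unity, nontrivial when the vertical momenta differ. -/
theorem fourierMatrix_det_ne_zero (φ : ℝ) :
    (fourierMatrix (Nt := Nt) (Nx := Nx) Ng φ).det ≠ 0 := by
  have hNt : (Nt : ℂ) ≠ 0 := Nat.cast_ne_zero.2 (NeZero.ne Nt)
  have hNx : (Nx : ℂ) ≠ 0 := Nat.cast_ne_zero.2 (NeZero.ne Nx)
  set G : Matrix (Site Nt Nx) (Site Nt Nx) ℂ :=
    Matrix.of fun m s => (wavePhase Ng φ m)⁻¹ ^ (s.1 : ℕ) * ZMod.stdAddChar (-m.2 * s.2) with hG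
  have key : G * fourierMatrix Ng φ = ((Nt : ℂ) * Nx) • (1 : Matrix (Site Nt Nx) (Site Nt Nx) ℂ) := by
    ext m m'
    have e1 : (G * fourierMatrix Ng φ : Matrix (Site Nt Nx) (Site Nt Nx) ℂ) m m'
        = (∑ t ∈ Finset.range Nt, ((wavePhase Ng φ m)⁻¹ * wavePhase Ng φ m') ^ t)
          * ∑ x : ZMod Nx, ZMod.stdAddChar (x * (m'.2 - m.2)) := by
      rw [← Fin.sum_univ_eq_sum_range, Finset.sum_mul_sum, Matrix.mul_apply, Fintype.sum_prod_type]
      refine Finset.sum_congr rfl fun t _ => Finset.sum_congr rfl fun x _ => ?_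
      simp only [hG, fourierMatrix, Matrix.of_apply]
      rw [show x * (m'.2 - m.2) = -m.2 * x + m'.2 * x by ring, AddChar.map_add_eq_mul, mul_pow]
      ring
    rw [e1, AddChar.sum_mulShift _ (ZMod.isPrimitive_stdAddChar Nx), Matrix.smul_apply,
      Matrix.one_apply]
    by_cases hk : m'.2 = m.2
    · by_cases hj : m'.1 = m.1
      · have : m = m' := Prod.ext hj.symm hk.symm
        subst this
        simp [wavePhase_ne_zero, ZMod.card]
      · have hmm : m ≠ m' := fun h => hj (by rw [h])
        have hq : ((wavePhase Ng φ m)⁻¹ * wavePhase Ng φ m') ^ Nt = 1 := by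
          rw [mul_pow, inv_pow, wavePhase_pow, wavePhase_pow, hk, inv_mul_cancel₀]
          rw [← hk, ← wavePhase_pow]
          exact pow_ne_zero _ (wavePhase_ne_zero _ _ _)
        have hq1 : (wavePhase Ng φ m)⁻¹ * wavePhase Ng φ m' ≠ 1 := by
          intro h
          have hp := Complex.isPrimitiveRoot_exp Nt (NeZero.ne Nt)
          have h2 : wavePhase Ng φ m' = wavePhase Ng φ m := by
            have := congrArg (wavePhase Ng φ m * ·) h
            simpa [← mul_assoc, wavePhase_ne_zero] using this
          have hw : ∀ m : Site Nt Nx, wavePhase Ng φ m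
              = Complex.exp (((twistAngle Nx Ng : ℂ) * m.2.val - φ) / Nt * Complex.I)
                * Complex.exp (2 * Real.pi * Complex.I / Nt) ^ (m.1 : ℕ) := by
            intro m
            rw [wavePhase, ← Complex.exp_nat_mul, ← Complex.exp_add, waveAngle]
            congr 1
            field_simp
          rw [hw, hw, hk] at h2
          have h3 := mul_left_cancel₀ (Complex.exp_ne_zero _) h2
          exact hj (Fin.ext (hp.pow_inj m'.1.2 m.1.2 h3))
        have h0 := geom_sum_mul ((wavePhase Ng φ m)⁻¹ * wavePhase Ng φ m') Nt
        rw [hq, sub_self] at h0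
        rw [(mul_eq_zero.1 h0).resolve_right (sub_ne_zero.2 hq1)]
        simp [hmm]
    · have hmm : m ≠ m' := fun h => hk (by rw [h])
      simp [hmm, sub_eq_zero, hk]
  intro h
  have h2 := congrArg Matrix.det key
  rw [Matrix.det_mul, h, mul_zero, Matrix.det_smul, Matrix.det_one, mul_one] at h2
  exact pow_ne_zero _ (mul_ne_zero hNt hNx) h2.symm

theorem shiftH_mul_fourierMatrix (φ : ℝ) : shiftH Nt Nx * fourierMatrix Ng φ
    = fourierMatrix Ng φ * Matrix.diagonal fun m => ZMod.stdAddChar (-m.2) := by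
  ext s m
  obtain ⟨s, rfl⟩ : ∃ r, s = right r := ⟨left s, (rightEquiv.apply_symm_apply s).symm⟩
  rw [Matrix.mul_diagonal, Matrix.mul_apply, Finset.sum_eq_single s]
  · simp only [shiftH, Matrix.of_apply, if_true, one_mul, fourierMatrix, right]
    rw [mul_assoc, ← AddChar.map_add_eq_mul]
    congr 2
    ring
  · intro s' _ hs'
    have : right s ≠ right s' := fun h => hs' (rightEquiv.injective h.symm)
    simp [shiftH, this]
  · simp

theorem shiftH_conjTranspose_mul_fourierMatrix (φ : ℝ) :
    (shiftH Nt Nx).conjTranspose * fourierMatrix Ng φ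
      = fourierMatrix Ng φ * Matrix.diagonal fun m => ZMod.stdAddChar m.2 := by
  ext s m
  rw [Matrix.mul_diagonal, Matrix.mul_apply, Finset.sum_eq_single (right s)]
  · simp only [shiftH, Matrix.conjTranspose_apply, Matrix.of_apply, if_true, star_one, one_mul,
      fourierMatrix, right]
    rw [mul_assoc, ← AddChar.map_add_eq_mul]
    congr 2
    ring
  · intro s' _ hs'
    simp [shiftH, hs']
  · simp

theorem up_down (s : Site Nt Nx) : up Ng (down Ng s) = s := (upEquiv Ng).apply_symm_apply s

/-- Inside the lattice this is one more power of the wave phase; across the seam it is the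
quantization condition `wavePhase_pow`. -/
theorem fourierMatrix_up (φ : ℝ) (s m : Site Nt Nx) :
    fourierMatrix Ng φ (up Ng s) m * conj (slicePhase φ s)
      = fourierMatrix Ng φ s m * wavePhase Ng φ m := by
  have hs := s.1.2
  by_cases h : (s.1 : ℕ) + 1 < Nt
  · have h' : (s.1 : ℕ) + 1 ≠ Nt := h.ne
    simp only [fourierMatrix, Matrix.of_apply, up, h, dite_true, slicePhase, h', if_false, map_one,
      mul_one, pow_succ]
    ring
  · have h' : (s.1 : ℕ) + 1 = Nt := by omega
    have hc : conj (Complex.exp (φ * Complex.I)) = Complex.exp (-(φ * Complex.I)) := by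
      rw [← Complex.exp_conj]; simp
    have hw : wavePhase Ng φ m ^ ((s.1 : ℕ) + 1)
        = Complex.exp (-(φ * Complex.I)) * ZMod.stdAddChar (m.2 * (Ng : ZMod Nx)) := by rw [h']; exact wavePhase_pow Ng φ m
    rw [pow_succ] at hw
    have hup : up Ng s = (0, s.2 + (Ng : ZMod Nx)) := dif_neg h
    have hph : slicePhase φ s = Complex.exp (φ * Complex.I) := if_pos h'
    simp only [fourierMatrix, Matrix.of_apply, hup, hph, hc,
      mul_add, AddChar.map_add_eq_mul, Fin.val_zero, pow_zero]
    linear_combination (-ZMod.stdAddChar (m.2 * s.2)) * hw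

theorem slicePhase_mul_conj (φ : ℝ) (s : Site Nt Nx) :
    slicePhase φ s * conj (slicePhase φ s) = 1 := by
  unfold slicePhase
  split_ifs
  · rw [Complex.mul_conj', Complex.norm_exp_ofReal_mul_I]; simp
  · simp

theorem shiftV_mul_fourierMatrix (φ : ℝ) : shiftV Ng φ * fourierMatrix (Nt := Nt) (Nx := Nx) Ng φ
    = fourierMatrix Ng φ * Matrix.diagonal fun m => (wavePhase Ng φ m)⁻¹ := by
  ext s m
  obtain ⟨s, rfl⟩ : ∃ r, s = up Ng r := ⟨down Ng s, (up_down Ng s).symm⟩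
  rw [Matrix.mul_diagonal, Matrix.mul_apply, Finset.sum_eq_single s]
  · simp only [shiftV, Matrix.of_apply, if_true]
    have h := fourierMatrix_up Ng φ s m
    have h2 := slicePhase_mul_conj φ s
    have h3 := wavePhase_ne_zero Ng φ m
    field_simp
    linear_combination (-slicePhase φ s) * h + fourierMatrix Ng φ (up Ng s) m * h2
  · intro s' _ hs'
    have : up Ng s ≠ up Ng s' := fun h => hs' ((upEquiv Ng).injective h.symm)
    simp [shiftV, this]
  · simp

theorem shiftV_conjTranspose_mul_fourierMatrix (φ : ℝ) :
    (shiftV Ng φ).conjTranspose * fourierMatrix (Nt := Nt) (Nx := Nx) Ng φ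
      = fourierMatrix Ng φ * Matrix.diagonal fun m => wavePhase Ng φ m := by
  ext s m
  rw [Matrix.mul_diagonal, Matrix.mul_apply, Finset.sum_eq_single (up Ng s)]
  · simp only [shiftV, Matrix.conjTranspose_apply, Matrix.of_apply, if_true, Complex.star_def]
    rw [← fourierMatrix_up, mul_comm]
  · intro s' _ hs'
    simp [shiftV, hs']
  · simp

/-- The shifts and their adjoints have eigenvalues `χ^(∓1)` and `w^(∓1)` on a plane wave. In the `2
× 2` determinant of a mode the terms of second order in `λ` combine through `(w + w⁻¹)² - (w - w⁻¹)²
= 4`, so the cosine of the wave angle enters only linearly. -/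
theorem det_gaussMatrix (φ : ℝ) (p : ℂ × ℂ) :
    (gaussMatrix (Nt := Nt) (Nx := Nx) Ng φ p).det = ∏ m : Site Nt Nx,
      (1 + p.1 ^ 2 + p.2 ^ 2 - 2 * p.2 * Complex.cos (2 * Real.pi * m.2.val / Nx)
        - p.1 * Complex.cos (waveAngle Ng φ m)
          * (2 - 2 * p.2 * Complex.cos (2 * Real.pi * m.2.val / Nx))) := by
  have hR := shiftH_mul_fourierMatrix (Nt := Nt) (Nx := Nx) Ng φ
  have hR' := shiftH_conjTranspose_mul_fourierMatrix (Nt := Nt) (Nx := Nx) Ng φ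
  have hV := shiftV_mul_fourierMatrix (Nt := Nt) (Nx := Nx) Ng φ
  have hV' := shiftV_conjTranspose_mul_fourierMatrix (Nt := Nt) (Nx := Nx) Ng φ
  set F := fourierMatrix (Nt := Nt) (Nx := Nx) Ng φ with hF
  set w := fun m : Site Nt Nx => wavePhase Ng φ m with hw
  set χ := fun m : Site Nt Nx => (ZMod.stdAddChar m.2 : ℂ) with hχ
  set χ' := fun m : Site Nt Nx => (ZMod.stdAddChar (-m.2) : ℂ) with hχ'
  set w' := fun m : Site Nt Nx => (wavePhase Ng φ m)⁻¹ with hw'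
  have h1 : ∀ d d' : Site Nt Nx → ℂ, ∀ a b : ℂ,
      Matrix.diagonal (fun m => 1 - a * d m - b * (w' m + w m))
        = 1 - a • Matrix.diagonal d - b • (Matrix.diagonal w' + Matrix.diagonal w) := by
    intro d d' a b
    ext i j
    by_cases hij : i = j
    · subst hij; simp
    · simp [hij]
  have h2 : ∀ b : ℂ, Matrix.diagonal (fun m => b * (w' m - w m))
        = b • (Matrix.diagonal w' - Matrix.diagonal w) := by
    intro b
    ext i j
    by_cases hij : i = j
    · subst hij; simp
    · simp [hij]
  rw [gaussMatrix, det_fromBlocks_of_eigenbasis (F := F)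
    (a := fun m => 1 - p.2 * χ' m - p.1 / 2 * (w' m + w m))
    (b := fun m => -(p.1 / 2) * (w' m - w m)) (c := fun m => -(p.1 / 2) * (w' m - w m))
    (d := fun m => 1 - p.2 * χ m - p.1 / 2 * (w' m + w m))
    (fourierMatrix_det_ne_zero Ng φ)]
  · refine Finset.prod_congr rfl fun m _ => ?_
    have e1 : w m * w' m = 1 := mul_inv_cancel₀ (wavePhase_ne_zero Ng φ m)
    have e2 : χ m * χ' m = 1 := by
      simp only [hχ, hχ']
      rw [← AddChar.map_add_eq_mul, add_neg_cancel, AddChar.map_zero_eq_one]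
    have e3 : 2 * Complex.cos (2 * Real.pi * m.2.val / Nx) = χ m + χ' m := by
      simp only [hχ, hχ']
      rw [Complex.two_cos, AddChar.map_neg_eq_inv, stdAddChar_eq_exp, neg_mul, Complex.exp_neg]
    have e4 : 2 * Complex.cos (waveAngle Ng φ m) = w m + w' m := by
      simp only [hw, hw', wavePhase]
      rw [Complex.two_cos, neg_mul, Complex.exp_neg]
    have e3' : Complex.cos (2 * Real.pi * m.2.val / Nx) = (χ m + χ' m) / 2 := by
      rw [← e3]; ring
    have e4' : Complex.cos (waveAngle Ng φ m) = (w m + w' m) / 2 := by rw [← e4]; ring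
    rw [e3', e4']
    linear_combination (p.2 ^ 2) * e2 + (p.1 ^ 2) * e1
  · rw [h1 χ' χ']
    simp only [Matrix.sub_mul, Matrix.mul_sub, Matrix.add_mul, Matrix.mul_add, Matrix.smul_mul,
      Matrix.mul_smul, hR, hV, hV', one_mul, mul_one]
  · rw [h2]
    simp only [Matrix.sub_mul, Matrix.mul_sub, Matrix.smul_mul, Matrix.mul_smul, hV, hV']
  · rw [h2]
    simp only [Matrix.sub_mul, Matrix.mul_sub, Matrix.smul_mul, Matrix.mul_smul, hV, hV']
  · rw [h1 χ χ]
    simp only [Matrix.sub_mul, Matrix.mul_sub, Matrix.add_mul, Matrix.mul_add, Matrix.smul_mul,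
      Matrix.mul_smul, hR', hV, hV', one_mul, mul_one]

/-- The case `X = arcosh a`, `α = 0` of `prod_cosh_sub_cos`, with `ch(nX) - 1 = 2 sh²(nX/2)`. -/
theorem prod_inv_sub_cos {n : ℕ} (hn : 2 < n) (a : ℂ) :
    ∏ k ∈ Finset.range n, (a - Complex.cos (2 * Real.pi * k / n))
      = Complex.sinh (1 / 2 * n * arcosh a) ^ 2 / 2 ^ (n - 2) := by
  have h := prod_cosh_sub_cos (by omega : 0 < n) (arcosh a) 0
  simp only [cosh_arcosh, zero_add, Complex.cos_zero] at h
  rw [Finset.prod_mul_distrib, Finset.prod_const, Finset.card_range] at h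
  have e : Complex.cosh (n * arcosh a) = 2 * Complex.sinh (1 / 2 * n * arcosh a) ^ 2 + 1 := by
    rw [show (n : ℂ) * arcosh a = 2 * (1 / 2 * n * arcosh a) by ring, Complex.cosh_two_mul,
      Complex.cosh_sq]
    ring
  rw [e] at h
  have e2 : (2 : ℂ) ^ n = 2 ^ (n - 2) * 4 := by
    rw [show (4 : ℂ) = 2 ^ 2 by norm_num, ← pow_add]
    congr 1
    omega
  rw [e2] at h
  rw [eq_div_iff (pow_ne_zero _ two_ne_zero)]
  linear_combination h / 4

theorem det_gaussMatrix_eq (hNx : 2 < Nx) {lam tau : ℂ} (hlam : lam ≠ 0) (htau : tau ≠ 0)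
    (hC : ∀ k < Nx, 2 - 2 * tau * Complex.cos (2 * Real.pi * k / Nx) ≠ 0) (φ : ℝ) :
    (gaussMatrix (Nt := Nt) (Nx := Nx) Ng φ (lam, tau)).det
      = (lam * tau) ^ (Nt * Nx) / 2 ^ (Nt * (Nx - 2))
        * Complex.sinh (1 / 2 * Nx * arcosh tau⁻¹) ^ (2 * Nt)
        * ∏ k ∈ Finset.range Nx, (2 * (Complex.cosh (tX Nt Nx lam tau k)
            - Complex.cos (φ - twistAngle Nx Ng * k))) := by
  rw [det_gaussMatrix, Fintype.prod_prod_type, Finset.prod_comm]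
  -- By the choice of `C_k`, with `c` the horizontal cosine and `w` the wave angle, the mode factor
  -- is `λτ(τ⁻¹ - c) * 2(C_k - cos w)`. Only the second factor depends on the vertical momentum.
  have hk : ∀ k : ZMod Nx, ∏ j : Fin Nt,
      (1 + lam ^ 2 + tau ^ 2 - 2 * tau * Complex.cos (2 * Real.pi * k.val / Nx)
        - lam * Complex.cos (waveAngle Ng φ (j, k))
          * (2 - 2 * tau * Complex.cos (2 * Real.pi * k.val / Nx)))
      = (lam * tau * (tau⁻¹ - Complex.cos (2 * Real.pi * k.val / Nx))) ^ Nt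
        * (2 * (Complex.cosh (tX Nt Nx lam tau k.val)
            - Complex.cos (φ - twistAngle Nx Ng * k.val))) := by
    intro k
    have hne := hC k.val (ZMod.val_lt k)
    have h := prod_cosh_sub_cos (Nat.pos_of_ne_zero (NeZero.ne Nt))
      (arcosh (coefC Nx lam tau k.val)) (twistAngle Nx Ng * k.val - φ)
    rw [cosh_arcosh, ← Fin.prod_univ_eq_prod_range (fun j => 2 * (coefC Nx lam tau k.val
      - Complex.cos ((twistAngle Nx Ng * k.val - φ + 2 * Real.pi * (j : ℕ)) / Nt)))] at h
    have hcos : Complex.cos (φ - twistAngle Nx Ng * k.val)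
        = Complex.cos (twistAngle Nx Ng * k.val - φ) := by rw [← Complex.cos_neg, neg_sub]
    rw [tX, hcos, ← h,
      ← Fin.prod_const Nt (lam * tau * _), ← Finset.prod_mul_distrib]
    refine Finset.prod_congr rfl fun j _ => ?_
    rw [waveAngle, coefC]
    generalize Complex.cos (2 * Real.pi * k.val / Nx) = c at *
    generalize Complex.cos _ = d
    have hne' : 1 - tau * c ≠ 0 := fun h0 => hne (by linear_combination 2 * h0)
    field_simp
    ring
  simp only [hk]
  rw [prod_zmod_val (fun k : ℕ => (lam * tau * (tau⁻¹ - Complex.cos (2 * Real.pi * k / Nx))) ^ Nt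
        * (2 * (Complex.cosh (tX Nt Nx lam tau k)
            - Complex.cos (φ - twistAngle Nx Ng * k)))), Finset.prod_mul_distrib, Finset.prod_pow,
    Finset.prod_mul_distrib, prod_inv_sub_cos hNx, Finset.prod_const, Finset.card_range]
  congr 1
  rw [mul_pow, div_pow, ← pow_mul, ← pow_mul, ← pow_mul, mul_comm Nx Nt, mul_comm (Nx - 2) Nt]
  ring

end Lattice

/-! ### Conjugacy classes of `SU(2)` -/

/-- The first row of a matrix of `SU(2)`. -/
def firstRow (g : SU2) : Spinor :=
  !₂[(g : Matrix (Fin 2) (Fin 2) ℂ) 0 0, (g : Matrix (Fin 2) (Fin 2) ℂ) 0 1]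

theorem quat_firstRow (g : SU2) : quat (firstRow g) = g := by
  obtain ⟨h0, h1⟩ := SU2.apply_one g
  ext i j
  fin_cases i <;> fin_cases j <;> simp [quat, firstRow, h0, h1]

theorem quat_sub (ζ ξ : Spinor) : quat (ζ - ξ) = quat ζ - quat ξ := by
  ext i j
  fin_cases i <;> fin_cases j <;> simp [quat]
  ring

theorem SU2.add_inv (g : SU2) : (g : Matrix (Fin 2) (Fin 2) ℂ) + (g⁻¹ : SU2)
    = ((2 * ((g : Matrix (Fin 2) (Fin 2) ℂ) 0 0).re : ℝ) : ℂ) • 1 := by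
  obtain ⟨h0, h1⟩ := SU2.apply_one g
  rw [SU2.coe_inv]
  ext i j
  fin_cases i <;> fin_cases j <;>
    simp [Matrix.star_apply, h0, h1, Complex.add_conj]
  rw [add_comm, Complex.add_conj]
  simp

theorem SU2.coe_mul_coe_inv (g : SU2) :
    (g : Matrix (Fin 2) (Fin 2) ℂ) * ((g⁻¹ : SU2) : Matrix (Fin 2) (Fin 2) ℂ) = 1 := by
  rw [← Submonoid.coe_mul, mul_inv_cancel, Submonoid.coe_one]

theorem SU2.coe_inv_mul_coe (g : SU2) :
    ((g⁻¹ : SU2) : Matrix (Fin 2) (Fin 2) ℂ) * (g : Matrix (Fin 2) (Fin 2) ℂ) = 1 := by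
  rw [← Submonoid.coe_mul, inv_mul_cancel, Submonoid.coe_one]

theorem diagSU2_re (φ : ℝ) : ((diagSU2 φ : Matrix (Fin 2) (Fin 2) ℂ) 0 0).re = Real.cos φ := by
  simp [diagSU2, Complex.exp_ofReal_mul_I_re]

/-- Equal traces mean `H + H⁻¹ = D + D⁻¹`. Multiplying by `H` gives `H (H - D⁻¹) = (H - D⁻¹) D`, so
the quaternion `H - D⁻¹`, once normalized, conjugates `D` to `H`. If it vanishes, the Weyl
reflection exchanging the two eigenvalues does the job. -/
theorem exists_conj_diagSU2 (H : SU2) (φ : ℝ)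
    (h : ((H : Matrix (Fin 2) (Fin 2) ℂ) 0 0).re = Real.cos φ) :
    ∃ u : SU2, H = u * diagSU2 φ * u⁻¹ := by
  set D := diagSU2 φ with hD
  by_cases hz : H = D⁻¹
  · have hu := quat_mem_SU2 (ζ := !₂[0, 1]) (by simp [EuclideanSpace.norm_eq, Fin.sum_univ_two])
    refine ⟨⟨_, hu⟩, ?_⟩
    rw [eq_mul_inv_iff_mul_eq, hz]
    apply Subtype.ext
    rw [Submonoid.coe_mul, Submonoid.coe_mul, SU2.coe_inv]
    have hc : conj (Complex.exp (φ * Complex.I)) = Complex.exp (-(φ * Complex.I)) := by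
      rw [← Complex.exp_conj]; simp
    have hc' : conj (Complex.exp (-(φ * Complex.I))) = Complex.exp (φ * Complex.I) := by
      rw [← hc, Complex.conj_conj]
    ext i j
    fin_cases i <;> fin_cases j <;>
      simp [quat, hD, diagSU2, Matrix.mul_apply, Fin.sum_univ_two, Matrix.star_apply, hc, hc']
  · set ζ := firstRow H - firstRow D⁻¹ with hζ
    have hq : quat ζ = (H : Matrix (Fin 2) (Fin 2) ℂ) - (D⁻¹ : SU2) := by
      rw [hζ, quat_sub, quat_firstRow, quat_firstRow]
    have hζ0 : ζ ≠ 0 := by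
      intro h0
      apply hz
      apply Subtype.ext
      rw [← quat_firstRow, ← quat_firstRow, sub_eq_zero.1 h0]
    obtain ⟨g, hg⟩ := exists_quat_eq ζ
    have hn : (‖ζ‖ : ℂ) ≠ 0 := Complex.ofReal_ne_zero.2 (norm_ne_zero_iff.2 hζ0)
    have hcomm : (H : Matrix (Fin 2) (Fin 2) ℂ) * quat ζ = quat ζ * (D : Matrix (Fin 2) (Fin 2) ℂ) := by
      have h1 := SU2.add_inv H
      have h2 := SU2.add_inv D
      rw [h] at h1
      rw [hD, diagSU2_re, ← hD, ← h1] at h2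
      have h3 : (H : Matrix (Fin 2) (Fin 2) ℂ) * (D + (D⁻¹ : SU2)) = H * (H + (H⁻¹ : SU2)) := by
        rw [h2]
      rw [mul_add, mul_add, SU2.coe_mul_coe_inv H] at h3
      rw [hq, mul_sub, sub_mul, SU2.coe_inv_mul_coe D, sub_eq_sub_iff_add_eq_add, ← h3]
    refine ⟨g, ?_⟩
    rw [eq_mul_inv_iff_mul_eq]
    apply Subtype.ext
    rw [hg, Matrix.mul_smul, Matrix.smul_mul] at hcomm
    exact smul_right_injective _ hn hcomm

instance : haarSU2.IsMulLeftInvariant := by unfold haarSU2; infer_instance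

/-! ### Analytic continuation in the couplings -/

section Continuation

variable {Nt Nx : ℕ} [NeZero Nt] [NeZero Nx] (Ng : ℤ)

/-- Gauge invariance: left translation of every node variable by `u` undoes the conjugation. -/
theorem psiLS_conj (u : SU2) (hh hv : Site Nt Nx → SU2) (a b : Site Nt Nx → ℕ) :
    psiLS Ng (fun s => u * hh s * u⁻¹) (fun s => u * hv s * u⁻¹) a b = psiLS Ng hh hv a b := by
  have e : ∀ x y z : SU2, (u * x)⁻¹ * (u * y * u⁻¹) * (u * z) = x⁻¹ * y * z := fun x y z => by group
  have h := integral_mul_left_eq_self (μ := Measure.pi fun _ : Site Nt Nx => haarSU2)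
    (fun g : Site Nt Nx → SU2 =>
      ∏ s, (expect spinUp ((g (right s))⁻¹ * (u * hh s * u⁻¹) * g s : SU2) ^ a s
        * expect spinPlus ((g (up Ng s))⁻¹ * (u * hv s * u⁻¹) * g s : SU2) ^ b s)) (fun _ => u)
  simp only [Pi.mul_apply, e] at h
  exact h.symm

theorem coherentSeries_conj (u H : SU2) :
    coherentSeries (Nt := Nt) (Nx := Nx) Ng (fun _ => 1) (lastSlice (u * H * u⁻¹))
      = coherentSeries (Nt := Nt) (Nx := Nx) Ng (fun _ => 1) (lastSlice H) := by
  have e : (lastSlice (u * H * u⁻¹) : Site Nt Nx → SU2) = fun s => u * lastSlice H s * u⁻¹ := by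
    ext s : 1
    unfold lastSlice
    split_ifs <;> simp
  have e1 : (fun _ => u * 1 * u⁻¹ : Site Nt Nx → SU2) = fun _ => 1 := by simp
  have key : ∀ a b : Site Nt Nx → ℕ, psiLS Ng (fun _ => 1) (lastSlice (u * H * u⁻¹)) a b
      = psiLS Ng (fun _ => 1) (lastSlice H) a b := by
    intro a b
    rw [e, ← psiLS_conj Ng u (fun _ => 1) (lastSlice H), e1]
  ext p
  exact tsum_congr fun c => congrArg (weight Ng p.1 p.2 c.1 c.2 * ·) (key c.1 c.2)

/-- Uniqueness: for any continuation `F`, the product `F * D` is analytic and equals `1` near the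
origin, hence throughout the connected domain. Existence: `D⁻¹` on the set where `D` does not
vanish, which is open and contains the convergence domain. -/
theorem isContinuedValue_inv_iff {S D : ℂ × ℂ → ℂ}
    (hD : AnalyticOnNhd ℂ D Set.univ)
    (hS : ∀ q ∈ convergenceDomain, D q ≠ 0 ∧ S q = (D q)⁻¹)
    (hline : ∀ q : ℂ × ℂ, {z : ℂ | D (z • q) = 0}.Countable)
    {p : ℂ × ℂ} (hp : D p ≠ 0) (z : ℂ) : IsContinuedValue S p z ↔ z = (D p)⁻¹ := by
  have hcont : Continuous D := continuousOn_univ.1 hD.continuousOn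
  have h0 : (0 : ℂ × ℂ) ∈ convergenceDomain := by simp [convergenceDomain]
  have hopen : IsOpen convergenceDomain :=
    isOpen_lt (by fun_prop : Continuous fun q : ℂ × ℂ => ‖q.1‖ + ‖q.2‖) continuous_const
  constructor
  · rintro ⟨U, F, hU, hUc, hsub, hpU, hF, hFS, rfl⟩
    have h1 : Set.EqOn (fun q => F q * D q) (fun _ => 1) U := by
      refine AnalyticOnNhd.eqOn_of_preconnected_of_eventuallyEq (hF.mul (hD.mono (Set.subset_univ _)))
        analyticOnNhd_const hUc.isPreconnected (hsub h0) ?_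
      filter_upwards [hopen.mem_nhds h0] with q hq
      obtain ⟨h2, h3⟩ := hS q hq
      rw [hFS hq, h3, inv_mul_cancel₀ h2]
    exact eq_inv_of_mul_eq_one_left (h1 hpU)
  · rintro rfl
    refine ⟨{q | D q ≠ 0}, fun q => (D q)⁻¹, isOpen_ne_fun hcont continuous_const, ⟨⟨p, hp⟩, ?_⟩,
      fun q hq => (hS q hq).1, hp, fun q hq => (hD q trivial).inv hq,
      fun q hq => (hS q hq).2.symm, rfl⟩
    refine isPreconnected_of_forall 0 fun q hq => ?_
    -- The nonvanishing set is connected because each of its points is joined to the origin inside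
    -- the complex line through it, a plane with countably many points removed.
    have hconn : IsConnected {z : ℂ | D (z • q) = 0}ᶜ :=
      (hline q).isConnected_compl_of_one_lt_rank (by simp)
    refine ⟨(fun z : ℂ => z • q) '' {z : ℂ | D (z • q) = 0}ᶜ, ?_, ⟨0, ?_, zero_smul _ _⟩,
      ⟨1, ?_, one_smul _ _⟩, hconn.isPreconnected.image _ (by fun_prop)⟩
    · rintro _ ⟨z, hz, rfl⟩
      exact hz
    · simpa using (hS 0 h0).1
    · simpa using hq

theorem analyticOnNhd_det_gaussMatrix (φ : ℝ) :
    AnalyticOnNhd ℂ (fun p => (gaussMatrix (Nt := Nt) (Nx := Nx) Ng φ p).det) Set.univ := by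
  intro p _
  simp_rw [det_gaussMatrix]
  refine Finset.analyticAt_fun_prod _ fun m _ => ?_
  have h1 : AnalyticAt ℂ (fun p : ℂ × ℂ => p.1) p := analyticAt_fst
  have h2 : AnalyticAt ℂ (fun p : ℂ × ℂ => p.2) p := analyticAt_snd
  fun_prop

/-- Along a complex line the determinant is a polynomial in `z` with value `1` at `z = 0`. -/
theorem countable_det_gaussMatrix_line (φ : ℝ) (q : ℂ × ℂ) :
    {z : ℂ | (gaussMatrix (Nt := Nt) (Nx := Nx) Ng φ (z • q)).det = 0}.Countable := by
  open Polynomial in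
  set P : ℂ[X] := ∏ m : Site Nt Nx,
      (1 + C (q.1 ^ 2 + q.2 ^ 2) * X ^ 2 - C (2 * q.2 * Complex.cos (2 * Real.pi * m.2.val / Nx)) * X
        - C (q.1 * Complex.cos (waveAngle Ng φ m)) * X
          * (2 - C (2 * q.2 * Complex.cos (2 * Real.pi * m.2.val / Nx)) * X)) with hP
  have heval : ∀ z : ℂ, (gaussMatrix (Nt := Nt) (Nx := Nx) Ng φ (z • q)).det = P.eval z := by
    intro z
    rw [det_gaussMatrix, hP, Polynomial.eval_prod]
    refine Finset.prod_congr rfl fun m _ => ?_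
    simp
    ring
  have hP0 : P ≠ 0 := by
    intro h
    have h1 := heval 0
    rw [h, Polynomial.eval_zero, det_gaussMatrix] at h1
    simp at h1
  simp_rw [heval]
  exact (Polynomial.finite_setOfPred_isRoot hP0).countable

theorem two_mul_cosh_sub_cos (Y θ : ℂ) : 2 * (Complex.cosh Y - Complex.cos θ)
    = Complex.exp (-Y) * (Complex.exp Y - Complex.exp (θ * Complex.I))
      * (Complex.exp Y - Complex.exp (-(θ * Complex.I))) := by
  have e1 : Complex.exp (-Y) * Complex.exp Y = 1 := by rw [← Complex.exp_add]; simp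
  have e2 : Complex.exp (θ * Complex.I) * Complex.exp (-(θ * Complex.I)) = 1 := by
    rw [← Complex.exp_add]; simp
  rw [mul_sub, Complex.two_cos, Complex.cosh, neg_mul]
  linear_combination (-Complex.exp Y + Complex.exp (θ * Complex.I)
    + Complex.exp (-(θ * Complex.I))) * e1 - Complex.exp (-Y) * e2

theorem cosh_sub_cos_ne_zero {Y : ℂ} (hY : 0 < Y.re) (θ : ℝ) :
    2 * (Complex.cosh Y - Complex.cos θ) ≠ 0 := by
  rw [two_mul_cosh_sub_cos]
  have h : 1 < ‖Complex.exp Y‖ := by rw [Complex.norm_exp]; exact Real.one_lt_exp_iff.2 hY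
  refine mul_ne_zero (mul_ne_zero (Complex.exp_ne_zero _) ?_) ?_
  · intro h0
    rw [sub_eq_zero.1 h0, Complex.norm_exp_ofReal_mul_I] at h
    exact lt_irrefl _ h
  · intro h0
    rw [sub_eq_zero.1 h0, ← neg_mul, ← Complex.ofReal_neg, Complex.norm_exp_ofReal_mul_I] at h
    exact lt_irrefl _ h

/-- The factor of the residue sum that does not depend on the angle. -/
def prefactor (Nt Nx : ℕ) (lam tau : ℂ) : ℂ :=
  2 ^ (Nt * (Nx - 2)) / (lam * tau) ^ (Nt * Nx)
    * (1 / Complex.sinh (1 / 2 * Nx * arcosh tau⁻¹) ^ (2 * Nt))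

/-- The product over the momenta of the inverse eigenvalue determinants. -/
def modeProduct (Nx : ℕ) (Y : ℕ → ℂ) (θ φ : ℝ) : ℂ :=
  ∏ k ∈ Finset.range Nx, (2 * (Complex.cosh (Y k) - Complex.cos (φ - θ * k)))⁻¹

theorem modeProduct_factor_ne_zero {Nx : ℕ} {Y : ℕ → ℂ} (hY : ∀ k < Nx, 0 < (Y k).re) (θ φ : ℝ)
    {k : ℕ} (hk : k < Nx) : 2 * (Complex.cosh (Y k) - Complex.cos (φ - θ * k)) ≠ 0 := by
  have h := cosh_sub_cos_ne_zero (hY k hk) (φ - θ * k)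
  push_cast at h
  exact h

theorem det_gaussMatrix_ne_zero_and_inv (hNx : 2 < Nx) {lam tau : ℂ} (hlam : lam ≠ 0) (htau : tau ≠ 0)
    (hC : ∀ k < Nx, 2 - 2 * tau * Complex.cos (2 * Real.pi * k / Nx) ≠ 0)
    (hY : ∀ k < Nx, 0 < (tX Nt Nx lam tau k).re) (φ : ℝ) :
    (gaussMatrix (Nt := Nt) (Nx := Nx) Ng φ (lam, tau)).det ≠ 0 ∧
    (gaussMatrix (Nt := Nt) (Nx := Nx) Ng φ (lam, tau)).det⁻¹
      = prefactor Nt Nx lam tau * modeProduct Nx (tX Nt Nx lam tau) (twistAngle Nx Ng) φ := by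
  -- By `prod_inv_sub_cos` at `τ⁻¹`, a zero here would be a zero of one of the denominators in the
  -- `C_k`.
  have hsinh : Complex.sinh (1 / 2 * Nx * arcosh tau⁻¹) ≠ 0 := by
    have h := prod_inv_sub_cos hNx tau⁻¹
    intro h0
    rw [h0, zero_pow two_ne_zero, zero_div, Finset.prod_eq_zero_iff] at h
    obtain ⟨k, hk, h1⟩ := h
    refine hC k (Finset.mem_range.1 hk) ?_
    rw [← sub_eq_zero.1 h1]
    field_simp
    ring
  rw [det_gaussMatrix_eq Ng hNx hlam htau hC]
  have h2 : (2 : ℂ) ^ (Nt * (Nx - 2)) ≠ 0 := pow_ne_zero _ two_ne_zero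
  constructor
  · refine mul_ne_zero (mul_ne_zero (div_ne_zero (pow_ne_zero _ (mul_ne_zero hlam htau)) h2)
      (pow_ne_zero _ hsinh)) (Finset.prod_ne_zero_iff.2 fun k hk => ?_)
    exact modeProduct_factor_ne_zero hY _ _ (Finset.mem_range.1 hk)
  · rw [prefactor, modeProduct, mul_inv, mul_inv, inv_div, Finset.prod_inv_distrib,
      one_div (Complex.sinh _ ^ _)]

/-- Any angle with the right cosine is allowed. This freedom later yields the symmetry `φ ↦ 2π - φ`
of the mode product. -/
theorem coherentState_eq (hNx : 2 < Nx) {lam tau : ℂ} (hlam : lam ≠ 0) (htau : tau ≠ 0)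
    (hC : ∀ k < Nx, 2 - 2 * tau * Complex.cos (2 * Real.pi * k / Nx) ≠ 0)
    (hY : ∀ k < Nx, 0 < (tX Nt Nx lam tau k).re) (H : SU2) (φ : ℝ)
    (hH : ((H : Matrix (Fin 2) (Fin 2) ℂ) 0 0).re = Real.cos φ) :
    (∃! z : ℂ, IsContinuedValue (coherentSeries (Nt := Nt) (Nx := Nx) Ng (fun _ => 1)
      (lastSlice H)) (lam, tau) z) ∧
    coherentState (Nt := Nt) (Nx := Nx) Ng (lam, tau) (fun _ => 1) (lastSlice H)
      = prefactor Nt Nx lam tau * modeProduct Nx (tX Nt Nx lam tau) (twistAngle Nx Ng) φ := by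
  obtain ⟨u, rfl⟩ := exists_conj_diagSU2 H φ hH
  obtain ⟨hD, hinv⟩ := det_gaussMatrix_ne_zero_and_inv (Nt := Nt) Ng hNx hlam htau hC hY φ
  have key := isContinuedValue_inv_iff
    (S := coherentSeries (Nt := Nt) (Nx := Nx) Ng (fun _ => 1) (lastSlice (u * diagSU2 φ * u⁻¹)))
    (analyticOnNhd_det_gaussMatrix (Nt := Nt) (Nx := Nx) Ng φ)
    (fun q hq => by
      rw [coherentSeries_conj]
      exact coherentSeries_diag Ng φ hq)
    (countable_det_gaussMatrix_line Ng φ) hD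
  refine ⟨⟨_, (key _).2 rfl, fun y hy => (key y).1 hy⟩, ?_⟩
  have hex : ∃ z, IsContinuedValue (coherentSeries (Nt := Nt) (Nx := Nx) Ng (fun _ => 1)
      (lastSlice (u * diagSU2 φ * u⁻¹))) (lam, tau) z := ⟨_, (key _).2 rfl⟩
  rw [coherentState, dif_pos hex, (key _).1 hex.choose_spec, hinv]

end Continuation

/-! ### Weyl integration formula -/

/-- Bounded support allows termwise integration of the exponential series, so the moments determine
the characteristic function and hence the measure. -/
theorem hasSum_charFun_of_abs_le_one {μ : Measure ℝ} [IsFiniteMeasure μ] (hμ : ∀ᵐ x ∂μ, |x| ≤ 1)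
    (t : ℝ) : HasSum (fun n : ℕ => (t * Complex.I) ^ n / (n.factorial : ℂ) * ((∫ x, x ^ n ∂μ : ℝ) : ℂ))
      (charFun μ t) := by
  set F : ℕ → ℝ → ℂ := fun n x => (t * Complex.I) ^ n / (n.factorial : ℂ) * ((x ^ n : ℝ) : ℂ) with hF
  have hnorm : ∀ n, ∀ᵐ x ∂μ, ‖F n x‖ ≤ |t| ^ n / n.factorial := by
    intro n
    filter_upwards [hμ] with x hx
    simp only [hF, norm_mul, norm_div, norm_pow, Complex.norm_real, Complex.norm_I, mul_one,
      Complex.norm_natCast, Real.norm_eq_abs]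
    exact mul_le_of_le_one_right (by positivity) (pow_le_one₀ (abs_nonneg _) hx)
  have hint : ∀ n, Integrable (F n) μ := fun n =>
    (integrable_const (|t| ^ n / (n.factorial : ℝ))).mono' (by fun_prop) (hnorm n)
  have hsum : Summable fun n => ∫ x, ‖F n x‖ ∂μ := by
    refine Summable.of_nonneg_of_le (fun n => integral_nonneg fun _ => norm_nonneg _) (fun n => ?_)
      ((Real.summable_pow_div_factorial |t|).mul_left (μ.real Set.univ))
    have h := integral_mono_ae (hint n).norm (integrable_const (|t| ^ n / (n.factorial : ℝ))) (hnorm n)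
    rwa [integral_const, smul_eq_mul] at h
  have h := hasSum_integral_of_summable_integral_norm hint hsum
  have e : ∀ x : ℝ, ∑' n, F n x = Complex.exp (t * x * Complex.I) := by
    intro x
    rw [Complex.exp_eq_exp_ℂ, NormedSpace.exp_eq_tsum_div]
    refine tsum_congr fun n => ?_
    simp only [hF, Complex.ofReal_pow]
    rw [show (t : ℂ) * x * Complex.I = t * Complex.I * x by ring, mul_pow (t * Complex.I)]
    ring
  simp_rw [e] at h
  rw [charFun_apply_real]
  have e2 : ∀ n, ∫ x, F n x ∂μ
      = (t * Complex.I) ^ n / (n.factorial : ℂ) * ((∫ x, x ^ n ∂μ : ℝ) : ℂ) := fun n => by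
    rw [hF, integral_const_mul, integral_complex_ofReal]
  simp_rw [e2] at h
  exact h

theorem measure_ext_of_moments {μ ν : Measure ℝ} [IsFiniteMeasure μ] [IsFiniteMeasure ν]
    (hμ : ∀ᵐ x ∂μ, |x| ≤ 1) (hν : ∀ᵐ x ∂ν, |x| ≤ 1)
    (h : ∀ n : ℕ, ∫ x, x ^ n ∂μ = ∫ x, x ^ n ∂ν) : μ = ν := by
  refine Measure.ext_of_charFun (funext fun t => ?_)
  have h1 := hasSum_charFun_of_abs_le_one hμ t
  simp_rw [h] at h1
  exact h1.unique (hasSum_charFun_of_abs_le_one hν t)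

theorem abs_re_le_norm_spinor (ζ : Spinor) : |(ζ 0).re| ≤ ‖ζ‖ :=
  (Complex.abs_re_le_norm _).trans (PiLp.norm_apply_le ζ 0)

theorem integrable_re_pow_mul_exp (n : ℕ) :
    Integrable (fun ζ : Spinor => (ζ 0).re ^ n * Real.exp (-‖ζ‖ ^ 2)) := by
  refine (integrable_norm_pow_mul_exp_spinor n).mono' (Continuous.aestronglyMeasurable (by fun_prop))
    (Eventually.of_forall fun ζ => ?_)
  rw [norm_mul, norm_pow, Real.norm_eq_abs, Real.norm_of_nonneg (Real.exp_pos _).le]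
  have := abs_re_le_norm_spinor ζ
  gcongr

theorem norm_sq_add_smul_single (ζ : Spinor) (t : ℝ) :
    ‖ζ + t • (EuclideanSpace.single 0 1 : Spinor)‖ ^ 2 = ‖ζ‖ ^ 2 + 2 * (ζ 0).re * t + t ^ 2 := by
  simp only [Spinor.norm_sq, ← Complex.normSq_eq_norm_sq, Complex.normSq_apply]
  simp
  ring

/-- Integration by parts: with `x` the real part of `ζ 0`, the derivative of `x^(n+1) exp(-|ζ|²)` in
the direction of `x` has integral zero. -/
theorem integral_re_pow_add_two (n : ℕ) :
    2 * ∫ ζ : Spinor, (ζ 0).re ^ (n + 2) * Real.exp (-‖ζ‖ ^ 2)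
      = (n + 1) * ∫ ζ : Spinor, (ζ 0).re ^ n * Real.exp (-‖ζ‖ ^ 2) := by
  set g' : Spinor → ℝ := fun ζ => (n + 1) * ((ζ 0).re ^ n * Real.exp (-‖ζ‖ ^ 2))
    - 2 * ((ζ 0).re ^ (n + 2) * Real.exp (-‖ζ‖ ^ 2)) with hg'
  have h1 := (integrable_re_pow_mul_exp n).const_mul ((n : ℝ) + 1)
  have h2 := (integrable_re_pow_mul_exp (n + 2)).const_mul 2
  have hd : ∀ ζ : Spinor, HasLineDerivAt ℝ
      (fun ζ : Spinor => (ζ 0).re ^ (n + 1) * Real.exp (-‖ζ‖ ^ 2)) (g' ζ) ζ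
      (EuclideanSpace.single 0 1) := by
    intro ζ
    unfold HasLineDerivAt
    have hre : ∀ t : ℝ, ((ζ + t • (EuclideanSpace.single 0 1 : Spinor)) 0).re = (ζ 0).re + t := by
      simp
    simp only [norm_sq_add_smul_single, hre]
    have ha : HasDerivAt (fun t : ℝ => (ζ 0).re + t) 1 0 := (hasDerivAt_id (0 : ℝ)).const_add _
    have hb : HasDerivAt (fun t : ℝ => -(‖ζ‖ ^ 2 + 2 * (ζ 0).re * t + t ^ 2)) (-(2 * (ζ 0).re)) 0 :=
      ((((hasDerivAt_id (0 : ℝ)).const_mul (2 * (ζ 0).re)).const_add (‖ζ‖ ^ 2)).add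
        ((hasDerivAt_id (0 : ℝ)).pow 2)).neg.congr_deriv (by simp)
    exact ((ha.pow (n + 1)).mul hb.exp).congr_deriv (by
      simp only [Pi.pow_apply, Nat.add_sub_cancel, add_zero, mul_zero, mul_one, hg']
      push_cast
      ring_nf)
  have h := integral_bilinear_hasLineDerivAt_right_eq_neg_left_of_integrable (μ := volume)
    (B := ContinuousLinearMap.mul ℝ ℝ) (f := fun _ : Spinor => (1 : ℝ)) (f' := fun _ => 0) (g' := g')
    (g := fun ζ : Spinor => (ζ 0).re ^ (n + 1) * Real.exp (-‖ζ‖ ^ 2))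
    (v := EuclideanSpace.single 0 1) (by simp)
    (by simp only [ContinuousLinearMap.mul_apply', one_mul]; exact h1.sub h2)
    (by simpa using integrable_re_pow_mul_exp (n + 1))
    (fun x _ => hasDerivAt_const (0 : ℝ) (1 : ℝ)) (fun x _ => hd x)
  simp only [ContinuousLinearMap.mul_apply', one_mul, zero_mul, integral_zero, neg_zero] at h
  rw [hg', integral_sub h1 h2, integral_const_mul, integral_const_mul] at h
  linarith

theorem integral_re_spinor_eq_zero :
    ∫ ζ : Spinor, (ζ 0).re ^ 1 * Real.exp (-‖ζ‖ ^ 2) = 0 := by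
  have h := integral_neg_eq_self (fun ζ : Spinor => (ζ 0).re ^ 1 * Real.exp (-‖ζ‖ ^ 2)) volume
  simp only [PiLp.neg_apply, Complex.neg_re, norm_neg, pow_one, neg_mul, integral_neg] at h ⊢
  linarith

/-- The one-node case of `integral_quat_mul_exp`, now read backwards to obtain Haar moments from
Gaussian ones. -/
theorem integral_re_pow_spinor (n : ℕ) :
    ∫ ζ : Spinor, (ζ 0).re ^ n * Real.exp (-‖ζ‖ ^ 2)
      = Real.pi ^ 2 * Real.Gamma ((n : ℝ) / 2 + 2)
        * ∫ g : SU2, ((g : Matrix (Fin 2) (Fin 2) ℂ) 0 0).re ^ n ∂haarSU2 := by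
  have h := integral_quat_mul_exp (σ := Unit) (fun M => (((M () 0 0).re ^ n : ℝ) : ℂ))
    (by fun_prop) (fun _ => n) (by
      intro r M
      simp [mul_pow])
  simp only [Finset.univ_unique, Finset.sum_singleton, Finset.prod_singleton] at h
  have h1 := (volume_preserving_funUnique Unit Spinor).integral_comp
    (MeasurableEquiv.measurableEmbedding _)
    (fun ζ : Spinor => (((ζ 0).re ^ n * Real.exp (-‖ζ‖ ^ 2) : ℝ) : ℂ))
  have h2 := (measurePreserving_funUnique haarSU2 Unit).integral_comp
    (MeasurableEquiv.measurableEmbedding _)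
    (fun g : SU2 => ((((g : Matrix (Fin 2) (Fin 2) ℂ) 0 0).re ^ n : ℝ) : ℂ))
  apply Complex.ofReal_injective
  rw [Complex.ofReal_mul, ← integral_complex_ofReal, ← integral_complex_ofReal, ← h1, ← h2]
  convert h using 2
  · ext ζ
    simp [quat, MeasurableEquiv.funUnique_apply]
  · rfl

theorem integral_SU2_re_pow_add_two (n : ℕ) :
    (n + 4) * ∫ g : SU2, ((g : Matrix (Fin 2) (Fin 2) ℂ) 0 0).re ^ (n + 2) ∂haarSU2
      = (n + 1) * ∫ g : SU2, ((g : Matrix (Fin 2) (Fin 2) ℂ) 0 0).re ^ n ∂haarSU2 := by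
  have h := integral_re_pow_add_two n
  rw [integral_re_pow_spinor, integral_re_pow_spinor] at h
  have hG : Real.Gamma (((n + 2 : ℕ) : ℝ) / 2 + 2) = ((n : ℝ) / 2 + 2) * Real.Gamma ((n : ℝ) / 2 + 2) := by
    rw [← Real.Gamma_add_one (by positivity)]
    congr 1
    push_cast
    ring
  rw [hG] at h
  have h0 : Real.pi ^ 2 * Real.Gamma ((n : ℝ) / 2 + 2) ≠ 0 :=
    mul_ne_zero (pow_ne_zero _ Real.pi_ne_zero) (Real.Gamma_pos_of_pos (by positivity)).ne'
  apply mul_left_cancel₀ h0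
  linear_combination h

theorem integral_SU2_re_pow_one :
    ∫ g : SU2, ((g : Matrix (Fin 2) (Fin 2) ℂ) 0 0).re ^ 1 ∂haarSU2 = 0 := by
  have h := integral_re_pow_spinor 1
  rw [integral_re_spinor_eq_zero] at h
  have h0 : Real.pi ^ 2 * Real.Gamma (((1 : ℕ) : ℝ) / 2 + 2) ≠ 0 :=
    mul_ne_zero (pow_ne_zero _ Real.pi_ne_zero) (Real.Gamma_pos_of_pos (by positivity)).ne'
  exact (mul_eq_zero.1 h.symm).resolve_left h0

/-- The derivative of `sin³ cos^(n+1)` integrates to zero over `[0, π]`. The recursion is that of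
the Haar moments in `integral_SU2_re_pow_add_two`. -/
theorem integral_sin_sq_mul_cos_pow_add_two (n : ℕ) :
    (n + 4) * ∫ φ in (0 : ℝ)..Real.pi, Real.sin φ ^ 2 * Real.cos φ ^ (n + 2)
      = (n + 1) * ∫ φ in (0 : ℝ)..Real.pi, Real.sin φ ^ 2 * Real.cos φ ^ n := by
  have h := intervalIntegral.integral_eq_sub_of_hasDerivAt (a := 0) (b := Real.pi)
    (f := fun φ => Real.sin φ ^ 3 * Real.cos φ ^ (n + 1))
    (f' := fun φ => (n + 4) * (Real.sin φ ^ 2 * Real.cos φ ^ (n + 2))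
      - (n + 1) * (Real.sin φ ^ 2 * Real.cos φ ^ n))
    (fun φ _ => (((Real.hasDerivAt_sin φ).pow 3).mul ((Real.hasDerivAt_cos φ).pow (n + 1))).congr_deriv
      (by
        simp only [Pi.pow_apply, Nat.add_sub_cancel, Nat.reduceSub]
        push_cast
        linear_combination (-(n + 1) * Real.sin φ ^ 2 * Real.cos φ ^ n) * Real.sin_sq_add_cos_sq φ))
    (Continuous.intervalIntegrable (by fun_prop) _ _)
  rw [intervalIntegral.integral_sub (Continuous.intervalIntegrable (by fun_prop) _ _)
    (Continuous.intervalIntegrable (by fun_prop) _ _), intervalIntegral.integral_const_mul,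
    intervalIntegral.integral_const_mul] at h
  simp at h
  linarith

theorem integral_sin_sq_mul_cos_pow_one :
    ∫ φ in (0 : ℝ)..Real.pi, Real.sin φ ^ 2 * Real.cos φ ^ 1 = 0 := by
  have h := intervalIntegral.integral_eq_sub_of_hasDerivAt (a := 0) (b := Real.pi)
    (f := fun φ => Real.sin φ ^ 3 / 3) (f' := fun φ => Real.sin φ ^ 2 * Real.cos φ ^ 1)
    (fun φ _ => (((Real.hasDerivAt_sin φ).pow 3).div_const 3).congr_deriv (by
      simp only [Nat.reduceSub, Nat.cast_ofNat, pow_one]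
      ring))
    (Continuous.intervalIntegrable (by fun_prop) _ _)
  rw [h]
  simp

theorem integral_SU2_re_pow (n : ℕ) :
    ∫ g : SU2, ((g : Matrix (Fin 2) (Fin 2) ℂ) 0 0).re ^ n ∂haarSU2
      = 2 / Real.pi * ∫ φ in (0 : ℝ)..Real.pi, Real.sin φ ^ 2 * Real.cos φ ^ n := by
  induction n using Nat.twoStepInduction with
  | zero =>
    simp
  | one => rw [integral_SU2_re_pow_one, integral_sin_sq_mul_cos_pow_one, mul_zero]
  | more n ih _ =>
    have h1 := integral_SU2_re_pow_add_two n
    have h2 := integral_sin_sq_mul_cos_pow_add_two n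
    have h0 : (n : ℝ) + 4 ≠ 0 := by positivity
    apply mul_left_cancel₀ h0
    rw [h1, ih]
    linear_combination (-2 / Real.pi) * h2

theorem continuous_SU2_re :
    Continuous fun g : SU2 => ((g : Matrix (Fin 2) (Fin 2) ℂ) 0 0).re := by
  have : Continuous fun g : SU2 => (g : Matrix (Fin 2) (Fin 2) ℂ) := continuous_subtype_val
  exact Complex.continuous_re.comp (this.matrix_elem 0 0)

theorem abs_SU2_re_le_one (g : SU2) : |((g : Matrix (Fin 2) (Fin 2) ℂ) 0 0).re| ≤ 1 :=
  (Complex.abs_re_le_norm _).trans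
    (entry_norm_bound_of_unitary (Matrix.mem_specialUnitaryGroup_iff.1 g.2).1 0 0)

/-- The law of the real part of the upper left entry under Haar measure is the image under `cos` of
the density `(2/π) sin²` on `(0, π]`: both are supported in `[-1, 1]` and have the same moments. -/
theorem integral_SU2_class {f : ℝ → ℂ} (hf : Continuous f) :
    ∫ g : SU2, f ((g : Matrix (Fin 2) (Fin 2) ℂ) 0 0).re ∂haarSU2
      = 2 / Real.pi * ∫ φ in (0 : ℝ)..Real.pi, (Real.sin φ : ℂ) ^ 2 * f (Real.cos φ) := by
  set ρ : ℝ → NNReal := fun φ => (2 / Real.pi * Real.sin φ ^ 2).toNNReal with hρ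
  have hρm : Measurable ρ := by fun_prop
  have hρc : Continuous ρ := by fun_prop
  have hρv : ∀ φ, (ρ φ : ℝ) = 2 / Real.pi * Real.sin φ ^ 2 := fun φ =>
    Real.coe_toNNReal _ (by positivity)
  set ν₀ : Measure ℝ := (volume.restrict (Set.Ioc 0 Real.pi)).withDensity fun φ => (ρ φ : ENNReal)
    with hν₀
  have hfin : IsFiniteMeasure ν₀ := by
    refine isFiniteMeasure_withDensity ?_
    have hint : IntegrableOn (fun φ => (ρ φ : ℝ)) (Set.Ioc 0 Real.pi) :=
      ((NNReal.continuous_coe.comp hρc).integrableOn_Icc (a := 0) (b := Real.pi)).mono_set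
        Set.Ioc_subset_Icc_self
    have h2 := hint.2
    rw [hasFiniteIntegral_iff_enorm] at h2
    simpa using h2.ne
  have hint : ∀ {E : Type} [NormedAddCommGroup E] [NormedSpace ℝ E] (h : ℝ → E),
      ∫ φ, h φ ∂ν₀ = ∫ φ in (0 : ℝ)..Real.pi, (2 / Real.pi * Real.sin φ ^ 2) • h φ := by
    intro E _ _ h
    rw [hν₀, integral_withDensity_eq_integral_smul hρm, intervalIntegral.integral_of_le Real.pi_pos.le]
    simp only [NNReal.smul_def, hρv]
  have hmap : Measure.map (fun g : SU2 => ((g : Matrix (Fin 2) (Fin 2) ℂ) 0 0).re) haarSU2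
      = Measure.map Real.cos ν₀ := by
    have : IsProbabilityMeasure
        (Measure.map (fun g : SU2 => ((g : Matrix (Fin 2) (Fin 2) ℂ) 0 0).re) haarSU2) :=
      Measure.isProbabilityMeasure_map continuous_SU2_re.measurable.aemeasurable
    have hset : MeasurableSet {x : ℝ | |x| ≤ 1} := measurableSet_le (by fun_prop) measurable_const
    refine measure_ext_of_moments ?_ ?_ fun n => ?_
    · rw [ae_map_iff continuous_SU2_re.measurable.aemeasurable hset]
      exact Eventually.of_forall abs_SU2_re_le_one
    · rw [ae_map_iff Real.measurable_cos.aemeasurable hset]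
      exact Eventually.of_forall Real.abs_cos_le_one
    · rw [integral_map continuous_SU2_re.measurable.aemeasurable (by fun_prop),
        integral_map Real.measurable_cos.aemeasurable (by fun_prop), integral_SU2_re_pow, hint,
        ← intervalIntegral.integral_const_mul]
      simp only [smul_eq_mul, mul_assoc]
  rw [← integral_map (f := f) continuous_SU2_re.measurable.aemeasurable hf.aestronglyMeasurable, hmap,
    integral_map Real.measurable_cos.aemeasurable hf.aestronglyMeasurable, hint,
    ← intervalIntegral.integral_const_mul]
  refine intervalIntegral.integral_congr fun φ _ => ?_
  simp only [Complex.real_smul]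
  push_cast
  ring

/-! ### Residues -/

/-- Partial fractions: the Lagrange basis polynomials at the nodes `a k` sum to one; divide by `∏ (z
- a k)`. -/
theorem prod_inv_sub_eq_sum {ι : Type*} [DecidableEq ι] {s : Finset ι} (hs : s.Nonempty)
    {a : ι → ℂ} (ha : Set.InjOn a s) {z : ℂ} (hz : ∀ k ∈ s, z ≠ a k) :
    ∏ k ∈ s, (z - a k)⁻¹ = ∑ n ∈ s, (∏ k ∈ s.erase n, (a n - a k)⁻¹) * (z - a n)⁻¹ := by
  have h := congrArg (Polynomial.eval z) (Lagrange.sum_basis ha hs)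
  rw [Polynomial.eval_finsetSum, Polynomial.eval_one] at h
  rw [← mul_one (∏ k ∈ s, (z - a k)⁻¹), ← h, Finset.mul_sum]
  refine Finset.sum_congr rfl fun n hn => ?_
  rw [← Finset.mul_prod_erase s _ hn, Lagrange.basis, Polynomial.eval_prod]
  simp only [Lagrange.basisDivisor, Polynomial.eval_mul, Polynomial.eval_C, Polynomial.eval_sub,
    Polynomial.eval_X]
  rw [Finset.prod_mul_distrib]
  have h1 : (∏ k ∈ s.erase n, (z - a k)⁻¹) * ∏ k ∈ s.erase n, (z - a k) = 1 := by
    rw [← Finset.prod_mul_distrib]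
    exact Finset.prod_eq_one fun k hk =>
      inv_mul_cancel₀ (sub_ne_zero.2 (hz k (Finset.mem_of_mem_erase hk)))
  linear_combination ((z - a n)⁻¹ * ∏ k ∈ s.erase n, (a n - a k)⁻¹) * h1

theorem circleIntegral_mul_prod_inv_sub {ι : Type*} [DecidableEq ι] {s : Finset ι}
    (hs : s.Nonempty) {a : ι → ℂ} (ha : Set.InjOn a s) (hlt : ∀ k ∈ s, ‖a k‖ < 1) {g : ℂ → ℂ}
    (hg : DifferentiableOn ℂ g (Metric.closedBall 0 1)) :
    (∮ z in C(0, 1), g z * ∏ k ∈ s, (z - a k)⁻¹)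
      = 2 * Real.pi * Complex.I * ∑ n ∈ s, (∏ k ∈ s.erase n, (a n - a k)⁻¹) * g (a n) := by
  have hne : ∀ z ∈ Metric.sphere (0 : ℂ) 1, ∀ k ∈ s, z - a k ≠ 0 := by
    intro z hz k hk h
    have := hlt k hk
    rw [← sub_eq_zero.1 h, mem_sphere_zero_iff_norm.1 hz] at this
    exact lt_irrefl _ this
  have e : (∮ z in C(0, 1), g z * ∏ k ∈ s, (z - a k)⁻¹)
      = ∮ z in C(0, 1), ∑ n ∈ s, (∏ k ∈ s.erase n, (a n - a k)⁻¹) * ((z - a n)⁻¹ • g z) := by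
    refine circleIntegral.integral_congr zero_le_one fun z hz => ?_
    simp only [smul_eq_mul]
    rw [prod_inv_sub_eq_sum hs ha fun k hk => sub_ne_zero.1 (hne z hz k hk), Finset.mul_sum]
    exact Finset.sum_congr rfl fun n _ => by ring
  have hcont : ∀ n ∈ s, ContinuousOn (fun z => (∏ k ∈ s.erase n, (a n - a k)⁻¹)
      * ((z - a n)⁻¹ • g z)) (Metric.sphere 0 1) := fun n hn =>
    continuousOn_const.mul (((continuousOn_id.sub continuousOn_const).inv₀
      fun z hz => hne z hz n hn).smul (hg.continuousOn.mono Metric.sphere_subset_closedBall))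
  rw [e, circleIntegral.integral_fun_sum fun n hn => (hcont n hn).circleIntegrable zero_le_one,
    Finset.mul_sum]
  refine Finset.sum_congr rfl fun n hn => ?_
  rw [circleIntegral.integral_const_mul,
    hg.circleIntegral_sub_inv_smul (mem_ball_zero_iff.2 (hlt n hn)), smul_eq_mul]
  ring

/-- In `z = exp(iφ)` this separates the zeros `exp(iα + Y)` and `exp(iα - Y)`, which for `Re Y > 0`
and real `α` lie outside and inside the unit circle. -/
theorem two_mul_cosh_sub_cos_sub (Y φ α : ℂ) :
    2 * (Complex.cosh Y - Complex.cos (φ - α))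
      = (Complex.exp Y - Complex.exp (φ * Complex.I) * Complex.exp (-(α * Complex.I)))
        * (Complex.exp (φ * Complex.I) - Complex.exp (α * Complex.I) * Complex.exp (-Y))
        * (Complex.exp (φ * Complex.I))⁻¹ := by
  have e1 : Complex.exp Y * Complex.exp (-Y) = 1 := by rw [← Complex.exp_add]; simp
  have e2 : Complex.exp (α * Complex.I) * Complex.exp (-(α * Complex.I)) = 1 := by
    rw [← Complex.exp_add]; simp
  have e3 := mul_inv_cancel₀ (Complex.exp_ne_zero (φ * Complex.I))
  rw [Complex.cosh, Complex.cos, show (φ - α) * Complex.I = φ * Complex.I + -(α * Complex.I) by ring,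
    show -(φ - α) * Complex.I = -(φ * Complex.I) + α * Complex.I by ring, Complex.exp_add,
    Complex.exp_add, Complex.exp_neg (φ * Complex.I)]
  generalize Complex.exp Y = y at *
  generalize Complex.exp (-Y) = y' at *
  generalize Complex.exp (φ * Complex.I) = z at *
  generalize Complex.exp (α * Complex.I) = t at *
  generalize Complex.exp (-(α * Complex.I)) = t' at *
  linear_combination (-y + z * t' - t * t' * y') * e3 + t * z⁻¹ * e1 - y' * e2

theorem sin_sq_eq (φ : ℂ) : Complex.sin φ ^ 2
    = -(Complex.exp (φ * Complex.I) ^ 2 - 1) ^ 2 / 4 * (Complex.exp (φ * Complex.I))⁻¹ ^ 2 := by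
  have e3 := mul_inv_cancel₀ (Complex.exp_ne_zero (φ * Complex.I))
  rw [Complex.sin, neg_mul, Complex.exp_neg]
  generalize Complex.exp (φ * Complex.I) = z at *
  have : (z ^ 2 - 1) ^ 2 * z⁻¹ ^ 2 = (z - z⁻¹) ^ 2 := by
    rw [← mul_pow, sub_mul, pow_two z, mul_assoc, e3, mul_one, one_mul]
  linear_combination (z⁻¹ - z) ^ 2 / 4 * Complex.I_sq + this / 4

/-- The residues at the poles inside the unit circle, summed. -/
theorem integral_sin_sq_mul_modeProduct {Nx : ℕ} (hNx : 2 < Nx) {Y : ℕ → ℂ}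
    (hY : ∀ k < Nx, 0 < (Y k).re) (θ : ℝ)
    (hinj : Set.InjOn (fun k : ℕ => Complex.exp (Complex.I * θ * k) * Complex.exp (-Y k))
      (Set.Iio Nx)) :
    1 / Real.pi * ∫ φ in (0 : ℝ)..2 * Real.pi, (Real.sin φ : ℂ) ^ 2 * modeProduct Nx Y θ φ
      = ∑ n ∈ Finset.range Nx, Complex.sin (θ * n + Complex.I * Y n) ^ 2 / Complex.sinh (Y n)
        * ∏ k ∈ (Finset.range Nx).erase n, 1 / (2 * (Complex.cosh (Y k)
          - Complex.cos (θ * ((n : ℂ) - k) + Complex.I * Y n))) := by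
  set a : ℕ → ℂ := fun k => Complex.exp (Complex.I * θ * k) * Complex.exp (-Y k) with ha
  set b : ℕ → ℂ → ℂ := fun k z => Complex.exp (Y k) - z * Complex.exp (-(θ * k * Complex.I)) with hb
  -- The part of the integrand holomorphic on the closed disc. The power of `z` collects `-2` from
  -- `sin²`, `Nx` from the mode factors and `-1` from `dφ = dz/(iz)`; for `Nx ≥ 3` there is no pole
  -- at the origin.
  set g : ℂ → ℂ := fun z => -(z ^ 2 - 1) ^ 2 / 4 * z ^ (Nx - 3)
    * ∏ k ∈ Finset.range Nx, (b k z)⁻¹ with hg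
  have hfac : ∀ (k : ℕ) (φ : ℂ), 2 * (Complex.cosh (Y k) - Complex.cos (φ - θ * k))
      = b k (Complex.exp (φ * Complex.I)) * (Complex.exp (φ * Complex.I) - a k)
        * (Complex.exp (φ * Complex.I))⁻¹ := fun k φ => by
    rw [two_mul_cosh_sub_cos_sub, ha, hb]
    simp only
    rw [show Complex.I * θ * k = θ * k * Complex.I by ring]
  have hlt : ∀ k ∈ Finset.range Nx, ‖a k‖ < 1 := by
    intro k hk
    simp only [ha]
    rw [norm_mul, show Complex.I * θ * k = ((θ * k : ℝ) : ℂ) * Complex.I by push_cast; ring,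
      Complex.norm_exp_ofReal_mul_I, one_mul, Complex.norm_exp, Real.exp_lt_one_iff, Complex.neg_re]
    exact neg_lt_zero.2 (hY k (Finset.mem_range.1 hk))
  have hb0 : ∀ k ∈ Finset.range Nx, ∀ z ∈ Metric.closedBall (0 : ℂ) 1, b k z ≠ 0 := by
    intro k hk z hz h
    have h1 : 1 < ‖Complex.exp (Y k)‖ := by
      rw [Complex.norm_exp]; exact Real.one_lt_exp_iff.2 (hY k (Finset.mem_range.1 hk))
    rw [sub_eq_zero.1 h, norm_mul, show -(θ * k * Complex.I) = ((-(θ * k) : ℝ) : ℂ) * Complex.I by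
      push_cast; ring, Complex.norm_exp_ofReal_mul_I, mul_one] at h1
    exact absurd (mem_closedBall_zero_iff.1 hz) (not_le.2 h1)
  have hgd : DifferentiableOn ℂ g (Metric.closedBall 0 1) := by
    refine DifferentiableOn.mul (by fun_prop) (DifferentiableOn.fun_finsetProd fun k hk => ?_)
    exact DifferentiableOn.inv (by fun_prop) (hb0 k hk)
  have hres := circleIntegral_mul_prod_inv_sub (s := Finset.range Nx)
    (Finset.nonempty_range_iff.2 (by omega)) (a := a) (by simpa using hinj) hlt hgd
  have hpow : ∀ z : ℂ, z ≠ 0 → z⁻¹ ^ 2 * z ^ Nx = z ^ (Nx - 3) * z := by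
    intro z hz
    obtain ⟨m, rfl⟩ : ∃ m, Nx = m + 3 := ⟨Nx - 3, by omega⟩
    rw [Nat.add_sub_cancel]
    field_simp
    ring
  have hcirc : (∮ z in C(0, 1), g z * ∏ k ∈ Finset.range Nx, (z - a k)⁻¹)
      = Complex.I * ∫ φ in (0 : ℝ)..2 * Real.pi, (Real.sin φ : ℂ) ^ 2 * modeProduct Nx Y θ φ := by
    rw [circleIntegral, ← intervalIntegral.integral_const_mul]
    refine intervalIntegral.integral_congr fun φ _ => ?_
    simp only [deriv_circleMap, smul_eq_mul, circleMap, Complex.ofReal_one, one_mul, zero_add]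
    have hz := Complex.exp_ne_zero (φ * Complex.I)
    rw [modeProduct, Complex.ofReal_sin, sin_sq_eq]
    simp only [hfac, mul_inv, inv_inv, Finset.prod_mul_distrib, Finset.prod_const, Finset.card_range, hg]
    linear_combination (-(-(Complex.exp (φ * Complex.I) ^ 2 - 1) ^ 2 / 4 * Complex.I
      * (∏ k ∈ Finset.range Nx, (b k (Complex.exp (φ * Complex.I)))⁻¹)
      * ∏ k ∈ Finset.range Nx, (Complex.exp (φ * Complex.I) - a k)⁻¹)) * hpow _ hz
  have hpi : (Real.pi : ℂ) ≠ 0 := Complex.ofReal_ne_zero.2 Real.pi_ne_zero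
  have hI : ∫ φ in (0 : ℝ)..2 * Real.pi, (Real.sin φ : ℂ) ^ 2 * modeProduct Nx Y θ φ
      = 2 * Real.pi * ∑ n ∈ Finset.range Nx,
        (∏ k ∈ (Finset.range Nx).erase n, (a n - a k)⁻¹) * g (a n) := by
    refine mul_left_cancel₀ Complex.I_ne_zero ?_
    rw [← hcirc, hres]
    ring
  rw [hI, show ∀ x : ℂ, 1 / (Real.pi : ℂ) * (2 * Real.pi * x) = 2 * x by
    intro x; field_simp, Finset.mul_sum]
  refine Finset.sum_congr rfl fun n hn => ?_
  -- The pole `a n` sits at the complex angle `θ n + i Y_n`, so the residue is read off from the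
  -- integrand at this angle. This explains the arguments of the sine and cosines in the residue
  -- sum.
  have hz : Complex.exp ((θ * n + Complex.I * Y n) * Complex.I) = a n := by
    simp only [ha]
    rw [← Complex.exp_add]
    congr 1
    linear_combination Y n * Complex.I_sq
  have han : a n ≠ 0 := mul_ne_zero (Complex.exp_ne_zero _) (Complex.exp_ne_zero _)
  -- The outer factor of the mode `n` itself gives the hyperbolic sine in the denominator; its `2`
  -- cancels the `2` left from `2π / π`.
  have hsinh : b n (a n) = 2 * Complex.sinh (Y n) := by
    simp only [hb, ha]
    have e : Complex.exp (Complex.I * θ * n) * Complex.exp (-(θ * n * Complex.I)) = 1 := by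
      rw [← Complex.exp_add, show Complex.I * θ * n + -(θ * n * Complex.I) = 0 by ring,
        Complex.exp_zero]
    rw [Complex.sinh]
    linear_combination (-Complex.exp (-Y n)) * e
  have hfac' : ∀ k : ℕ, 2 * (Complex.cosh (Y k)
      - Complex.cos (θ * ((n : ℂ) - k) + Complex.I * Y n)) = b k (a n) * (a n - a k) * (a n)⁻¹ :=
    fun k => by
      rw [show (θ : ℂ) * ((n : ℂ) - k) + Complex.I * Y n = (θ * n + Complex.I * Y n) - θ * k by ring,
        hfac k, hz]
  rw [sin_sq_eq, hz]
  simp only [hfac', one_div, mul_inv, inv_inv, Finset.prod_mul_distrib, Finset.prod_const,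
    Finset.card_erase_of_mem hn, Finset.card_range, hg]
  rw [← Finset.mul_prod_erase _ _ hn, hsinh, mul_inv]
  have hpow' : (a n)⁻¹ ^ 2 * a n ^ (Nx - 1) = a n ^ (Nx - 3) := by
    obtain ⟨m, rfl⟩ : ∃ m, Nx = m + 3 := ⟨Nx - 3, by omega⟩
    rw [Nat.add_sub_cancel, show m + 3 - 1 = m + 2 by omega]
    field_simp
    ring
  rw [div_eq_mul_inv (_ * _) (Complex.sinh _), ← hpow']
  ring

theorem continuous_modeProduct {Nx : ℕ} {Y : ℕ → ℂ} (hY : ∀ k < Nx, 0 < (Y k).re) :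
    Continuous fun p : ℝ × ℝ => modeProduct Nx Y p.1 p.2 := by
  unfold modeProduct
  refine continuous_finsetProd _ fun k hk => Continuous.inv₀ (by fun_prop) fun p => ?_
  exact modeProduct_factor_ne_zero hY _ _ (Finset.mem_range.1 hk)

theorem continuous_modeProduct_right {Nx : ℕ} {Y : ℕ → ℂ} (hY : ∀ k < Nx, 0 < (Y k).re) (θ : ℝ)
    {u : ℝ → ℝ} (hu : Continuous u) : Continuous fun x => modeProduct Nx Y θ (u x) :=
  Continuous.comp (g := fun p : ℝ × ℝ => modeProduct Nx Y p.1 p.2) (f := fun x => (θ, u x))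
    (continuous_modeProduct hY) (continuous_const.prodMk hu)

theorem continuous_modeProduct_arccos {Nx : ℕ} {Y : ℕ → ℂ} (hY : ∀ k < Nx, 0 < (Y k).re) (θ : ℝ) (c : ℂ) :
    Continuous fun x : ℝ => c * modeProduct Nx Y θ (Real.arccos x) :=
  continuous_const.mul (continuous_modeProduct_right hY θ Real.continuous_arccos)

/-- Poles `k ≠ l` coincide only when `exp(i(k-l)θ) = exp(Y_k - Y_l)`. The left side has nonzero
derivative in `θ`, so it avoids any given value on a punctured neighbourhood. -/
theorem eventually_injOn_poles (Y : ℕ → ℂ) (n : ℕ) (θ₀ : ℝ) :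
    ∀ᶠ θ : ℝ in 𝓝[≠] θ₀,
      Set.InjOn (fun k : ℕ => Complex.exp (Complex.I * θ * k) * Complex.exp (-Y k)) (Set.Iio n) := by
  have key : ∀ k l : ℕ, k ≠ l → ∀ᶠ θ : ℝ in 𝓝[≠] θ₀,
      Complex.exp (Complex.I * θ * k) * Complex.exp (-Y k)
        ≠ Complex.exp (Complex.I * θ * l) * Complex.exp (-Y l) := by
    intro k l hkl
    have hd : HasDerivAt (fun θ : ℝ => Complex.exp (((k : ℂ) - l) * Complex.I * θ))
        (Complex.exp (((k : ℂ) - l) * Complex.I * θ₀) * (((k : ℂ) - l) * Complex.I * 1)) θ₀ :=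
      ((Complex.ofRealCLM.hasDerivAt (x := θ₀)).const_mul (((k : ℂ) - l) * Complex.I)).cexp
    have hd0 : Complex.exp (((k : ℂ) - l) * Complex.I * θ₀) * (((k : ℂ) - l) * Complex.I * 1) ≠ 0 :=
      mul_ne_zero (Complex.exp_ne_zero _) (mul_ne_zero (mul_ne_zero
        (sub_ne_zero.2 (Nat.cast_injective.ne hkl)) Complex.I_ne_zero) one_ne_zero)
    filter_upwards [hd.eventually_ne hd0 (c := Complex.exp (Y k - Y l))] with θ h heq
    refine h ?_
    rw [← Complex.exp_add, ← Complex.exp_add] at heq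
    have h2 := congrArg (fun z => z * Complex.exp (Y k - Complex.I * θ * l)) heq
    simp only [← Complex.exp_add] at h2
    rw [show ((k : ℂ) - l) * Complex.I * θ = Complex.I * θ * k + -Y k + (Y k - Complex.I * θ * l) by
      ring, h2]
    congr 1
    ring
  have h : ∀ k ∈ Finset.range n, ∀ᶠ θ : ℝ in 𝓝[≠] θ₀, ∀ l ∈ Finset.range n, k ≠ l →
      Complex.exp (Complex.I * θ * k) * Complex.exp (-Y k)
        ≠ Complex.exp (Complex.I * θ * l) * Complex.exp (-Y l) := fun k _ =>
    (eventually_all_finset _).2 fun l _ => by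
      by_cases hkl : k = l
      · exact Eventually.of_forall fun _ h => absurd hkl h
      · exact (key k l hkl).mono fun _ h _ => h
  filter_upwards [(eventually_all_finset _).2 h] with θ hθ k hk l hl heq
  by_contra hkl
  exact hθ k (Finset.mem_range.2 hk) l (Finset.mem_range.2 hl) hkl heq

theorem tX_re_pos {Nt Nx : ℕ} [NeZero Nt] {lam tau : ℂ} {k : ℕ} (h : 0 < (arcosh (coefC Nx lam tau k)).re) :
    0 < (tX Nt Nx lam tau k).re := by
  rw [tX, ← Complex.ofReal_natCast, Complex.re_ofReal_mul]
  exact mul_pos (Nat.cast_pos.2 (Nat.pos_of_ne_zero (NeZero.ne Nt))) h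

theorem residueSum_eq {Nt Nx : ℕ} (hNx : 2 < Nx) {lam tau : ℂ}
    (hY : ∀ k < Nx, 0 < (tX Nt Nx lam tau k).re)
    {θ : ℝ} (hinj : Set.InjOn (pole Nt Nx lam tau θ) (Set.Iio Nx)) :
    residueSum Nt Nx lam tau θ = prefactor Nt Nx lam tau
      * (1 / Real.pi * ∫ φ in (0 : ℝ)..2 * Real.pi, (Real.sin φ : ℂ) ^ 2
        * modeProduct Nx (tX Nt Nx lam tau) θ φ) := by
  rw [integral_sin_sq_mul_modeProduct hNx hY θ hinj]
  rfl

/-! ### The partition function and its limit formula -/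

section Amplitude

variable {Nt Nx : ℕ} [NeZero Nt] [NeZero Nx] (Ng : ℤ)

theorem coherentState_eq_arccos (hNx : 2 < Nx) {lam tau : ℂ} (hlam : lam ≠ 0) (htau : tau ≠ 0)
    (hC : ∀ k < Nx, 2 - 2 * tau * Complex.cos (2 * Real.pi * k / Nx) ≠ 0)
    (hY : ∀ k < Nx, 0 < (tX Nt Nx lam tau k).re) :
    (fun H : SU2 => coherentState (Nt := Nt) (Nx := Nx) Ng (lam, tau) (fun _ => 1) (lastSlice H))
      = fun H : SU2 => prefactor Nt Nx lam tau * modeProduct Nx (tX Nt Nx lam tau)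
        (twistAngle Nx Ng) (Real.arccos ((H : Matrix (Fin 2) (Fin 2) ℂ) 0 0).re) := by
  funext H
  have h := abs_le.1 (abs_SU2_re_le_one H)
  exact (coherentState_eq Ng hNx hlam htau hC hY H _ (Real.cos_arccos h.1 h.2).symm).2

theorem integrable_coherentState (hNx : 2 < Nx) {lam tau : ℂ} (hlam : lam ≠ 0) (htau : tau ≠ 0)
    (hC : ∀ k < Nx, 2 - 2 * tau * Complex.cos (2 * Real.pi * k / Nx) ≠ 0)
    (hY : ∀ k < Nx, 0 < (tX Nt Nx lam tau k).re) :
    Integrable (fun H : SU2 =>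
      coherentState (Nt := Nt) (Nx := Nx) Ng (lam, tau) (fun _ => 1) (lastSlice H)) haarSU2 := by
  rw [coherentState_eq_arccos Ng hNx hlam htau hC hY]
  have h : Continuous fun H : SU2 => prefactor Nt Nx lam tau * modeProduct Nx (tX Nt Nx lam tau)
      (twistAngle Nx Ng) (Real.arccos ((H : Matrix (Fin 2) (Fin 2) ℂ) 0 0).re) :=
    (continuous_modeProduct_arccos hY _ _).comp continuous_SU2_re
  exact h.integrable_of_hasCompactSupport (HasCompactSupport.of_compactSpace _)

/-- The class integral runs over `[0, π]`; the reflection symmetry of the integrand doubles it to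
the full circle needed for residues. No distinctness of the poles enters. -/
theorem partitionFunction_eq (hNx : 2 < Nx) {lam tau : ℂ} (hlam : lam ≠ 0) (htau : tau ≠ 0)
    (hC : ∀ k < Nx, 2 - 2 * tau * Complex.cos (2 * Real.pi * k / Nx) ≠ 0)
    (hY : ∀ k < Nx, 0 < (tX Nt Nx lam tau k).re) :
    partitionFunction Nt Nx Ng (lam, tau) = prefactor Nt Nx lam tau
      * (1 / Real.pi * ∫ φ in (0 : ℝ)..2 * Real.pi, (Real.sin φ : ℂ) ^ 2
        * modeProduct Nx (tX Nt Nx lam tau) (twistAngle Nx Ng) φ) := by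
  set P := prefactor Nt Nx lam tau
  set F : ℝ → ℂ := fun φ => (Real.sin φ : ℂ) ^ 2
    * (P * modeProduct Nx (tX Nt Nx lam tau) (twistAngle Nx Ng) φ) with hF
  have hFc : Continuous F := by
    exact Continuous.mul (by fun_prop)
      (continuous_const.mul (continuous_modeProduct_right hY _ continuous_id))
  -- Both angles describe the same conjugacy class, so `coherentState_eq` evaluates the same
  -- wave-function at each.
  have hsymm : ∀ φ, F (2 * Real.pi - φ) = F φ := by
    intro φ
    have h1 := (coherentState_eq (Nt := Nt) Ng hNx hlam htau hC hY (diagSU2 φ) φ (diagSU2_re φ)).2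
    have h2 := (coherentState_eq (Nt := Nt) Ng hNx hlam htau hC hY (diagSU2 φ) (2 * Real.pi - φ)
      (by rw [Real.cos_two_pi_sub, diagSU2_re])).2
    simp only [hF]
    rw [← h2, ← h1, Real.sin_two_pi_sub, Complex.ofReal_neg, neg_sq]
  have hint : ∀ x y : ℝ, IntervalIntegrable F volume x y := fun x y => hFc.intervalIntegrable x y
  have hdouble : ∫ φ in (0 : ℝ)..2 * Real.pi, F φ = 2 * ∫ φ in (0 : ℝ)..Real.pi, F φ := by
    rw [← intervalIntegral.integral_add_adjacent_intervals (hint 0 Real.pi) (hint Real.pi _)]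
    have h := intervalIntegral.integral_comp_sub_left F (2 * Real.pi) (a := 0) (b := Real.pi)
    simp only [hsymm] at h
    rw [sub_zero, show 2 * Real.pi - Real.pi = Real.pi by ring] at h
    rw [← h]
    ring
  have hlast : ∫ φ in (0 : ℝ)..2 * Real.pi, (Real.sin φ : ℂ) ^ 2
      * modeProduct Nx (tX Nt Nx lam tau) (twistAngle Nx Ng) φ * P
      = ∫ φ in (0 : ℝ)..2 * Real.pi, F φ :=
    intervalIntegral.integral_congr fun φ _ => by simp only [hF]; ring
  rw [intervalIntegral.integral_mul_const] at hlast
  rw [partitionFunction, coherentState_eq_arccos Ng hNx hlam htau hC hY,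
    integral_SU2_class (continuous_modeProduct_arccos hY (twistAngle Nx Ng) P)]
  have harc : ∫ φ in (0 : ℝ)..Real.pi, (Real.sin φ : ℂ) ^ 2
      * (P * modeProduct Nx (tX Nt Nx lam tau) (twistAngle Nx Ng) (Real.arccos (Real.cos φ)))
      = ∫ φ in (0 : ℝ)..Real.pi, F φ := by
    refine intervalIntegral.integral_congr fun φ hφ => ?_
    rw [Set.uIcc_of_le Real.pi_pos.le] at hφ
    simp only [hF, Real.arccos_cos hφ.1 hφ.2]
  rw [harc]
  linear_combination (-1 / (Real.pi : ℂ)) * (hlast.trans hdouble)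

/-- The angular integral depends continuously on `θ`, since its integrand has no singularity on the
circle, and it agrees with the residue sum at all nearby `θ ≠ γ`, where the poles are distinct. -/
theorem tendsto_residueSum (hNx : 2 < Nx) {lam tau : ℂ} (hlam : lam ≠ 0) (htau : tau ≠ 0)
    (hC : ∀ k < Nx, 2 - 2 * tau * Complex.cos (2 * Real.pi * k / Nx) ≠ 0)
    (hY : ∀ k < Nx, 0 < (tX Nt Nx lam tau k).re) :
    Tendsto (residueSum Nt Nx lam tau) (𝓝[≠] (twistAngle Nx Ng))
      (𝓝 (partitionFunction Nt Nx Ng (lam, tau))) := by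
  rw [partitionFunction_eq Ng hNx hlam htau hC hY]
  have hc : Continuous fun θ : ℝ => prefactor Nt Nx lam tau
      * (1 / Real.pi * ∫ φ in (0 : ℝ)..2 * Real.pi, (Real.sin φ : ℂ) ^ 2
        * modeProduct Nx (tX Nt Nx lam tau) θ φ) := by
    refine continuous_const.mul (continuous_const.mul ?_)
    refine intervalIntegral.continuous_parametric_intervalIntegral_of_continuous' ?_ _ _
    exact Continuous.mul (by fun_prop) (continuous_modeProduct hY)
  refine (hc.continuousAt.tendsto.mono_left nhdsWithin_le_nhds).congr' ?_
  filter_upwards [eventually_injOn_poles (tX Nt Nx lam tau) Nx (twistAngle Nx Ng)] with θ hθ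
  exact (residueSum_eq hNx hY hθ).symm

end Amplitude

end PonzanoRegge

end

theorem mainTheorem4 (Nt Nx : ℕ) [NeZero Nt] [NeZero Nx] (hNx : 2 < Nx) (Ng : ℤ)
    (lam tau : ℂ) (hlam : lam ≠ 0) (htau : tau ≠ 0) (hdec : lam ^ 2 + tau ^ 2 ≠ 1)
    (hC : ∀ k < Nx, 2 - 2 * tau * Complex.cos (2 * Real.pi * k / Nx) ≠ 0)
    (hX : ∀ k < Nx, 0 < (PonzanoRegge.arcosh (PonzanoRegge.coefC Nx lam tau k)).re) :
    -- the series converges absolutely for `|λ| + |τ| < 1`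
    (∀ (hh hv : PonzanoRegge.Site Nt Nx → PonzanoRegge.SU2),
      ∀ p ∈ PonzanoRegge.convergenceDomain,
        Summable (PonzanoRegge.coherentTerm Ng hh hv p)) ∧
    -- the boundary state in the amplitude is well defined at the couplings `(λ, τ)`
    (∀ H : PonzanoRegge.SU2, ∃! z : ℂ, PonzanoRegge.IsContinuedValue
      (PonzanoRegge.coherentSeries (Nt := Nt) (Nx := Nx) Ng (fun _ => 1)
        (PonzanoRegge.lastSlice H)) (lam, tau) z) ∧
    Integrable (fun H : PonzanoRegge.SU2 =>
      PonzanoRegge.coherentState (Nt := Nt) (Nx := Nx) Ng (lam, tau) (fun _ => 1)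
        (PonzanoRegge.lastSlice H)) PonzanoRegge.haarSU2 ∧
    -- the residue formula, if the poles are simple
    (Set.InjOn (PonzanoRegge.pole Nt Nx lam tau (PonzanoRegge.twistAngle Nx Ng)) (Set.Iio Nx) →
      PonzanoRegge.partitionFunction Nt Nx Ng (lam, tau) =
        PonzanoRegge.residueSum Nt Nx lam tau (PonzanoRegge.twistAngle Nx Ng)) ∧
    -- the residue formula in general, as a limit in the angle
    Tendsto (PonzanoRegge.residueSum Nt Nx lam tau)
      (𝓝[≠] (PonzanoRegge.twistAngle Nx Ng))
      (𝓝 (PonzanoRegge.partitionFunction Nt Nx Ng (lam, tau))) := by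
  have hY : ∀ k < Nx, 0 < (PonzanoRegge.tX Nt Nx lam tau k).re := fun k hk =>
    PonzanoRegge.tX_re_pos (hX k hk)
  refine ⟨fun hh hv p hp => (PonzanoRegge.hasSum_coherentTerm Ng hh hv hp).1.of_norm, fun H => ?_,
    PonzanoRegge.integrable_coherentState Ng hNx hlam htau hC hY, fun hinj => ?_,
    PonzanoRegge.tendsto_residueSum Ng hNx hlam htau hC hY⟩
  · have h := abs_le.1 (PonzanoRegge.abs_SU2_re_le_one H)
    exact (PonzanoRegge.coherentState_eq Ng hNx hlam htau hC hY H _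
      (Real.cos_arccos h.1 h.2).symm).1
  · rw [PonzanoRegge.partitionFunction_eq Ng hNx hlam htau hC hY,
      PonzanoRegge.residueSum_eq hNx hY hinj]
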